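/- All graphs are finite, simple and non-empty. Two adjacent vertices $u,v$ of a graph $G$ are twins if $N_G(u)\setminus\{v\}=N_G(v)\setminus\{u\}$, and a bubble of $G$ is a maximal set of pairwise twins. A bubble partition of $G$ is a partition $\mathcal V$ of $V(G)$ such that every $U\in\mathcal V$ is a union of bubbles and the simple graph obtained from $G$ by contracting every $U\in\mathcal V$ to a single vertex is a tree. Its independence number $\alpha(\mathcal V)$ is the largest independence number of an induced subgraph $G[U]$, $U\in\mathcal V$, and its width is the largest number of bubbles contained in a set $U\in\mathcal V$. For an integer $\alpha>0$ let $\mathrm{bw}_\alpha(G)$ be the smallest width of a bubble partition $\mathcal V$ of $G$ with $\alpha(\mathcal V)\le\alpha$ ($\infty$ if there is none), and let $\mathrm{BW}_\alpha$ be the class of graphs $G$ with $\mathrm{bw}_\alpha(G)<\infty$. An algorithm (on a random access machine with addition and subtraction at unit cost) on instances $I$ for which $G\in\mathrm{BW}_\alpha$ is the input graph is called FPT with respect to $\mathrm{bw}_\alpha(G)$ if there are a computable function $f$ and a constant $c$ such that its running time is at most $f(\mathrm{bw}_\alpha(G))\cdot|I|^c$, where $|I|$ is the bit length of the encoding of $I$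 (graphs being given by their adjacency matrices). Nothing is required of it when $G\notin\mathrm{BW}_\alpha$. **Statement.** Let $\alpha>0$ be an integer. Suppose that there is an algorithm, FPT with respect to $\mathrm{bw}_\alpha(G)$, that finds for every $G\in\mathrm{BW}_\alpha$ a bubble partition $\mathcal V$ of $G$ with $\alpha(\mathcal V)\le\alpha$ and width $\mathrm{bw}_\alpha(G)$. Then MaxCut on $\mathrm{BW}_\alpha$ is fixed-parameter tractable when parameterized by $\mathrm{bw}_\alpha(G)$: there is an algorithm, FPT with respect to $\mathrm{bw}_\alpha(G)$, that finds for every $G\in\mathrm{BW}_\alpha$ a maximum cut of $G$ (a set $S\subseteq V(G)$ for which the number of edges with exactly one endpoint in $S$ is largest possible), and there is an algorithm, FPT with respect to $\mathrm{bw}_\alpha(G)$, that decides for every $G\in\mathrm{BW}_\alpha$ and every integer $m\ge 0$ whether $G$ has a cut with at least $m$ edges. -/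

import Mathlib

open scoped Classical in
/-- The truth value of `p` as a number: `1` if `p` holds and `0` otherwise. -/
noncomputable def bit01 (p : Prop) : ℕ := if p then 1 else 0

/-! ### Random access machines

A program uses finitely many registers and finitely many memory banks (unbounded arrays), all
holding natural numbers.  The arithmetic is addition and truncated subtraction; every elementary
operation costs one step.  As there is no multiplication, a number can grow by at most one
bit per step, and this cost measure is polynomially related to Turing machine time. -/

/-- The memory of the machine: `reg x` is register `x`, `mem a i` is cell `i` of bank `a`. -/
structure RAMState where
  reg : ℕ → ℕ
  mem : ℕ → ℕ → ℕ

/-- Arithmetic expressions: constants, registers, memory reads (indirect addressing), sums and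
truncated differences. -/
inductive RAMExpr where
  | num (c : ℕ)
  | reg (x : ℕ)
  | read (a : ℕ) (i : RAMExpr)
  | add (e₁ e₂ : RAMExpr)
  | sub (e₁ e₂ : RAMExpr)

def RAMExpr.eval (s : RAMState) : RAMExpr → ℕ
  | .num c => c
  | .reg x => s.reg x
  | .read a i => s.mem a (i.eval s)
  | .add e₁ e₂ => e₁.eval s + e₂.eval s
  | .sub e₁ e₂ => e₁.eval s - e₂.eval s

/-- The number of elementary operations needed to evaluate an expression. -/
def RAMExpr.cost : RAMExpr → ℕ
  | .num _ => 1
  | .reg _ => 1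
  | .read _ i => i.cost + 1
  | .add e₁ e₂ => e₁.cost + e₂.cost + 1
  | .sub e₁ e₂ => e₁.cost + e₂.cost + 1

/-- Programs of the random access machine.  `assign x e` writes the value of `e` to register `x`;
`store a i e` writes the value of `e` to cell `i` of bank `a`; `cond e p q` runs `p` if `e` is
nonzero and `q` otherwise; `loop e p` repeats `p` as long as `e` is nonzero. -/
inductive RAMProg where
  | skip
  | assign (x : ℕ) (e : RAMExpr)
  | store (a : ℕ) (i e : RAMExpr)
  | seq (p q : RAMProg)
  | cond (e : RAMExpr) (p q : RAMProg)
  | loop (e : RAMExpr) (p : RAMProg)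

def RAMState.setReg (s : RAMState) (x v : ℕ) : RAMState :=
  { s with reg := Function.update s.reg x v }

def RAMState.setMem (s : RAMState) (a i v : ℕ) : RAMState :=
  { s with mem := Function.update s.mem a (Function.update (s.mem a) i v) }

/-- `p.Run s s' t`: started in state `s`, the program `p` halts in state `s'` after exactly `t`
steps. (Execution is deterministic.) -/
inductive RAMProg.Run : RAMProg → RAMState → RAMState → ℕ → Prop
  | skip (s : RAMState) : Run .skip s s 1
  | assign (x : ℕ) (e : RAMExpr) (s : RAMState) :
      Run (.assign x e) s (s.setReg x (e.eval s)) (e.cost + 1)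
  | store (a : ℕ) (i e : RAMExpr) (s : RAMState) :
      Run (.store a i e) s (s.setMem a (i.eval s) (e.eval s)) (i.cost + e.cost + 1)
  | seq {p q : RAMProg} {s s' s'' : RAMState} {t t' : ℕ} :
      Run p s s' t → Run q s' s'' t' → Run (.seq p q) s s'' (t + t')
  | cond_true {e : RAMExpr} {p q : RAMProg} {s s' : RAMState} {t : ℕ} :
      e.eval s ≠ 0 → Run p s s' t → Run (.cond e p q) s s' (e.cost + 1 + t)
  | cond_false {e : RAMExpr} {p q : RAMProg} {s s' : RAMState} {t : ℕ} :
      e.eval s = 0 → Run q s s' t → Run (.cond e p q) s s' (e.cost + 1 + t)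
  | loop_done {e : RAMExpr} {p : RAMProg} {s : RAMState} :
      e.eval s = 0 → Run (.loop e p) s s (e.cost + 1)
  | loop_step {e : RAMExpr} {p : RAMProg} {s s' s'' : RAMState} {t t' : ℕ} :
      e.eval s ≠ 0 → Run p s s' t → Run (.loop e p) s' s'' t' →
      Run (.loop e p) s s'' (e.cost + 1 + t + t')

/-- The initial state on an input word `w`: register `0` holds the length of `w`, bank `0` holds
the entries of `w`, and everything else is zero. -/
def RAMState.init (w : List ℕ) : RAMState where
  reg := fun x => if x = 0 then w.length else 0
  mem := fun a i => if a = 0 then w.getD i 0 else 0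

/-- The output word of a final state: its length is in register `0`, its entries in bank `0`. -/
def RAMState.output (s : RAMState) : List ℕ :=
  (List.range (s.reg 0)).map (s.mem 0)

/-- On input `w`, the program `p` halts with output `w'` after exactly `t` steps. -/
def RAMProg.Outputs (p : RAMProg) (w w' : List ℕ) (t : ℕ) : Prop :=
  ∃ s, p.Run (RAMState.init w) s t ∧ s.output = w'

/-- The length `|w|` of an input word, in bits, with one separator for each entry. -/
def bitLength (w : List ℕ) : ℕ := (w.map fun x => Nat.size x + 1).sum

/-! ### Fixed-parameter tractability -/

/-- There is an algorithm which, for every instance `x` with `dom x`, computes from the encoding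
`enc x` a word `out` with `sol x out` in time at most `f (param x) * |enc x| ^ c`, where `f` is a
computable function and `c` a constant. Nothing is required outside `dom`. -/
def FPTSolvable {I : Type} (enc : I → List ℕ) (dom : I → Prop) (param : I → ℕ)
    (sol : I → List ℕ → Prop) : Prop :=
  ∃ (p : RAMProg) (f : ℕ → ℕ) (c : ℕ), Computable f ∧
    ∀ x, dom x → ∃ out t, p.Outputs (enc x) out t ∧ sol x out ∧
      t ≤ f (param x) * bitLength (enc x) ^ c

/-- The decision problem with set of yes-instances `yes`, restricted to the instances in `dom` and
parameterized by `param`, is fixed-parameter tractable (answer `1` for yes, `0` for no). -/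
def FPTDecidable {I : Type} (enc : I → List ℕ) (dom : I → Prop) (param : I → ℕ)
    (yes : I → Prop) : Prop :=
  FPTSolvable enc dom param fun x out => out = [bit01 (yes x)]

/-! ### Bubbles and bubble partitions -/

section Bubbles

variable {V : Type} [Fintype V] [DecidableEq V] (G : SimpleGraph V)

/-- (True) twins: adjacent vertices with the same neighbours apart from each other. -/
def AreTwins (u v : V) : Prop :=
  G.Adj u v ∧ G.neighborSet u \ {v} = G.neighborSet v \ {u}

/-- A bubble is an inclusion-maximal set of pairwise twins. -/
def IsBubble (B : Finset V) : Prop :=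
  Maximal (fun C : Finset V => (C : Set V).Pairwise (AreTwins G)) B

/-- `A` is a union of bubbles. -/
def IsUnionOfBubbles (A : Finset V) : Prop :=
  ∃ 𝓑 : Set (Finset V), (∀ B ∈ 𝓑, IsBubble G B) ∧ (A : Set V) = ⋃ B ∈ 𝓑, (B : Set V)

/-- The simple graph obtained from `G` by contracting every part of `P` to a single vertex. -/
def contractParts (P : Finpartition (Finset.univ : Finset V)) :
    SimpleGraph {A : Finset V // A ∈ P.parts} where
  Adj A B := A ≠ B ∧ ∃ u ∈ A.1, ∃ v ∈ B.1, G.Adj u v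
  symm := ⟨fun _ _ ⟨hne, u, hu, v, hv, h⟩ => ⟨hne.symm, v, hv, u, hu, h.symm⟩⟩
  loopless := ⟨fun _ h => h.1 rfl⟩

/-- A bubble partition: a partition of the vertex set into unions of bubbles whose contraction is
a tree. -/
def IsBubblePartition (P : Finpartition (Finset.univ : Finset V)) : Prop :=
  (∀ A ∈ P.parts, IsUnionOfBubbles G A) ∧ (contractParts G P).IsTree

/-- The number of bubbles contained in `A`. -/
noncomputable def bubbleCount (A : Finset V) : ℕ :=
  {B : Finset V | IsBubble G B ∧ B ⊆ A}.ncard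

/-- The independence number of a partition: the largest independence number of the subgraph
induced by a part. -/
noncomputable def partitionIndepNum (P : Finpartition (Finset.univ : Finset V)) : ℕ :=
  P.parts.sup fun A => (G.induce (A : Set V)).indepNum

/-- The width of a partition: the largest number of bubbles in a part. -/
noncomputable def partitionWidth (P : Finpartition (Finset.univ : Finset V)) : ℕ :=
  P.parts.sup (bubbleCount G)

/-- The `α`-bubble width of `G`: the smallest width of a bubble partition with independence number
at most `α`, and `⊤` if there is none. -/
noncomputable def bubbleWidth (α : ℕ) : ℕ∞ :=
  ⨅ (P : Finpartition (Finset.univ : Finset V)) (_ : IsBubblePartition G P)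
    (_ : partitionIndepNum G P ≤ α), (partitionWidth G P : ℕ∞)

/-! ### Cuts -/

/-- The number of edges of `G` with exactly one endpoint in `S`. -/
noncomputable def cutSize (S : Finset V) : ℕ :=
  {e | e ∈ G.edgeSet ∧ ∃ u ∈ S, ∃ v ∉ S, e = s(u, v)}.ncard

/-- `S` is (a side of) a maximum cut of `G`. -/
def IsMaxCut (S : Finset V) : Prop :=
  ∀ T : Finset V, cutSize G T ≤ cutSize G S

end Bubbles

/-! ### Graphs as inputs -/

/-- A finite simple graph on the vertices `0, …, n - 1`. -/
abbrev FinGraph : Type := Σ n : ℕ, SimpleGraph (Fin n)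

/-- The encoding of a graph: the number of vertices, then the adjacency matrix row by row. -/
noncomputable def encodeGraph (G : FinGraph) : List ℕ :=
  G.1 :: (List.ofFn fun u => List.ofFn fun v => bit01 (G.2.Adj u v)).flatten

/-- The class `BW_α` of the graphs of finite `α`-bubble width. -/
def InBW (α : ℕ) (G : FinGraph) : Prop := bubbleWidth G.2 α < ⊤

/-- The `α`-bubble width as a number, for graphs in `BW_α`. -/
noncomputable def bwParam (α : ℕ) (G : FinGraph) : ℕ := (bubbleWidth G.2 α).toNat

/-- The word `out` encodes the partition `P` of `{0, …, n - 1}`: it has `n` entries smaller than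
`n`, and two vertices have the same entry if and only if they lie in the same part. -/
def EncodesPartition {n : ℕ} (P : Finpartition (Finset.univ : Finset (Fin n)))
    (out : List ℕ) : Prop :=
  ∃ ℓ : Fin n → Fin n, out = List.ofFn (fun v => (ℓ v : ℕ)) ∧
    ∀ u v, ℓ u = ℓ v ↔ P.part u = P.part v

/-- The word `out` encodes a bubble partition of `G` which has independence number at most `α` and
width equal to the `α`-bubble width of `G`. -/
def IsOptimalBubblePartitionOutput (α : ℕ) (G : FinGraph) (out : List ℕ) : Prop :=
  ∃ P : Finpartition (Finset.univ : Finset (Fin G.1)), IsBubblePartition G.2 P ∧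
    partitionIndepNum G.2 P ≤ α ∧ (partitionWidth G.2 P : ℕ∞) = bubbleWidth G.2 α ∧
    EncodesPartition P out

/-- The word `out` is the 0/1 indicator vector of a maximum cut of `G`. -/
def IsMaxCutOutput (G : FinGraph) (out : List ℕ) : Prop :=
  ∃ S : Finset (Fin G.1), IsMaxCut G.2 S ∧ out = List.ofFn fun v => bit01 (v ∈ S)

/-! ### Total correctness with loop bounds -/

namespace RAMProg

/-! Call two vertices equivalent if their closed neighbourhoods agree; the classes are exactly the
bubbles. The cut size is a quadratic function of the indicator of a set and depends only on how many
vertices it takes from each class. Suppose a cut splits two adjacent classes X and Y properly.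
Moving one unit from X to Y changes the cut by exactly the negative of what the reverse move does,
because the second order terms cancel for adjacent classes. So in a maximum cut both moves are
neutral, whereas the sum of the squares of the numbers of vertices taken from the classes is
strictly convex along the move. A maximum cut that also maximizes this sum therefore splits no two
adjacent classes, and a further choice makes it meet every class in an initial segment
(`exists_canonical_cut`).

Split classes inside one part are thus pairwise non-adjacent, so there are at most `α` of them. The
trace of the canonical cut on a part with at most `k` bubbles is a union of bubbles, with at most `2
^ k` possibilities, modified in at most `α` classes, each modification being determined by the last
vertex taken. This gives a table of at most `(n + 1) ^ α * (n * 2 ^ k)` labelled candidate sets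
containing all traces (`mem_iterate_splitTable`, `length_unionTable`, `length_iterate_splitTable`).

The tree structure then permits dynamic programming. Repeatedly a leaf label is merged into its
neighbour: every candidate `T` of the neighbour is replaced by `T ∪ S` with a leaf candidate `S`
making the cut of `T ∪ S` largest. The table never grows. The invariant is that some maximum cut has
all its traces in the table; it survives because edges at the leaf region stay inside the two
regions (`cutN_exchange`, `Mergeful.merge`). When a single label is left, the best candidate is a
maximum cut.

The rest is a verified implementation. `Exec` proves correctness together with the static time bound
`bound N`, which is polynomial in `N` for a fixed program; `N` only has to dominate the number of
iterations of each loop. The syntactic write sets `wr` and `wm` give the frame conditions. The given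
partition algorithm runs with all registers and banks shifted by 50, so it cannot disturb the input,
and its output labels appear in bank 50. Banks 0 to 3 hold the matrix, the row offsets, the powers
of two and the twin relation, banks 4 and 5 the labels and masks of the table, and bank 6 a decoded
set. -/

/-- An upper bound for the running time when every loop is iterated at most `N` times per call. -/
def bound (N : ℕ) : RAMProg → ℕ
  | skip => 1
  | assign _ e => e.cost + 1
  | store _ i e => i.cost + e.cost + 1
  | seq p q => p.bound N + q.bound N
  | cond e p q => e.cost + 1 + p.bound N + q.bound N
  | loop e p => (N + 1) * (e.cost + 1 + p.bound N)

/-- Whether the program contains an assignment to register `x`. -/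
def wr (x : ℕ) : RAMProg → Bool
  | skip => false
  | assign y _ => y == x
  | store _ _ _ => false
  | seq p q => p.wr x || q.wr x
  | cond _ p q => p.wr x || q.wr x
  | loop _ p => p.wr x

/-- Whether the program contains a store to bank `a`. -/
def wm (a : ℕ) : RAMProg → Bool
  | skip => false
  | assign _ _ => false
  | store b _ _ => b == a
  | seq p q => p.wm a || q.wm a
  | cond _ p q => p.wm a || q.wm a
  | loop _ p => p.wm a

/-- Each loop contributes one factor `N + 1`, so the degree is governed by the structure of the
program alone. This is what turns an iteration bound into a running time. -/
theorem bound_poly (p : RAMProg) : ∃ C d, ∀ N, p.bound N ≤ C * (N + 1) ^ d := by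
  induction p with
  | skip => exact ⟨1, 0, fun N => by simp [bound]⟩
  | assign x e => exact ⟨e.cost + 1, 0, fun N => by simp [bound]⟩
  | store a i e => exact ⟨i.cost + e.cost + 1, 0, fun N => by simp [bound]⟩
  | seq p q hp hq =>
    obtain ⟨C, d, h⟩ := hp
    obtain ⟨C', d', h'⟩ := hq
    refine ⟨C + C', d + d', fun N => ?_⟩
    have h1 : (N + 1) ^ d ≤ (N + 1) ^ (d + d') := Nat.pow_le_pow_right (by lia) (by lia)
    have h2 : (N + 1) ^ d' ≤ (N + 1) ^ (d + d') := Nat.pow_le_pow_right (by lia) (by lia)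
    calc p.bound N + q.bound N ≤ C * (N + 1) ^ d + C' * (N + 1) ^ d' := add_le_add (h N) (h' N)
      _ ≤ C * (N + 1) ^ (d + d') + C' * (N + 1) ^ (d + d') := by gcongr
      _ = _ := by ring
  | cond e p q hp hq =>
    obtain ⟨C, d, h⟩ := hp
    obtain ⟨C', d', h'⟩ := hq
    refine ⟨e.cost + 1 + C + C', d + d', fun N => ?_⟩
    have h1 : (N + 1) ^ d ≤ (N + 1) ^ (d + d') := Nat.pow_le_pow_right (by lia) (by lia)
    have h2 : (N + 1) ^ d' ≤ (N + 1) ^ (d + d') := Nat.pow_le_pow_right (by lia) (by lia)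
    have h3 : 1 ≤ (N + 1) ^ (d + d') := Nat.one_le_pow _ _ (by lia)
    calc e.cost + 1 + p.bound N + q.bound N
        ≤ (e.cost + 1) * 1 + C * (N + 1) ^ d + C' * (N + 1) ^ d' := by
          have := h N; have := h' N; lia
      _ ≤ (e.cost + 1) * (N + 1) ^ (d + d') + C * (N + 1) ^ (d + d')
          + C' * (N + 1) ^ (d + d') := by gcongr
      _ = _ := by ring
  | loop e p hp =>
    obtain ⟨C, d, h⟩ := hp
    refine ⟨e.cost + 1 + C, d + 1, fun N => ?_⟩
    have h3 : 1 ≤ (N + 1) ^ d := Nat.one_le_pow _ _ (by lia)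
    calc (N + 1) * (e.cost + 1 + p.bound N)
        ≤ (N + 1) * ((e.cost + 1) * 1 + C * (N + 1) ^ d) := by
          have := h N; gcongr; lia
      _ ≤ (N + 1) * ((e.cost + 1) * (N + 1) ^ d + C * (N + 1) ^ d) := by gcongr
      _ = _ := by ring

/-! ### Frame conditions and Hoare rules -/

/-- `s'` agrees with `s` on all registers and banks that `p` does not write. -/
structure Same (p : RAMProg) (s s' : RAMState) : Prop where
  reg : ∀ x, p.wr x = false → s'.reg x = s.reg x
  mem : ∀ a, p.wm a = false → s'.mem a = s.mem a

theorem Same.refl (p : RAMProg) (s : RAMState) : p.Same s s := ⟨fun _ _ => rfl, fun _ _ => rfl⟩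

theorem Run.same {p : RAMProg} {s s' : RAMState} {t : ℕ} (h : p.Run s s' t) : p.Same s s' := by
  induction h with
  | skip s => exact .refl _ _
  | assign x e s =>
    refine ⟨fun y hy => ?_, fun _ _ => rfl⟩
    have : x ≠ y := by simpa [wr] using hy
    simp [RAMState.setReg, Function.update_of_ne this.symm]
  | store a i e s =>
    refine ⟨fun _ _ => rfl, fun b hb => ?_⟩
    have : a ≠ b := by simpa [wm] using hb
    simp [RAMState.setMem, Function.update_of_ne this.symm]
  | seq _ _ h1 h2 =>
    refine ⟨fun x hx => ?_, fun a ha => ?_⟩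
    · simp only [wr, Bool.or_eq_false_iff] at hx
      rw [h2.reg x hx.2, h1.reg x hx.1]
    · simp only [wm, Bool.or_eq_false_iff] at ha
      rw [h2.mem a ha.2, h1.mem a ha.1]
  | cond_true _ _ h1 =>
    refine ⟨fun x hx => ?_, fun a ha => ?_⟩
    · simp only [wr, Bool.or_eq_false_iff] at hx
      rw [h1.reg x hx.1]
    · simp only [wm, Bool.or_eq_false_iff] at ha
      rw [h1.mem a ha.1]
  | cond_false _ _ h1 =>
    refine ⟨fun x hx => ?_, fun a ha => ?_⟩
    · simp only [wr, Bool.or_eq_false_iff] at hx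
      rw [h1.reg x hx.2]
    · simp only [wm, Bool.or_eq_false_iff] at ha
      rw [h1.mem a ha.2]
  | loop_done _ => exact .refl _ _
  | loop_step _ _ _ h1 h2 =>
    exact ⟨fun x hx => (h2.reg x hx).trans (h1.reg x hx),
      fun a ha => (h2.mem a ha).trans (h1.mem a ha)⟩

/-- `p` halts from `s` in a state satisfying `Q`, within the time `p.bound N`. -/
def Exec (N : ℕ) (p : RAMProg) (s : RAMState) (Q : RAMState → Prop) : Prop :=
  ∃ s' t, p.Run s s' t ∧ t ≤ p.bound N ∧ Q s'

variable {N : ℕ} {p q : RAMProg} {s : RAMState} {Q R : RAMState → Prop}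

theorem Exec.mono (h : Exec N p s Q) (hQ : ∀ s', p.Same s s' → Q s' → R s') : Exec N p s R := by
  obtain ⟨s', t, h1, h2, h3⟩ := h
  exact ⟨s', t, h1, h2, hQ s' h1.same h3⟩

theorem Exec.skip (h : Q s) : Exec N skip s Q := ⟨s, _, .skip s, le_rfl, h⟩

theorem Exec.assign {x : ℕ} {e : RAMExpr} (h : Q (s.setReg x (e.eval s))) :
    Exec N (assign x e) s Q := ⟨_, _, .assign x e s, le_rfl, h⟩

theorem Exec.store {a : ℕ} {i e : RAMExpr} (h : Q (s.setMem a (i.eval s) (e.eval s))) :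
    Exec N (store a i e) s Q := ⟨_, _, .store a i e s, le_rfl, h⟩

theorem Exec.seq (h : Exec N p s fun s' => Exec N q s' Q) : Exec N (seq p q) s Q := by
  obtain ⟨s', t, h1, h2, s'', t', h3, h4, h5⟩ := h
  exact ⟨s'', _, .seq h1 h3, add_le_add h2 h4, h5⟩

/-- Sequential composition with the intermediate assertion and the frame of the first program. -/
theorem Exec.seq' (hp : Exec N p s R) (hq : ∀ s', p.Same s s' → R s' → Exec N q s' Q) :
    Exec N (.seq p q) s Q := .seq (hp.mono hq)

theorem Exec.cond {e : RAMExpr} (h1 : e.eval s ≠ 0 → Exec N p s Q)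
    (h2 : e.eval s = 0 → Exec N q s Q) : Exec N (cond e p q) s Q := by
  by_cases h : e.eval s = 0
  · obtain ⟨s', t, h3, h4, h5⟩ := h2 h
    exact ⟨s', _, .cond_false h h3, by simp only [bound]; lia, h5⟩
  · obtain ⟨s', t, h3, h4, h5⟩ := h1 h
    exact ⟨s', _, .cond_true h h3, by simp only [bound]; lia, h5⟩

/-- `for x < y do p`, with `x` and `y` registers. -/
def forp (x y : ℕ) (p : RAMProg) : RAMProg :=
  .seq (.assign x (.num 0))
    (.loop (.sub (.reg y) (.reg x)) (.seq p (.assign x (.add (.reg x) (.num 1)))))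

/-- The index `j` of the invariant is the exact number of remaining iterations, so it serves as the
termination measure and as the time count. The extra summand in `m + 1` pays for the final test. -/
theorem Exec.loop_countdown {e : RAMExpr} (I : ℕ → RAMState → Prop) (m : ℕ)
    (he : ∀ j s', I j s' → (e.eval s' = 0 ↔ j = 0))
    (step : ∀ j s', I (j + 1) s' → Exec N p s' (I j)) (h : I m s) :
    ∃ s' t, (RAMProg.loop e p).Run s s' t ∧
      t ≤ (m + 1) * (e.cost + 1 + p.bound N) ∧ I 0 s' := by
  induction m generalizing s with
  | zero =>
    refine ⟨s, _, .loop_done ((he 0 s h).2 rfl), ?_, h⟩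
    simp
  | succ m ih =>
    obtain ⟨s1, t1, h1, h2, h3⟩ := step m s h
    obtain ⟨s2, t2, h4, h5, h6⟩ := ih h3
    refine ⟨s2, _, .loop_step (fun h0 => ?_) h1 h4, ?_, h6⟩
    · have := (he _ s h).1 h0
      lia
    · rw [add_mul (m + 1), one_mul]
      lia

/-- The invariant rule for counting loops. -/
theorem Exec.forp {x y n : ℕ} (I : ℕ → RAMState → Prop) (hn : s.reg y = n) (hN : n ≤ N)
    (hxy : (x == y) = false) (hx : p.wr x = false) (hy : p.wr y = false)
    (h0 : I 0 (s.setReg x 0))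
    (step : ∀ i s', i < n → (forp x y p).Same s s' → s'.reg x = i → I i s' →
      Exec N p s' fun s'' => I (i + 1) (s''.setReg x (i + 1))) :
    Exec N (RAMProg.forp x y p) s (I n) := by
  have hxy' : x ≠ y := by simpa using hxy
  have hwy : (RAMProg.forp x y p).wr y = false := by
    simp [RAMProg.forp, wr, hxy', hy]
  have h00 : (RAMProg.forp x y p).Same s (s.setReg x 0) := by
    refine ⟨fun z hz => ?_, fun a ha => rfl⟩
    have : x ≠ z := by
      rintro rfl
      simp [RAMProg.forp, wr] at hz
    simp [RAMState.setReg, Function.update_of_ne this.symm]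
  obtain ⟨s', t, h1, h2, h3⟩ := Exec.loop_countdown (N := N)
    (e := .sub (.reg y) (.reg x)) (p := .seq p (.assign x (.add (.reg x) (.num 1))))
    (s := s.setReg x 0)
    -- Here `i` iterations are done and `j` remain. The frame relative to the start is carried
    -- along, so that bodies may use that unwritten registers and banks are unchanged.
    (fun j s' => ∃ i, i + j = n ∧ s'.reg x = i ∧ (RAMProg.forp x y p).Same s s' ∧ I i s') n
    (by
      rintro j s' ⟨i, hij, hi, hs, -⟩
      have := hs.reg y hwy
      simp only [RAMExpr.eval, this, hn, hi]
      lia)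
    (by
      rintro j s' ⟨i, hij, hi, hs, hI⟩
      refine Exec.seq' (step i s' (by lia) hs hi hI) fun s2 hs2 hI2 => Exec.assign ?_
      have hx2 : s2.reg x = i := (hs2.reg x hx).trans hi
      have hev : RAMExpr.eval s2 (.add (.reg x) (.num 1)) = i + 1 := by
        simp [RAMExpr.eval, hx2]
      rw [hev]
      refine ⟨i + 1, by lia, by simp [RAMState.setReg], ?_, hI2⟩
      refine ⟨fun z hz => ?_, fun a ha => ?_⟩
      · have hz' : ¬x = z ∧ p.wr z = false ∧ ¬x = z := by
          simpa [RAMProg.forp, wr] using hz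
        rw [← hs.reg z hz, ← hs2.reg z hz'.2.1]
        simp [RAMState.setReg, Function.update_of_ne (Ne.symm hz'.1)]
      · have ha' : p.wm a = false := by simpa [RAMProg.forp, wm] using ha
        rw [← hs.mem a ha, ← hs2.mem a ha']
        rfl)
    ⟨0, by lia, by simp [RAMState.setReg], h00, h0⟩
  obtain ⟨i, hi, -, -, hI⟩ := h3
  obtain rfl : i = n := by lia
  refine ⟨s', _, .seq (.assign x (.num 0) s) h1, ?_, hI⟩
  simp only [RAMProg.forp, bound] at h2 ⊢
  have : (i + 1) * ((RAMExpr.sub (.reg y) (.reg x)).cost + 1 +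
    (p.bound N + ((RAMExpr.add (.reg x) (.num 1)).cost + 1))) ≤
    (N + 1) * ((RAMExpr.sub (.reg y) (.reg x)).cost + 1 +
    (p.bound N + ((RAMExpr.add (.reg x) (.num 1)).cost + 1))) := by gcongr
  lia

/-! ### Renaming registers and banks -/

/-- Rename register `x` to `x + d` and bank `a` to `a + d` in an expression. -/
def _root_.RAMExpr.shift (d : ℕ) : RAMExpr → RAMExpr
  | .num c => .num c
  | .reg x => .reg (x + d)
  | .read a i => .read (a + d) (i.shift d)
  | .add e₁ e₂ => .add (e₁.shift d) (e₂.shift d)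
  | .sub e₁ e₂ => .sub (e₁.shift d) (e₂.shift d)

/-- Rename register `x` to `x + d` and bank `a` to `a + d` in a program. -/
def shift (d : ℕ) : RAMProg → RAMProg
  | skip => skip
  | assign x e => assign (x + d) (e.shift d)
  | store a i e => store (a + d) (i.shift d) (e.shift d)
  | seq p q => seq (p.shift d) (q.shift d)
  | cond e p q => cond (e.shift d) (p.shift d) (q.shift d)
  | loop e p => loop (e.shift d) (p.shift d)

/-- The part of the state seen by a shifted program. -/
def _root_.RAMState.unshift (d : ℕ) (s : RAMState) : RAMState where
  reg x := s.reg (x + d)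
  mem a := s.mem (a + d)

theorem eval_shift (d : ℕ) (e : RAMExpr) (s : RAMState) :
    (e.shift d).eval s = e.eval (s.unshift d) := by
  induction e with
  | num c => rfl
  | reg x => rfl
  | read a i ih => simp [RAMExpr.shift, RAMExpr.eval, ih, RAMState.unshift]
  | add e₁ e₂ h1 h2 => simp [RAMExpr.shift, RAMExpr.eval, h1, h2]
  | sub e₁ e₂ h1 h2 => simp [RAMExpr.shift, RAMExpr.eval, h1, h2]

theorem cost_shift (d : ℕ) (e : RAMExpr) : (e.shift d).cost = e.cost := by
  induction e <;> simp [RAMExpr.shift, RAMExpr.cost, *]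

theorem unshift_setReg (d x v : ℕ) (s : RAMState) :
    (s.setReg (x + d) v).unshift d = (s.unshift d).setReg x v := by
  simp only [RAMState.unshift, RAMState.setReg, RAMState.mk.injEq, and_true]
  ext z
  by_cases h : z = x
  · subst h; simp
  · simp [Function.update_of_ne, h]

theorem unshift_setMem (d a i v : ℕ) (s : RAMState) :
    (s.setMem (a + d) i v).unshift d = (s.unshift d).setMem a i v := by
  simp only [RAMState.unshift, RAMState.setMem, RAMState.mk.injEq, true_and]
  ext z
  by_cases h : z = a
  · subst h; simp
  · simp [Function.update_of_ne, h]

/-- The shifted program sees only the cells from `d` on, and there it performs the original run step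
by step, with the same costs. The cells below `d` are arbitrary. -/
theorem Run.shift {d : ℕ} {s₀ s₁ : RAMState} {t : ℕ} (h : p.Run s₀ s₁ t) :
    ∀ s, s.unshift d = s₀ → ∃ s', (p.shift d).Run s s' t ∧ s'.unshift d = s₁ := by
  induction h with
  | skip s => exact fun s hs => ⟨s, .skip s, hs⟩
  | assign x e s₀ =>
    rintro s rfl
    refine ⟨_, ?_, unshift_setReg d x _ s⟩
    rw [← eval_shift, ← cost_shift d]
    exact .assign _ _ s
  | store a i e s₀ =>
    rintro s rfl
    refine ⟨_, ?_, unshift_setMem d a _ _ s⟩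
    rw [← eval_shift, ← eval_shift, ← cost_shift d i, ← cost_shift d e]
    exact .store _ _ _ s
  | seq _ _ h1 h2 =>
    intro s hs
    obtain ⟨s', hr, hs'⟩ := h1 s hs
    obtain ⟨s'', hr', hs''⟩ := h2 s' hs'
    exact ⟨s'', .seq hr hr', hs''⟩
  | cond_true he _ h1 =>
    rintro s rfl
    obtain ⟨s', hr, hs'⟩ := h1 s rfl
    rw [← eval_shift] at he
    rw [← cost_shift d]
    exact ⟨s', .cond_true he hr, hs'⟩
  | cond_false he _ h1 =>
    rintro s rfl
    obtain ⟨s', hr, hs'⟩ := h1 s rfl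
    rw [← eval_shift] at he
    rw [← cost_shift d]
    exact ⟨s', .cond_false he hr, hs'⟩
  | loop_done he =>
    rintro s rfl
    rw [← eval_shift] at he
    rw [← cost_shift d]
    exact ⟨s, .loop_done he, rfl⟩
  | loop_step he _ _ h1 h2 =>
    rintro s rfl
    obtain ⟨s', hr, hs'⟩ := h1 s rfl
    obtain ⟨s'', hr', hs''⟩ := h2 s' hs'
    rw [← eval_shift] at he
    rw [← cost_shift d]
    exact ⟨s'', .loop_step he hr hr', hs''⟩

theorem wr_shift {d x : ℕ} (hx : x < d) (p : RAMProg) : (p.shift d).wr x = false := by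
  induction p <;> simp_all [RAMProg.shift, wr]
  lia

theorem wm_shift {d a : ℕ} (ha : a < d) (p : RAMProg) : (p.shift d).wm a = false := by
  induction p <;> simp_all [RAMProg.shift, wm]
  lia

end RAMProg

/-! ### Sets as bit masks, cuts -/

/-- The number whose binary digits are the indicator of `S`. -/
def mask (S : Finset ℕ) : ℕ := ∑ v ∈ S, 2 ^ v

theorem mask_union {S T : Finset ℕ} (h : Disjoint S T) : mask (S ∪ T) = mask S + mask T :=
  Finset.sum_union h

theorem mask_injective : Function.Injective mask := Finset.geomSum_injective le_rfl

theorem bit01_true {p : Prop} (h : p) : bit01 p = 1 := by simp [bit01, h]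

theorem bit01_false {p : Prop} (h : ¬p) : bit01 p = 0 := by simp [bit01, h]

theorem bit01_eq_zero {p : Prop} : bit01 p = 0 ↔ ¬p := by unfold bit01; split <;> simp_all

/-- The number of pairs `u ∈ S`, `v ∉ S` below `n` related by `A`. -/
noncomputable def cutN (n : ℕ) (A : ℕ → ℕ → Prop) (S : Finset ℕ) : ℕ :=
  ∑ u ∈ Finset.range n, ∑ v ∈ Finset.range n, bit01 (u ∈ S ∧ v ∉ S ∧ A u v)

/-- `u` and `v` have the same neighbours below `n`; for a reflexive relation this means that they
are equal or twins. -/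
def SameNbrs (n : ℕ) (A : ℕ → ℕ → Prop) (u v : ℕ) : Prop := ∀ z < n, (A u z ↔ A v z)

/-! ### Comparison expressions, decoding of masks and evaluation of cuts -/

namespace RAMProg

theorem reg_setReg (s : RAMState) (x v y : ℕ) :
    (s.setReg x v).reg y = if y = x then v else s.reg y := by
  simp [RAMState.setReg, Function.update_apply]

theorem mem_setReg (s : RAMState) (x v : ℕ) : (s.setReg x v).mem = s.mem := rfl

theorem reg_setMem (s : RAMState) (a i v : ℕ) : (s.setMem a i v).reg = s.reg := rfl

theorem mem_setMem_ne {a b : ℕ} (s : RAMState) (i v : ℕ) (h : b ≠ a) :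
    (s.setMem a i v).mem b = s.mem b := by
  simp [RAMState.setMem, Function.update_of_ne h]

theorem mem_setMem (s : RAMState) (a i v j : ℕ) :
    (s.setMem a i v).mem a j = if j = i then v else s.mem a j := by
  simp [RAMState.setMem, Function.update_apply]

/-- An expression which is nonzero if and only if `e` and `f` have different values. -/
def neE (e f : RAMExpr) : RAMExpr := .add (.sub e f) (.sub f e)

/-- An expression which is nonzero if and only if the value of `e` is at most that of `f`. -/
def leE (e f : RAMExpr) : RAMExpr := .sub (.add f (.num 1)) e

theorem eval_neE (s : RAMState) (e f : RAMExpr) :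
    (neE e f).eval s = 0 ↔ e.eval s = f.eval s := by
  simp only [neE, RAMExpr.eval]; lia

theorem eval_leE (s : RAMState) (e f : RAMExpr) :
    (leE e f).eval s = 0 ↔ f.eval s < e.eval s := by
  simp only [leE, RAMExpr.eval]; lia

/-- The entry of the square matrix in bank `a` in row `e` and column `f`; the row offsets are in
bank `1`. -/
def entry (a : ℕ) (e f : RAMExpr) : RAMExpr := .read a (.add (.read 1 e) f)

local infixr:60 " ;; " => RAMProg.seq

/-- Decode the mask in register `10` to bank `6`. -/
def decode : RAMProg :=
  forp 30 1 (
    .assign 31 (.sub (.sub (.reg 1) (.num 1)) (.reg 30)) ;;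
    .cond (leE (.read 2 (.reg 31)) (.reg 10))
      (.store 6 (.reg 31) (.num 1) ;; .assign 10 (.sub (.reg 10) (.read 2 (.reg 31))))
      (.store 6 (.reg 31) (.num 0)))

/-- Compute in register `11` the size of the cut given by bank `6`. -/
def cutVal : RAMProg :=
  .assign 11 (.num 0) ;;
  forp 32 1 (forp 33 1 (
    .assign 11 (.add (.reg 11) (.sub (.sub (.add (.read 6 (.reg 32))
      (entry 0 (.reg 32) (.reg 33))) (.read 6 (.reg 33))) (.num 1)))))

/-- Register `1` holds `n`, bank `0` the matrix of `A`, bank `2` the powers of two. -/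
structure Env (n : ℕ) (A : ℕ → ℕ → Prop) (s : RAMState) : Prop where
  size : s.reg 1 = n
  adj : ∀ u < n, ∀ v < n, s.mem 0 (s.mem 1 u + v) = bit01 (A u v)
  pow : ∀ v < n, s.mem 2 v = 2 ^ v

/-- For a concrete program the write sets are closed Boolean computations, so the side conditions
are discharged by `rfl`. -/
theorem Env.of_same {n : ℕ} {A : ℕ → ℕ → Prop} {s s' : RAMState} {p : RAMProg} (h : Env n A s)
    (hs : p.Same s s') (h1 : p.wr 1 = false := by rfl) (h2 : p.wm 0 = false := by rfl)
    (h3 : p.wm 1 = false := by rfl) (h4 : p.wm 2 = false := by rfl) : Env n A s' := by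
  refine ⟨?_, ?_, ?_⟩
  · rw [hs.reg 1 h1, h.size]
  · rw [hs.mem 0 h2, hs.mem 1 h3]; exact h.adj
  · rw [hs.mem 2 h4]; exact h.pow

theorem Env.setReg {n x v : ℕ} {A : ℕ → ℕ → Prop} {s : RAMState} (h : Env n A s)
    (hx : x ≠ 1 := by decide) : Env n A (s.setReg x v) :=
  ⟨by rw [reg_setReg, if_neg hx.symm, h.size], h.adj, h.pow⟩

variable {N n : ℕ} {A : ℕ → ℕ → Prop} {s : RAMState}

/-- Greedy reading of binary digits from the top: after `i` rounds register 10 holds the part of the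
mask below `n - i`, and the digits from `n - i` on have been written. -/
theorem exec_decode (hN : n ≤ N) (hE : Env n A s) {S : Finset ℕ} (hS : S ⊆ Finset.range n)
    (hm : s.reg 10 = mask S) :
    Exec N decode s fun s' => ∀ v < n, s'.mem 6 v = bit01 (v ∈ S) := by
  refine (Exec.forp (fun i s' => s'.reg 10 = mask (S.filter (· < n - i)) ∧
    ∀ v < n, n - i ≤ v → s'.mem 6 v = bit01 (v ∈ S)) hE.size hN rfl rfl rfl ?_ ?_).mono ?_
  · refine ⟨?_, fun v hv hv' => by lia⟩
    rw [reg_setReg, if_neg (by decide), hm, Finset.filter_true_of_mem]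
    intro v hv
    simpa using hS hv
  · rintro i s' hi hs hri ⟨hm', hb⟩
    have hE' := hE.of_same hs
    have h31 : n - i = n - 1 - i + 1 := by lia
    have hfil : S.filter (· < n - 1 - i + 1) =
        if n - 1 - i ∈ S then insert (n - 1 - i) (S.filter (· < n - 1 - i))
        else S.filter (· < n - 1 - i) := by
      ext v
      split_ifs with h
      · simp only [Finset.mem_filter, Finset.mem_insert, Nat.lt_succ_iff_lt_or_eq]
        constructor
        · rintro ⟨h1, h2 | h2⟩ <;> simp_all
        · rintro (rfl | ⟨h1, h2⟩) <;> simp_all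
      · simp only [Finset.mem_filter, Nat.lt_succ_iff_lt_or_eq]
        constructor
        · rintro ⟨h1, h2 | h2⟩ <;> simp_all
        · rintro ⟨h1, h2⟩; simp_all
    -- All lower digits together are less than the current power of two, so comparing the remainder
    -- with this power decides membership.
    have hlt : mask (S.filter (· < n - 1 - i)) < 2 ^ (n - 1 - i) :=
      Nat.geomSum_lt le_rfl (by simp)
    have hi' : n - (i + 1) = n - 1 - i := by lia
    rw [h31, hfil] at hm'
    refine Exec.seq (Exec.assign ?_)
    have e31 : (s'.setReg 31 (n - 1 - i)).reg 31 = n - 1 - i := by simp [reg_setReg]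
    simp only [RAMExpr.eval, hE'.size, hri]
    have hp : s'.mem 2 (n - 1 - i) = 2 ^ (n - 1 - i) := hE'.pow _ (by lia)
    refine Exec.cond (fun h => ?_) (fun h => ?_)
    · rw [Ne, eval_leE, not_lt] at h
      simp only [RAMExpr.eval, e31, mem_setReg, hp] at h
      simp only [reg_setReg] at h
      have hmem : n - 1 - i ∈ S := by
        by_contra hc
        rw [if_neg hc] at hm'
        simp at h
        lia
      rw [if_pos hmem, mask, Finset.sum_insert (by simp)] at hm'
      refine Exec.seq (Exec.store (Exec.assign ⟨?_, fun v hv hv' => ?_⟩))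
      · rw [hi']
        simp only [RAMExpr.eval, reg_setReg, reg_setMem, mem_setReg,
          mem_setMem_ne _ _ _ (show (2 : ℕ) ≠ 6 by decide)]
        simp [hp, hm', mask]
      · simp only [RAMExpr.eval, mem_setReg, mem_setMem, e31]
        split_ifs with hvi
        · rw [hvi, bit01_true hmem]
        · exact hb v hv (by lia)
    · rw [eval_leE] at h
      simp only [RAMExpr.eval, e31, mem_setReg, hp] at h
      simp only [reg_setReg] at h
      have hmem : n - 1 - i ∉ S := by
        intro hc
        rw [if_pos hc, mask, Finset.sum_insert (by simp)] at hm'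
        simp at h
        lia
      rw [if_neg hmem] at hm'
      refine Exec.store ⟨?_, fun v hv hv' => ?_⟩
      · rw [hi']
        simp [reg_setReg, reg_setMem, hm']
      · simp only [RAMExpr.eval, mem_setReg, mem_setMem, e31]
        split_ifs with hvi
        · rw [hvi, bit01_false hmem]
        · exact hb v hv (by lia)
  · rintro s' - ⟨-, h⟩ v hv
    exact h v hv (by lia)

theorem exec_cutVal (hN : n ≤ N) (hE : Env n A s) {S : Finset ℕ}
    (hb : ∀ v < n, s.mem 6 v = bit01 (v ∈ S)) :
    Exec N cutVal s fun s' => s'.reg 11 = cutN n A S := by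
  refine Exec.seq (Exec.assign ?_)
  refine Exec.forp (fun i s' => s'.reg 11 = ∑ u ∈ Finset.range i, ∑ v ∈ Finset.range n,
    bit01 (u ∈ S ∧ v ∉ S ∧ A u v)) hE.setReg.size hN rfl rfl rfl (by simp [reg_setReg, RAMExpr.eval]) ?_
  intro i s1 hi hs1 hri h11
  have hE1 := hE.setReg.of_same hs1
  refine (Exec.forp (fun j s' => s'.reg 11 = ∑ u ∈ Finset.range i, ∑ v ∈ Finset.range n,
    bit01 (u ∈ S ∧ v ∉ S ∧ A u v) + ∑ v ∈ Finset.range j, bit01 (i ∈ S ∧ v ∉ S ∧ A i v))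
    hE1.size hN rfl rfl rfl (by simp [reg_setReg, h11]) ?_).mono ?_
  · intro j s2 hj hs2 hrj h11'
    have hE2 := hE1.of_same hs2
    have hm6 : s2.mem 6 = s.mem 6 := (hs2.mem 6 rfl).trans (hs1.mem 6 rfl)
    have h32 : s2.reg 32 = i := (hs2.reg 32 rfl).trans hri
    refine Exec.assign ?_
    rw [Finset.sum_range_succ _ j, ← add_assoc, ← h11']
    simp only [RAMExpr.eval, entry, reg_setReg, hm6, h32, hrj, hb i hi, hb j hj, hE2.adj i hi j hj]
    simp only [show ¬(11 : ℕ) = 33 by decide, if_false, if_true, bit01]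
    -- With truncated subtraction, `a + e - b - 1` on bits is `1` exactly for `a = e = 1` and `b =
    -- 0`.
    by_cases h1 : i ∈ S <;> by_cases h2 : j ∈ S <;> by_cases h3 : A i j <;> simp [h1, h2, h3]
  · intro s2 _ h
    simp [reg_setReg, h, Finset.sum_range_succ _ i]

end RAMProg

namespace RAMProg

local infixr:60 " ;; " => RAMProg.seq

variable {N n : ℕ} {A : ℕ → ℕ → Prop} {s : RAMState}

/-! ### Tables of partial solutions -/

/-- The sets recorded for the label `x`: record `r < L` (register `2`) has its label in bank `4` and
its mask in bank `5`. -/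
def Fam (s : RAMState) (x : ℕ) : Set (Finset ℕ) :=
  {S | ∃ r < s.reg 2, s.mem 4 r = x ∧ s.mem 5 r = mask S}

/-- Among the sets recorded for the label in register `13`, find one whose union with the set in
register `12` has the largest cut. -/
def best : RAMProg :=
  .assign 14 (.num 0) ;; .assign 15 (.num 0) ;;
  forp 34 2 (
    .cond (neE (.read 4 (.reg 34)) (.reg 13)) .skip (
      .assign 10 (.add (.reg 12) (.read 5 (.reg 34))) ;;
      decode ;; cutVal ;;
      .cond (leE (.reg 15) (.reg 11))
        (.assign 15 (.add (.reg 11) (.num 1)) ;;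
          .assign 14 (.add (.reg 12) (.read 5 (.reg 34))))
        .skip))

theorem exec_best (hN : n ≤ N) (hL : s.reg 2 ≤ N) (hE : Env n A s) {T : Finset ℕ} {x : ℕ}
    (hT : T ⊆ Finset.range n) (h12 : s.reg 12 = mask T) (h13 : s.reg 13 = x)
    (hv : ∀ r < s.reg 2, s.mem 4 r = x →
      ∃ S, s.mem 5 r = mask S ∧ S ⊆ Finset.range n ∧ Disjoint T S)
    (hne : (Fam s x).Nonempty) :
    Exec N best s fun s' => ∃ S ∈ Fam s x, s'.reg 14 = mask (T ∪ S) ∧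
      s'.reg 15 = cutN n A (T ∪ S) + 1 ∧
      ∀ S' ∈ Fam s x, cutN n A (T ∪ S') ≤ cutN n A (T ∪ S) := by
  refine Exec.seq (Exec.assign (Exec.seq (Exec.assign ?_)))
  set s0 := (s.setReg 14 (RAMExpr.eval s (.num 0))).setReg 15
    (RAMExpr.eval (s.setReg 14 (RAMExpr.eval s (.num 0))) (.num 0)) with hs0
  -- Register 15 holds the best value plus one, so that `0` can mean that no record with the label
  -- has been met. The test `reg 15 ≤ reg 11` then accepts the first record and later exactly the
  -- strict improvements.
  refine (Exec.forp (n := s.reg 2) (fun i s' => (s'.reg 15 = 0 ∧ ∀ r < i, s.mem 4 r ≠ x) ∨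
    ∃ S ∈ Fam s x, s'.reg 14 = mask (T ∪ S) ∧ s'.reg 15 = cutN n A (T ∪ S) + 1 ∧
      ∀ r < i, ∀ S', s.mem 4 r = x → s.mem 5 r = mask S' →
        cutN n A (T ∪ S') ≤ cutN n A (T ∪ S)) (by simp [hs0, reg_setReg]) hL rfl rfl rfl ?_ ?_).mono ?_
  · left
    simp [hs0, reg_setReg, RAMExpr.eval]
  · intro i s1 hi hs1 hri hI
    have hE1 : Env n A s1 := (hE.setReg.setReg).of_same hs1
    have m4 : s1.mem 4 = s.mem 4 := hs1.mem 4 rfl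
    have m5 : s1.mem 5 = s.mem 5 := hs1.mem 5 rfl
    have r12 : s1.reg 12 = mask T := by
      rw [hs1.reg 12 rfl, ← h12]; simp [hs0, reg_setReg]
    have r13 : s1.reg 13 = x := by
      rw [hs1.reg 13 rfl, ← h13]; simp [hs0, reg_setReg]
    refine Exec.cond (fun h => Exec.skip ?_) (fun h => ?_)
    · rw [Ne, eval_neE] at h
      simp only [RAMExpr.eval, m4, hri, r13] at h
      simp only [reg_setReg]
      rcases hI with ⟨h1, h2⟩ | ⟨S, hS, h1, h2, h3⟩
      · left
        refine ⟨by simpa using h1, fun r hr => ?_⟩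
        rcases Nat.lt_succ_iff_lt_or_eq.1 hr with hr | rfl
        exacts [h2 r hr, h]
      · right
        refine ⟨S, hS, by simpa using h1, by simpa using h2, fun r hr => ?_⟩
        rcases Nat.lt_succ_iff_lt_or_eq.1 hr with hr | rfl
        exacts [h3 r hr, fun S' h' => absurd h' h]
    · rw [eval_neE] at h
      simp only [RAMExpr.eval, m4, hri, r13] at h
      obtain ⟨S, hS, hSn, hd⟩ := hv i hi h
      have hSF : S ∈ Fam s x := ⟨i, hi, h, hS⟩
      have hTS : T ∪ S ⊆ Finset.range n := Finset.union_subset hT hSn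
      refine Exec.seq (Exec.assign ?_)
      refine Exec.seq' (exec_decode hN (hE1.setReg) hTS ?_) fun s2 hs2 hb => ?_
      · simp [reg_setReg, RAMExpr.eval, r12, m5, hri, hS, mask_union hd]
      refine Exec.seq' (exec_cutVal hN ((hE1.setReg).of_same hs2) hb) fun s3 hs3 hc => ?_
      have g12 : s3.reg 12 = mask T := by
        rw [hs3.reg 12 rfl, hs2.reg 12 rfl, ← r12]; simp [reg_setReg]
      have g34 : s3.reg 34 = i := by
        rw [hs3.reg 34 rfl, hs2.reg 34 rfl, ← hri]; simp [reg_setReg]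
      have g14 : s3.reg 14 = s1.reg 14 := by
        rw [hs3.reg 14 rfl, hs2.reg 14 rfl]; simp [reg_setReg]
      have g15 : s3.reg 15 = s1.reg 15 := by
        rw [hs3.reg 15 rfl, hs2.reg 15 rfl]; simp [reg_setReg]
      have g5 : s3.mem 5 = s.mem 5 := by
        rw [hs3.mem 5 rfl, hs2.mem 5 rfl, mem_setReg, m5]
      refine Exec.cond (fun h' => ?_) (fun h' => Exec.skip ?_)
      · rw [Ne, eval_leE, not_lt] at h'
        simp only [RAMExpr.eval, g15, hc] at h'
        refine Exec.seq (Exec.assign (Exec.assign ?_))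
        simp only [RAMExpr.eval, reg_setReg, mem_setReg, hc, g12, g34, g5]
        right
        refine ⟨S, hSF, by simp [mask_union hd, hS], by simp, fun r hr S' h4 h5 => ?_⟩
        rcases Nat.lt_succ_iff_lt_or_eq.1 hr with hr | rfl
        · rcases hI with ⟨-, h2⟩ | ⟨S0, -, -, h2, h3⟩
          · exact absurd h4 (h2 r hr)
          · exact (h3 r hr S' h4 h5).trans (by lia)
        · rw [mask_injective (h5.symm.trans hS)]
      · rw [eval_leE] at h'
        simp only [RAMExpr.eval, g15, hc] at h'
        rcases hI with ⟨h1, -⟩ | ⟨S0, hS0, h1, h2, h3⟩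
        · lia
        · right
          refine ⟨S0, hS0, by simpa [reg_setReg, g14] using h1, by simpa [reg_setReg, g15] using h2,
            fun r hr S' h4 h5 => ?_⟩
          rcases Nat.lt_succ_iff_lt_or_eq.1 hr with hr | rfl
          · exact h3 r hr S' h4 h5
          · rw [mask_injective (h5.symm.trans hS)]
            lia
  · rintro s' - (⟨-, h⟩ | ⟨S, hS, h1, h2, h3⟩)
    · obtain ⟨S, r, hr, h4, -⟩ := hne
      exact absurd h4 (h r hr)
    · refine ⟨S, hS, h1, h2, ?_⟩
      rintro S' ⟨r, hr, h4, h5⟩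
      exact h3 r hr S' h4 h5

/-! ### Merging two labels in the table -/

/-- Replace every set `T` recorded for the label in register `17` by its best union with a set
recorded for the label in register `16`. -/
def mergeFam : RAMProg :=
  forp 35 2 (
    .cond (neE (.read 4 (.reg 35)) (.reg 17)) .skip (
      .assign 12 (.read 5 (.reg 35)) ;; .assign 13 (.reg 16) ;; best ;;
      .store 5 (.reg 35) (.reg 14)))

theorem exec_mergeFam (hN : n ≤ N) (hL : s.reg 2 ≤ N) (hE : Env n A s) {l p : ℕ} (hlp : l ≠ p)
    (h16 : s.reg 16 = l) (h17 : s.reg 17 = p) {X Y : Finset ℕ} (hX : X ⊆ Finset.range n)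
    (hY : Y ⊆ Finset.range n) (hXY : Disjoint X Y)
    (hl : ∀ r < s.reg 2, s.mem 4 r = l → ∃ S ⊆ X, s.mem 5 r = mask S)
    (hp : ∀ r < s.reg 2, s.mem 4 r = p → ∃ S ⊆ Y, s.mem 5 r = mask S)
    (hne : (Fam s l).Nonempty) :
    Exec N mergeFam s fun s' => ∀ r < s.reg 2,
      (s.mem 4 r ≠ p → s'.mem 5 r = s.mem 5 r) ∧
      ∀ T, s.mem 4 r = p → s.mem 5 r = mask T → ∃ S ∈ Fam s l, s'.mem 5 r = mask (T ∪ S) ∧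
        ∀ S' ∈ Fam s l, cutN n A (T ∪ S') ≤ cutN n A (T ∪ S) := by
  -- The table is overwritten in place. Records of other labels, and those not yet reached, still
  -- have their initial values.
  refine (Exec.forp (n := s.reg 2) (fun i s' => ∀ r < s.reg 2,
    (s.mem 4 r ≠ p ∨ i ≤ r → s'.mem 5 r = s.mem 5 r) ∧
      ∀ T, r < i → s.mem 4 r = p → s.mem 5 r = mask T →
        ∃ S ∈ Fam s l, s'.mem 5 r = mask (T ∪ S) ∧
        ∀ S' ∈ Fam s l, cutN n A (T ∪ S') ≤ cutN n A (T ∪ S)) rfl hL rfl rfl rfl ?_ ?_).mono ?_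
  · intro r _
    exact ⟨fun _ => rfl, fun T h => by lia⟩
  · intro i s1 hi hs1 hri hI
    have hE1 : Env n A s1 := hE.of_same hs1
    have m4 : s1.mem 4 = s.mem 4 := hs1.mem 4 rfl
    have r2 : s1.reg 2 = s.reg 2 := hs1.reg 2 rfl
    have r16 : s1.reg 16 = l := (hs1.reg 16 rfl).trans h16
    have r17 : s1.reg 17 = p := (hs1.reg 17 rfl).trans h17
    refine Exec.cond (fun h => Exec.skip ?_) (fun h => ?_)
    · rw [Ne, eval_neE] at h
      simp only [RAMExpr.eval, m4, hri, r17] at h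
      simp only [mem_setReg]
      intro r hr
      refine ⟨fun h' => (hI r hr).1 (h'.imp_right (by lia)), fun T hri hT => ?_⟩
      rcases Nat.lt_succ_iff_lt_or_eq.1 hri with h' | rfl
      exacts [(hI r hr).2 T h' hT, absurd hT h]
    · rw [eval_neE] at h
      simp only [RAMExpr.eval, m4, hri, r17] at h
      obtain ⟨T, hTY, hT⟩ := hp i hi h
      have hT1 : s1.mem 5 i = mask T := ((hI i hi).1 (Or.inr le_rfl)).trans hT
      refine Exec.seq (Exec.assign (Exec.seq (Exec.assign ?_)))
      set s2 := (s1.setReg 12 (RAMExpr.eval s1 (.read 5 (.reg 35)))).setReg 13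
        (RAMExpr.eval (s1.setReg 12 (RAMExpr.eval s1 (.read 5 (.reg 35)))) (.reg 16)) with hs2
      have f2 : s2.reg 2 = s.reg 2 := by simp [hs2, reg_setReg, r2]
      have f35 : s2.reg 35 = i := by simp [hs2, reg_setReg, hri]
      have f12 : s2.reg 12 = mask T := by simp [hs2, reg_setReg, RAMExpr.eval, hri, hT1]
      have f13 : s2.reg 13 = l := by simp [hs2, reg_setReg, RAMExpr.eval, r16]
      have f4 : s2.mem 4 = s.mem 4 := m4
      have f5 : s2.mem 5 = s1.mem 5 := rfl
      -- Since `l ≠ p`, the records from which the best partner is chosen are never overwritten.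
      have hFam : Fam s2 l = Fam s l := by
        ext S
        simp only [Fam, Set.mem_ofPred_eq, f2, f4, f5]
        refine exists_congr fun r => and_congr_right fun hr => and_congr_right fun h4 => ?_
        rw [(hI r hr).1 (Or.inl (by rw [h4]; exact hlp))]
      refine Exec.seq' (exec_best hN (f2.trans_le hL) (hE1.setReg.setReg) (hTY.trans hY) f12 f13
        ?_ (hFam ▸ hne)) ?_
      · rw [f2, f4, f5]
        intro r hr h4
        obtain ⟨S, hS, h5⟩ := hl r hr h4
        refine ⟨S, ?_, hS.trans hX, (hXY.mono hS hTY).symm⟩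
        rw [(hI r hr).1 (Or.inl (by rw [h4]; exact hlp)), h5]
      · rintro s3 hs3 ⟨S, hS, h14, -, hmax⟩
        rw [hFam] at hS hmax
        have g35 : s3.reg 35 = i := (hs3.reg 35 rfl).trans f35
        have g5 : s3.mem 5 = s1.mem 5 := (hs3.mem 5 rfl).trans f5
        refine Exec.store ?_
        simp only [mem_setReg, mem_setMem, RAMExpr.eval, g35, g5, h14]
        intro r hr
        refine ⟨fun h' => ?_, fun T' hri h4 hT' => ?_⟩
        · rw [if_neg (by rintro rfl; exact h'.elim (absurd h) (by lia))]
          exact (hI r hr).1 (h'.imp_right (by lia))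
        · rcases Nat.lt_succ_iff_lt_or_eq.1 hri with h' | rfl
          · rw [if_neg h'.ne]
            exact (hI r hr).2 T' h' h4 hT'
          · rw [if_pos rfl]
            rw [mask_injective (hT'.symm.trans hT)]
            exact ⟨S, hS, rfl, hmax⟩
  · intro s' _ h r hr
    exact ⟨fun h' => (h r hr).1 (Or.inl h'), fun T => (h r hr).2 T hr⟩

/-- Replace the label in register `16` by the label in register `17`. -/
def relabel : RAMProg :=
  forp 36 1 (.cond (neE (.read 50 (.reg 36)) (.reg 16)) .skip (.store 50 (.reg 36) (.reg 17)))

theorem exec_relabel (hN : n ≤ N) (h1 : s.reg 1 = n) {l p : ℕ} (h16 : s.reg 16 = l)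
    (h17 : s.reg 17 = p) :
    Exec N relabel s fun s' => ∀ v < n, s'.mem 50 v = if s.mem 50 v = l then p else s.mem 50 v := by
  refine (Exec.forp (fun i s' => ∀ v < n, s'.mem 50 v =
    if v < i ∧ s.mem 50 v = l then p else s.mem 50 v) h1 hN rfl rfl rfl ?_ ?_).mono ?_
  · intro v _
    simp [mem_setReg]
  · intro i s1 hi hs1 hri hI
    have r16 : s1.reg 16 = l := (hs1.reg 16 rfl).trans h16
    have r17 : s1.reg 17 = p := (hs1.reg 17 rfl).trans h17
    have hi' := hI i hi
    simp only [lt_irrefl, false_and, if_false] at hi'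
    refine Exec.cond (fun h => Exec.skip ?_) (fun h => Exec.store ?_)
    · rw [Ne, eval_neE] at h
      simp only [RAMExpr.eval, hri, r16, hi'] at h
      intro v hv
      rw [mem_setReg, hI v hv]
      rcases eq_or_ne v i with rfl | hvi
      · simp [h]
      · have : v < i + 1 ↔ v < i := by lia
        simp only [this]
    · rw [eval_neE] at h
      simp only [RAMExpr.eval, hri, r16, hi'] at h
      intro v hv
      simp only [mem_setReg, mem_setMem, RAMExpr.eval, hri, r17]
      rcases eq_or_ne v i with rfl | hvi
      · simp [h]
      · rw [if_neg hvi, hI v hv]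
        have : v < i + 1 ↔ v < i := by lia
        simp only [this]
  · intro s' _ h v hv
    simpa [hv] using h v hv

/-- The label of `u₀` can be merged into that of `w₀`: they are different, and all neighbours of
vertices with the label of `u₀` have one of the two labels. -/
def Mergeable (n : ℕ) (A : ℕ → ℕ → Prop) (lab : ℕ → ℕ) (u₀ w₀ : ℕ) : Prop :=
  lab u₀ ≠ lab w₀ ∧ ∀ u < n, ∀ v < n, lab u = lab u₀ → A u v → lab v = lab u₀ ∨ lab v = lab w₀

/-- Test in register `19` whether the labels of the vertices in registers `37` and `38` can be
merged. -/
def testMerge : RAMProg :=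
  .assign 19 (neE (.read 50 (.reg 37)) (.read 50 (.reg 38))) ;;
  forp 39 1 (.cond (neE (.read 50 (.reg 39)) (.read 50 (.reg 37))) .skip (
    forp 40 1 (.cond (entry 0 (.reg 39) (.reg 40))
      (.cond (neE (.read 50 (.reg 40)) (.read 50 (.reg 37)))
        (.cond (neE (.read 50 (.reg 40)) (.read 50 (.reg 38)))
          (.assign 19 (.num 0)) .skip) .skip) .skip)))

theorem exec_testMerge (hN : n ≤ N) (hE : Env n A s) {a b : ℕ} (h37 : s.reg 37 = a)
    (h38 : s.reg 38 = b) :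
    Exec N testMerge s fun s' => s'.reg 19 ≠ 0 ↔ Mergeable n A (s.mem 50) a b := by
  refine Exec.seq (Exec.assign ?_)
  set s0 := s.setReg 19 (RAMExpr.eval s (neE (.read 50 (.reg 37)) (.read 50 (.reg 38)))) with hs0
  have h19 : s0.reg 19 ≠ 0 ↔ s.mem 50 a ≠ s.mem 50 b := by
    have := eval_neE s (.read 50 (.reg 37)) (.read 50 (.reg 38))
    simp only [RAMExpr.eval, h37, h38] at this
    simp [hs0, reg_setReg, this]
  have i37 : s0.reg 37 = a := by simp [hs0, reg_setReg, h37]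
  have i38 : s0.reg 38 = b := by simp [hs0, reg_setReg, h38]
  have hE0 : Env n A s0 := hE.setReg
  have i50 : s0.mem 50 = s.mem 50 := rfl
  clear_value s0
  refine (Exec.forp (fun i s' => s'.reg 19 ≠ 0 ↔ s.mem 50 a ≠ s.mem 50 b ∧
    ∀ u < i, ∀ v < n, s.mem 50 u = s.mem 50 a → A u v →
      s.mem 50 v = s.mem 50 a ∨ s.mem 50 v = s.mem 50 b) hE0.size hN rfl rfl rfl ?_ ?_).mono ?_
  · simp [reg_setReg, ← h19]
  · intro i s1 hi hs1 hri hI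
    have hE1 := hE0.of_same hs1
    have m50 : s1.mem 50 = s.mem 50 := (hs1.mem 50 rfl).trans i50
    have r37 : s1.reg 37 = a := (hs1.reg 37 rfl).trans i37
    have r38 : s1.reg 38 = b := (hs1.reg 38 rfl).trans i38
    refine Exec.cond (fun h => Exec.skip ?_) (fun h => ?_)
    · rw [Ne, eval_neE] at h
      simp only [RAMExpr.eval, hri, m50, r37] at h
      simp only [reg_setReg, if_neg (show ¬(19 : ℕ) = 39 by decide)]
      rw [hI]
      refine and_congr_right fun _ => ⟨fun h' u hu => ?_, fun h' u hu => h' u (by lia)⟩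
      rcases Nat.lt_succ_iff_lt_or_eq.1 hu with h'' | rfl
      exacts [h' u h'', fun _ _ h3 => absurd h3 h]
    · rw [eval_neE] at h
      simp only [RAMExpr.eval, hri, m50, r37] at h
      refine (Exec.forp (fun j s' => s'.reg 19 ≠ 0 ↔ s1.reg 19 ≠ 0 ∧ ∀ v < j, A i v →
        s.mem 50 v = s.mem 50 a ∨ s.mem 50 v = s.mem 50 b) hE1.size hN rfl rfl rfl ?_ ?_).mono ?_
      · simp [reg_setReg]
      · intro j s2 hj hs2 hrj hJ
        have hE2 := hE1.of_same hs2
        have n50 : s2.mem 50 = s.mem 50 := (hs2.mem 50 rfl).trans m50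
        have n39 : s2.reg 39 = i := (hs2.reg 39 rfl).trans hri
        have n37 : s2.reg 37 = a := (hs2.reg 37 rfl).trans r37
        have n38 : s2.reg 38 = b := (hs2.reg 38 rfl).trans r38
        have hadj : (entry 0 (.reg 39) (.reg 40)).eval s2 = 0 ↔ ¬A i j := by
          simp [entry, RAMExpr.eval, n39, hrj, hE2.adj i hi j hj, bit01_eq_zero]
        -- Common conclusion of the three branches that leave the flag alone: the vertex `j`
        -- violates nothing.
        have key (hj' : A i j → s.mem 50 j = s.mem 50 a ∨ s.mem 50 j = s.mem 50 b) :
            (s2.setReg 40 (j + 1)).reg 19 ≠ 0 ↔ s1.reg 19 ≠ 0 ∧ ∀ v < j + 1, A i v →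
              s.mem 50 v = s.mem 50 a ∨ s.mem 50 v = s.mem 50 b := by
          simp only [reg_setReg, if_neg (show ¬(19 : ℕ) = 40 by decide)]
          rw [hJ]
          refine and_congr_right fun _ => ⟨fun h' u hu => ?_, fun h' u hu => h' u (by lia)⟩
          rcases Nat.lt_succ_iff_lt_or_eq.1 hu with h'' | rfl
          exacts [h' u h'', hj']
        refine Exec.cond (fun ha => Exec.cond (fun hb => Exec.cond (fun hc => Exec.assign ?_)
          (fun hc => Exec.skip (key fun _ => ?_))) (fun hb => Exec.skip (key fun _ => ?_)))
          (fun ha => Exec.skip (key fun h' => ?_))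
        · rw [Ne, hadj, not_not] at ha
          rw [Ne, eval_neE] at hb hc
          simp only [RAMExpr.eval, hrj, n50, n37, n38] at hb hc
          simp only [reg_setReg, RAMExpr.eval]
          simp only [show ¬(19 : ℕ) = 40 by decide, if_false, if_true, ne_eq, not_true, false_iff,
            not_and]
          intro _ h'
          exact (h' j (by lia) ha).elim hb hc
        · rw [eval_neE] at hc
          simp only [RAMExpr.eval, hrj, n50, n38] at hc
          exact Or.inr hc
        · rw [eval_neE] at hb
          simp only [RAMExpr.eval, hrj, n50, n37] at hb
          exact Or.inl hb
        · exact absurd h' (hadj.1 ha)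
      · intro s2 _ hJ
        simp only [reg_setReg, if_neg (show ¬(19 : ℕ) = 39 by decide)]
        rw [hJ, hI]
        constructor
        · rintro ⟨⟨h1, h2⟩, h3⟩
          refine ⟨h1, fun u hu v hv hua huv => ?_⟩
          rcases Nat.lt_succ_iff_lt_or_eq.1 hu with h'' | rfl
          exacts [h2 u h'' v hv hua huv, h3 v hv huv]
        · rintro ⟨h1, h2⟩
          exact ⟨⟨h1, fun u hu => h2 u (by lia)⟩, fun v hv => h2 i (by lia) v hv h⟩
  · intro s' _ h
    exact h

/-- Search two labels that can be merged; register `18` tells whether there are any. -/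
def search : RAMProg :=
  .assign 18 (.num 0) ;;
  forp 37 1 (forp 38 1 (testMerge ;;
    .cond (.reg 19)
      (.assign 18 (.num 1) ;; .assign 16 (.read 50 (.reg 37)) ;; .assign 17 (.read 50 (.reg 38)))
      .skip))

theorem exec_search (hN : n ≤ N) (hE : Env n A s) :
    Exec N search s fun s' =>
      (s'.reg 18 = 0 ∧ ∀ a < n, ∀ b < n, ¬Mergeable n A (s.mem 50) a b) ∨
      (s'.reg 18 ≠ 0 ∧ ∃ a < n, ∃ b < n, Mergeable n A (s.mem 50) a b ∧
        s'.reg 16 = s.mem 50 a ∧ s'.reg 17 = s.mem 50 b) := by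
  refine Exec.seq (Exec.assign ?_)
  set s0 := s.setReg 18 (RAMExpr.eval s (.num 0)) with hs0
  have hE0 : Env n A s0 := hE.setReg
  have i50 : s0.mem 50 = s.mem 50 := rfl
  have i18 : s0.reg 18 = 0 := by simp [hs0, reg_setReg, RAMExpr.eval]
  clear_value s0
  refine Exec.forp (fun i s' =>
      (s'.reg 18 = 0 ∧ ∀ a < i, ∀ b < n, ¬Mergeable n A (s.mem 50) a b) ∨
      (s'.reg 18 ≠ 0 ∧ ∃ a < n, ∃ b < n, Mergeable n A (s.mem 50) a b ∧
        s'.reg 16 = s.mem 50 a ∧ s'.reg 17 = s.mem 50 b)) hE0.size hN rfl rfl rfl ?_ ?_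
  · left
    simp [reg_setReg, i18]
  · intro i s1 hi hs1 hri hI
    have hE1 := hE0.of_same hs1
    have m50 : s1.mem 50 = s.mem 50 := (hs1.mem 50 rfl).trans i50
    refine (Exec.forp (fun j s' =>
      (s'.reg 18 = 0 ∧ (∀ a < i, ∀ b < n, ¬Mergeable n A (s.mem 50) a b) ∧
        ∀ b < j, ¬Mergeable n A (s.mem 50) i b) ∨
      (s'.reg 18 ≠ 0 ∧ ∃ a < n, ∃ b < n, Mergeable n A (s.mem 50) a b ∧
        s'.reg 16 = s.mem 50 a ∧ s'.reg 17 = s.mem 50 b)) hE1.size hN rfl rfl rfl ?_ ?_).mono ?_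
    · simpa [reg_setReg] using hI
    · intro j s2 hj hs2 hrj hJ
      have hE2 := hE1.of_same hs2
      have n50 : s2.mem 50 = s.mem 50 := (hs2.mem 50 rfl).trans m50
      have n37 : s2.reg 37 = i := (hs2.reg 37 rfl).trans hri
      refine Exec.seq' (exec_testMerge hN hE2 n37 hrj) fun s3 hs3 h3 => ?_
      rw [n50] at h3
      have k50 : s3.mem 50 = s.mem 50 := (hs3.mem 50 rfl).trans n50
      have k37 : s3.reg 37 = i := (hs3.reg 37 rfl).trans n37
      have k38 : s3.reg 38 = j := (hs3.reg 38 rfl).trans hrj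
      have k18 : s3.reg 18 = s2.reg 18 := hs3.reg 18 rfl
      have k16 : s3.reg 16 = s2.reg 16 := hs3.reg 16 rfl
      have k17 : s3.reg 17 = s2.reg 17 := hs3.reg 17 rfl
      refine Exec.cond (fun h => Exec.seq (Exec.assign (Exec.seq (Exec.assign (Exec.assign ?_)))))
        (fun h => Exec.skip ?_)
      · right
        simp only [reg_setReg, mem_setReg, RAMExpr.eval, k50, k37, k38]
        exact ⟨by simp, i, hi, j, hj, h3.1 h, by simp, by simp⟩
      · have h' : ¬Mergeable n A (s.mem 50) i j := fun h0 => h3.2 h0 h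
        simp only [reg_setReg, k18, k16, k17]
        rcases hJ with ⟨h1, h2, h4⟩ | h1
        · left
          refine ⟨by simpa using h1, h2, fun b hb => ?_⟩
          rcases Nat.lt_succ_iff_lt_or_eq.1 hb with h'' | rfl
          exacts [h4 b h'', h']
        · right
          simpa using h1
    · rintro s2 - (⟨h1, h2, h3⟩ | h1)
      · left
        refine ⟨by simpa [reg_setReg] using h1, fun a ha => ?_⟩
        rcases Nat.lt_succ_iff_lt_or_eq.1 ha with h'' | rfl
        exacts [h2 a h'', h3]
      · right
        simpa [reg_setReg] using h1

end RAMProg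

/-! ### Merging the labels along a tree -/

/-- The vertices below `n` with label `x`. -/
def region (n : ℕ) (lab : ℕ → ℕ) (x : ℕ) : Finset ℕ := (Finset.range n).filter (lab · = x)

theorem mem_region {n : ℕ} {lab : ℕ → ℕ} {x v : ℕ} : v ∈ region n lab x ↔ v < n ∧ lab v = x := by
  simp [region]

theorem region_subset (n : ℕ) (lab : ℕ → ℕ) (x : ℕ) : region n lab x ⊆ Finset.range n :=
  Finset.filter_subset _ _

theorem region_disjoint (n : ℕ) (lab : ℕ → ℕ) {x y : ℕ} (h : x ≠ y) :
    Disjoint (region n lab x) (region n lab y) := by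
  rw [Finset.disjoint_left]
  intro v h1 h2
  exact h ((mem_region.1 h1).2.symm.trans (mem_region.1 h2).2)

/-- If `X` has neighbours only in `X ∪ Y`, then replacing `S₀ ∩ X` by `S` changes the size of the cut
`S₀` in the same way as that of the cut `S₀ ∩ (X ∪ Y)`. -/
theorem cutN_exchange {n : ℕ} {A : ℕ → ℕ → Prop} (hA : ∀ u v, A u v → A v u)
    {X Y S S₀ : Finset ℕ} (hX : ∀ u ∈ X, ∀ v < n, A u v → v ∈ X ∨ v ∈ Y) (hS : S ⊆ X) (hXY : Disjoint X Y) :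
    cutN n A S₀ + cutN n A ((S₀ ∩ Y) ∪ S) =
      cutN n A ((S₀ \ X) ∪ S) + cutN n A ((S₀ ∩ Y) ∪ (S₀ ∩ X)) := by
  simp only [cutN, ← Finset.sum_add_distrib]
  refine Finset.sum_congr rfl fun u hu => Finset.sum_congr rfl fun v hv => ?_
  rw [Finset.mem_range] at hu hv
  by_cases hAuv : A u v
  · have hin (z : ℕ) (hz : z ∈ X ∨ z ∈ Y) : (z ∈ S₀ ↔ z ∈ (S₀ ∩ Y) ∪ (S₀ ∩ X)) ∧
        (z ∈ (S₀ ∩ Y) ∪ S ↔ z ∈ (S₀ \ X) ∪ S) := by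
      have h1 : z ∈ X → z ∉ Y := fun h => Finset.disjoint_left.1 hXY h
      simp only [Finset.mem_union, Finset.mem_inter, Finset.mem_sdiff]
      tauto
    have hout (z : ℕ) (hz : z ∉ X) : (z ∈ S₀ ↔ z ∈ (S₀ \ X) ∪ S) ∧
        (z ∈ (S₀ ∩ Y) ∪ S ↔ z ∈ (S₀ ∩ Y) ∪ (S₀ ∩ X)) := by
      have h1 : z ∉ S := fun h => hz (hS h)
      simp only [Finset.mem_union, Finset.mem_inter, Finset.mem_sdiff]
      tauto
    by_cases hc : u ∈ X ∨ v ∈ X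
    · have h1 : (u ∈ X ∨ u ∈ Y) ∧ (v ∈ X ∨ v ∈ Y) := by
        rcases hc with hc | hc
        · exact ⟨Or.inl hc, hX u hc v hv hAuv⟩
        · exact ⟨hX v hc u hu (hA u v hAuv), Or.inl hc⟩
      rw [(hin u h1.1).2, (hin v h1.2).2, (hin u h1.1).1, (hin v h1.2).1, add_comm]
    · push Not at hc
      rw [← (hout u hc.1).1, ← (hout v hc.2).1, ← (hout u hc.1).2, ← (hout v hc.2).2]
  · simp [hAuv]

/-- In a tree, every finite set with at least two vertices has a vertex with at most one neighbour
in the set. -/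
theorem SimpleGraph.IsTree.exists_leaf_of_finset {τ : Type} {T : SimpleGraph τ} (hT : T.IsTree)
    {X : Finset τ} {a b : τ} (ha : a ∈ X) (hb : b ∈ X) (hab : a ≠ b) :
    ∃ l ∈ X, ∃ p ∈ X, l ≠ p ∧ ∀ y ∈ X, T.Adj l y → y = p := by
  -- Take `l` in `X` farthest from `a`. Adjacent vertices of a tree have different distances from
  -- `a`, so a neighbour of `l` in `X` is closer and is the penultimate vertex of the unique path
  -- from `a` to `l`. The set `X` need not be connected; if `l` has no neighbour in it, any other
  -- vertex may serve as `p`.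
  obtain ⟨l, hl, hmax⟩ := X.exists_max_image (T.dist a) ⟨a, ha⟩
  have hla : l ≠ a := by
    rintro rfl
    have h1 := hmax b hb
    rw [SimpleGraph.dist_self] at h1
    have := (hT.connected.dist_eq_zero_iff (u := l) (v := b)).1 (by lia)
    exact hab this
  have key (y : τ) (hy : y ∈ X) (hly : T.Adj l y) :
      ∃ q : T.Walk a l, q.IsPath ∧ q.penultimate = y := by
    obtain ⟨q, hq⟩ := hT.connected.exists_walk_length_eq_dist a y
    have h1 := hT.dist_eq_dist_add_one_of_adj a hly
    have h2 := hmax y hy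
    refine ⟨q.concat hly.symm, ?_, by simp⟩
    apply SimpleGraph.Walk.isPath_of_length_eq_dist
    rw [SimpleGraph.Walk.length_concat, hq]
    lia
  by_cases h : ∃ y ∈ X, T.Adj l y
  · obtain ⟨p, hp, hlp⟩ := h
    refine ⟨l, hl, p, hp, hlp.ne, fun y hy hly => ?_⟩
    obtain ⟨q, hq, rfl⟩ := key p hp hlp
    obtain ⟨q', hq', rfl⟩ := key y hy hly
    have := (hT.isAcyclic.subsingleton_path a l).elim ⟨q, hq⟩ ⟨q', hq'⟩
    rw [Subtype.mk.injEq] at this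
    rw [this]
  · push Not at h
    exact ⟨l, hl, a, ha, hla, fun y hy hly => absurd hly (h y hy)⟩

/-! ### The dynamic programming invariant -/

namespace RAMProg

local infixr:60 " ;; " => RAMProg.seq

variable {N n : ℕ} {A : ℕ → ℕ → Prop} {s : RAMState} {τ : Type} {T : SimpleGraph τ}

/-- The labels in use correspond to the image of `π`, a finite vertex set of the tree `T`; a leaf of
this set and its only possible neighbour give the two labels. -/
theorem exists_mergeable (hT : T.IsTree) {lab : ℕ → ℕ} {π : ℕ → τ}
    (hπ : ∀ u < n, ∀ v < n, (lab u = lab v ↔ π u = π v))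
    (hadj : ∀ u < n, ∀ v < n, A u v → π u = π v ∨ T.Adj (π u) (π v))
    {a b : ℕ} (ha : a < n) (hb : b < n) (hab : lab a ≠ lab b) :
    ∃ u₀ < n, ∃ w₀ < n, Mergeable n A lab u₀ w₀ := by
  classical
  have hmem (v : ℕ) (hv : v < n) : π v ∈ (Finset.range n).image π :=
    Finset.mem_image_of_mem _ (Finset.mem_range.2 hv)
  obtain ⟨l, hl, p, hp, hlp, h⟩ := hT.exists_leaf_of_finset (hmem a ha) (hmem b hb)
    (fun h => hab ((hπ a ha b hb).2 h))
  obtain ⟨u₀, hu₀, rfl⟩ := Finset.mem_image.1 hl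
  obtain ⟨w₀, hw₀, rfl⟩ := Finset.mem_image.1 hp
  rw [Finset.mem_range] at hu₀ hw₀
  refine ⟨u₀, hu₀, w₀, hw₀, fun h' => hlp ((hπ _ hu₀ _ hw₀).1 h'), fun u hu v hv hua huv => ?_⟩
  have h1 := (hπ u hu u₀ hu₀).1 hua
  rw [hπ v hv u₀ hu₀, hπ v hv w₀ hw₀, ← h1]
  rcases hadj u hu v hv huv with h2 | h2
  · exact Or.inl h2.symm
  · exact Or.inr (h _ (hmem v hv) (h1 ▸ h2))

/-- The labels are those of connected pieces of a tree, the recorded sets consist of vertices with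
the recorded label, and some maximum cut is composed of recorded sets. -/
structure Mergeful (n : ℕ) (A : ℕ → ℕ → Prop) (T : SimpleGraph τ) (s : RAMState) : Prop where
  valid : ∀ v < n, ∀ r < s.reg 2, s.mem 4 r = s.mem 50 v →
    ∃ S ⊆ region n (s.mem 50) (s.mem 50 v), s.mem 5 r = mask S
  cov : ∃ S₀ ⊆ Finset.range n, (∀ S ⊆ Finset.range n, cutN n A S ≤ cutN n A S₀) ∧
    ∀ v < n, S₀ ∩ region n (s.mem 50) (s.mem 50 v) ∈ Fam s (s.mem 50 v)
  tree : ∃ π : ℕ → τ, (∀ u < n, ∀ v < n, (s.mem 50 u = s.mem 50 v ↔ π u = π v)) ∧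
    ∀ u < n, ∀ v < n, A u v → π u = π v ∨ T.Adj (π u) (π v)

theorem Mergeful.congr {s' : RAMState} (h : Mergeful n A T s) (h2 : s'.reg 2 = s.reg 2)
    (h4 : s'.mem 4 = s.mem 4) (h5 : s'.mem 5 = s.mem 5) (h50 : s'.mem 50 = s.mem 50) :
    Mergeful n A T s' := by
  have hF (x : ℕ) : Fam s' x = Fam s x := by simp only [Fam, h2, h4, h5]
  refine ⟨?_, ?_, ?_⟩
  · rw [h2, h4, h5, h50]; exact h.valid
  · simp only [hF, h50]; exact h.cov
  · rw [h50]; exact h.tree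

/-- The maximum cut witnessing the invariant may change: its trace on the absorbed region is
replaced by the partner `S` chosen for its trace on the other region. By `cutN_exchange` the change
of the cut can be measured on the two regions alone, where `S` was the best choice, so the new cut
is again maximum. -/
theorem Mergeful.merge (hA : ∀ u v, A u v → A v u) (hM : Mergeful n A T s) {s' : RAMState}
    {a b : ℕ} (ha : a < n) (hb : b < n) (hab : Mergeable n A (s.mem 50) a b)
    (h2 : s'.reg 2 = s.reg 2) (h4 : s'.mem 4 = s.mem 4)
    (hm : ∀ r < s.reg 2, (s.mem 4 r ≠ s.mem 50 b → s'.mem 5 r = s.mem 5 r) ∧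
      ∀ T, s.mem 4 r = s.mem 50 b → s.mem 5 r = mask T →
        ∃ S ∈ Fam s (s.mem 50 a), s'.mem 5 r = mask (T ∪ S) ∧
        ∀ S' ∈ Fam s (s.mem 50 a), cutN n A (T ∪ S') ≤ cutN n A (T ∪ S))
    (h50 : ∀ v < n, s'.mem 50 v = if s.mem 50 v = s.mem 50 a then s.mem 50 b else s.mem 50 v) :
    Mergeful n A T s' := by
  obtain ⟨hne, hnb⟩ := hab
  have hreg (x : ℕ) (hxa : x ≠ s.mem 50 a) (hxb : x ≠ s.mem 50 b) :
      region n (s'.mem 50) x = region n (s.mem 50) x := by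
    ext v
    rw [mem_region, mem_region]
    refine and_congr_right fun hv => ?_
    rw [h50 v hv]
    split_ifs with h
    · rw [h]; exact ⟨fun h' => absurd h'.symm hxb, fun h' => absurd h'.symm hxa⟩
    · rfl
  have hregb : region n (s'.mem 50) (s.mem 50 b) =
      region n (s.mem 50) (s.mem 50 b) ∪ region n (s.mem 50) (s.mem 50 a) := by
    ext v
    rw [Finset.mem_union, mem_region, mem_region, mem_region, ← and_or_left]
    refine and_congr_right fun hv => ?_
    rw [h50 v hv]
    split_ifs with h <;> simp [h]
  have hcase (v : ℕ) (hv : v < n) : s'.mem 50 v = s.mem 50 b ∨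
      (s'.mem 50 v = s.mem 50 v ∧ s.mem 50 v ≠ s.mem 50 a ∧ s.mem 50 v ≠ s.mem 50 b) := by
    rw [h50 v hv]
    split_ifs with h
    · exact Or.inl rfl
    · by_cases h' : s.mem 50 v = s.mem 50 b
      · exact Or.inl h'
      · exact Or.inr ⟨rfl, h, h'⟩
  have hvalF (v : ℕ) (hv : v < n) (S : Finset ℕ) (hS : S ∈ Fam s (s.mem 50 v)) :
      S ⊆ region n (s.mem 50) (s.mem 50 v) := by
    obtain ⟨r, hr, hr4, hr5⟩ := hS
    obtain ⟨S', hS', h5⟩ := hM.valid v hv r hr hr4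
    rwa [mask_injective (hr5.symm.trans h5)]
  refine ⟨fun v hv r hr hr4 => ?_, ?_, ?_⟩
  · rw [h2] at hr
    rw [h4] at hr4
    rcases hcase v hv with h | ⟨h, hva, hvb⟩
    · rw [h] at hr4 ⊢
      obtain ⟨S, hS, h5⟩ := hM.valid b hb r hr hr4
      obtain ⟨S', hS', h5', -⟩ := (hm r hr).2 S hr4 h5
      exact ⟨S ∪ S', hregb ▸ Finset.union_subset_union hS (hvalF a ha S' hS'), h5'⟩
    · rw [h] at hr4 ⊢
      rw [hreg _ hva hvb, (hm r hr).1 (by rwa [hr4])]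
      exact hM.valid v hv r hr hr4
  · obtain ⟨S₀, hS₀, hmax, hcov⟩ := hM.cov
    obtain ⟨r, hr, hr4, hr5⟩ := hcov b hb
    obtain ⟨S, hS, h5, hbest⟩ := (hm r hr).2 _ hr4 hr5
    have hSX := hvalF a ha S hS
    have hXn := region_subset n (s.mem 50) (s.mem 50 a)
    have hd := region_disjoint n (s.mem 50) hne
    have hex := cutN_exchange hA (n := n) (X := region n (s.mem 50) (s.mem 50 a))
      (Y := region n (s.mem 50) (s.mem 50 b)) (S := S) (S₀ := S₀)
      (fun u hu v hv huv => by
        rw [mem_region] at hu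
        simpa [mem_region, hv] using hnb u hu.1 v hv hu.2 huv) hSX hd
    have hle := hbest _ (hcov a ha)
    refine ⟨(S₀ \ region n (s.mem 50) (s.mem 50 a)) ∪ S,
      Finset.union_subset (Finset.sdiff_subset.trans hS₀) (hSX.trans hXn),
      fun S' hS' => (hmax S' hS').trans (by lia), fun v hv => ?_⟩
    rcases hcase v hv with h | ⟨h, hva, hvb⟩
    · rw [h, hregb]
      refine ⟨r, h2 ▸ hr, by rw [h4, hr4], ?_⟩
      rw [h5]
      congr 1
      ext z
      have h1 : z ∈ S → z ∈ region n (s.mem 50) (s.mem 50 a) := fun h => hSX h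
      have h2 : z ∈ region n (s.mem 50) (s.mem 50 a) → z ∉ region n (s.mem 50) (s.mem 50 b) :=
        fun h => Finset.disjoint_left.1 hd h
      simp only [Finset.mem_union, Finset.mem_inter, Finset.mem_sdiff]
      tauto
    · rw [h, hreg _ hva hvb]
      obtain ⟨r', hr', hr4', hr5'⟩ := hcov v hv
      refine ⟨r', h2 ▸ hr', by rw [h4, hr4'], ?_⟩
      rw [(hm r' hr').1 (by rwa [hr4']), hr5']
      congr 1
      ext z
      have h1 : z ∈ S → z ∈ region n (s.mem 50) (s.mem 50 a) := fun h => hSX h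
      have h2 : z ∈ region n (s.mem 50) (s.mem 50 a) → z ∉ region n (s.mem 50) (s.mem 50 v) :=
        fun h => Finset.disjoint_left.1 (region_disjoint n (s.mem 50) hva.symm) h
      simp only [Finset.mem_union, Finset.mem_inter, Finset.mem_sdiff]
      tauto
  · classical
    obtain ⟨π, h1, h3⟩ := hM.tree
    have hπ' (v : ℕ) (hv : v < n) : (if π v = π a then π b else π v) =
        if s.mem 50 v = s.mem 50 a then π b else π v := by
      simp only [h1 v hv a ha]
    -- The tree is not contracted; the absorbed vertices move to the node of `b`. Edges leaving the
    -- absorbed region end in one of the two regions, so they collapse.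
    refine ⟨fun v => if π v = π a then π b else π v, fun u hu v hv => ?_, fun u hu v hv huv => ?_⟩
    · beta_reduce
      rw [h50 u hu, h50 v hv, hπ' u hu, hπ' v hv]
      split_ifs
      · simp
      · exact h1 b hb v hv
      · exact h1 u hu b hb
      · exact h1 u hu v hv
    · beta_reduce
      rw [hπ' u hu, hπ' v hv]
      split_ifs with hu' hv' hv'
      · exact Or.inl rfl
      · have := hnb u hu v hv hu' huv
        exact Or.inl ((h1 b hb v hv).1 (this.resolve_left hv').symm)
      · have := hnb v hv u hu hv' (hA _ _ huv)
        exact Or.inl ((h1 u hu b hb).1 (this.resolve_left hu'))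
      · exact h3 u hu v hv huv

/-- The number of labels in use. -/
def numLab (n : ℕ) (s : RAMState) : ℕ := ((Finset.range n).image (s.mem 50)).card

/-- Merge two labels, if possible. -/
def mergeRound : RAMProg := search ;; .cond (.reg 18) (mergeFam ;; relabel) .skip

theorem exec_mergeRound (hT : T.IsTree) (hA : ∀ u v, A u v → A v u) (hN : n ≤ N)
    (hL : s.reg 2 ≤ N) (hE : Env n A s) (hM : Mergeful n A T s) :
    Exec N mergeRound s fun s' => Mergeful n A T s' ∧ (numLab n s' < numLab n s ∨ numLab n s' ≤ 1) := by
  refine Exec.seq' (exec_search hN hE) fun s1 hs1 h => ?_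
  have m4 : s1.mem 4 = s.mem 4 := hs1.mem 4 rfl
  have m5 : s1.mem 5 = s.mem 5 := hs1.mem 5 rfl
  have m50 : s1.mem 50 = s.mem 50 := hs1.mem 50 rfl
  have r2 : s1.reg 2 = s.reg 2 := hs1.reg 2 rfl
  have hM1 := hM.congr r2 m4 m5 m50
  have hE1 := hE.of_same hs1
  rcases h with ⟨h18, hno⟩ | ⟨h18, a, ha, b, hb, hab, h16, h17⟩
  -- If the search fails, there cannot be two labels, by the existence of a leaf.
  · refine Exec.cond (fun h => absurd h18 h) fun _ => Exec.skip ⟨hM1, Or.inr ?_⟩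
    rw [numLab, m50, Finset.card_le_one]
    intro x hx y hy
    obtain ⟨u, hu, rfl⟩ := Finset.mem_image.1 hx
    obtain ⟨v, hv, rfl⟩ := Finset.mem_image.1 hy
    by_contra huv
    obtain ⟨π, h1, h2⟩ := hM.tree
    obtain ⟨a, ha, b, hb, hab⟩ := exists_mergeable hT h1 h2 (Finset.mem_range.1 hu)
      (Finset.mem_range.1 hv) huv
    exact hno a ha b hb hab
  · refine Exec.cond (fun _ => ?_) fun h => absurd h h18
    have hab1 := hab
    rw [← m50] at hab1 h16 h17
    obtain ⟨S₀, -, -, hcov⟩ := hM1.cov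
    refine Exec.seq' (exec_mergeFam hN (r2.trans_le hL) hE1 hab1.1 h16 h17
      (region_subset n (s1.mem 50) _) (region_subset n (s1.mem 50) _) (region_disjoint n _ hab1.1)
      (hM1.valid a ha) (hM1.valid b hb) ⟨_, hcov a ha⟩) fun s2 hs2 hm => ?_
    have n50 : s2.mem 50 = s1.mem 50 := hs2.mem 50 rfl
    refine (exec_relabel hN (hE1.of_same hs2).size ((hs2.reg 16 rfl).trans h16)
      ((hs2.reg 17 rfl).trans h17)).mono fun s3 hs3 h50 => ?_
    rw [n50] at h50
    refine ⟨hM1.merge hA ha hb hab1 ((hs3.reg 2 rfl).trans (hs2.reg 2 rfl))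
      ((hs3.mem 4 rfl).trans (hs2.mem 4 rfl)) ?_ h50, Or.inl ?_⟩
    · rw [hs3.mem 5 rfl]
      exact hm
    · rw [numLab, numLab, ← m50]
      refine Finset.card_lt_card ((Finset.ssubset_iff_of_subset ?_).2 ⟨s1.mem 50 a,
        Finset.mem_image_of_mem _ (Finset.mem_range.2 ha), ?_⟩)
      · intro x hx
        obtain ⟨v, hv, rfl⟩ := Finset.mem_image.1 hx
        rw [h50 v (Finset.mem_range.1 hv)]
        split_ifs
        · exact Finset.mem_image_of_mem _ (Finset.mem_range.2 hb)
        · exact Finset.mem_image_of_mem _ hv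
      · intro hx
        obtain ⟨v, hv, hx⟩ := Finset.mem_image.1 hx
        rw [h50 v (Finset.mem_range.1 hv)] at hx
        split_ifs at hx with h
        exacts [hab1.1 hx.symm, h hx]

/-- Merge all labels and find the best recorded set. -/
def solve : RAMProg :=
  forp 41 1 mergeRound ;; .assign 12 (.num 0) ;; .assign 13 (.read 50 (.num 0)) ;; best

theorem exec_solve (hT : T.IsTree) (hA : ∀ u v, A u v → A v u) (hN : n ≤ N) (hn : 0 < n)
    (hL : s.reg 2 ≤ N) (hE : Env n A s) (hM : Mergeful n A T s) :
    Exec N solve s fun s' => ∃ S ⊆ Finset.range n, s'.reg 14 = mask S ∧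
      s'.reg 15 = cutN n A S + 1 ∧ ∀ S' ⊆ Finset.range n, cutN n A S' ≤ cutN n A S := by
  -- Each round loses a label until at most one is left, and there are at most `n` labels at the
  -- start, so `n` rounds suffice.
  refine Exec.seq' (Exec.forp (fun i s' => Mergeful n A T s' ∧ (numLab n s' + i ≤ n ∨ numLab n s' ≤ 1))
    hE.size hN rfl rfl rfl ?_ ?_) ?_
  · refine ⟨hM.congr (by simp [reg_setReg]) rfl rfl rfl, Or.inl ?_⟩
    exact (Nat.add_zero _).trans_le (Finset.card_image_le.trans (Finset.card_range n).le)
  · rintro i s1 hi hs1 hri ⟨hM1, h1⟩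
    refine (exec_mergeRound hT hA hN ((hs1.reg 2 rfl).trans_le hL) (hE.of_same hs1) hM1).mono ?_
    rintro s2 - ⟨hM2, h2⟩
    refine ⟨hM2.congr (by simp [reg_setReg]) rfl rfl rfl, ?_⟩
    change numLab n s2 + (i + 1) ≤ n ∨ numLab n s2 ≤ 1
    lia
  · rintro s1 hs1 ⟨hM1, h1⟩
    have hlab : ∀ v < n, s1.mem 50 v = s1.mem 50 0 := by
      have h2 : numLab n s1 ≤ 1 := by lia
      rw [numLab, Finset.card_le_one] at h2
      exact fun v hv => h2 _ (Finset.mem_image_of_mem _ (Finset.mem_range.2 hv)) _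
        (Finset.mem_image_of_mem _ (Finset.mem_range.2 hn))
    have hreg : region n (s1.mem 50) (s1.mem 50 0) = Finset.range n :=
      Finset.filter_true_of_mem fun v hv => hlab v (Finset.mem_range.1 hv)
    obtain ⟨S₀, hS₀, hmax, hcov⟩ := hM1.cov
    have hval := hM1.valid 0 hn
    have hcov0 := hcov 0 hn
    rw [hreg] at hval hcov0
    rw [Finset.inter_eq_left.2 hS₀] at hcov0
    refine Exec.seq (Exec.assign (Exec.seq (Exec.assign ?_)))
    set s2 := (s1.setReg 12 (RAMExpr.eval s1 (.num 0))).setReg 13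
      (RAMExpr.eval (s1.setReg 12 (RAMExpr.eval s1 (.num 0))) (.read 50 (.num 0))) with hs2
    have f2 : s2.reg 2 = s1.reg 2 := by simp [hs2, reg_setReg]
    have hF (x : ℕ) : Fam s2 x = Fam s1 x := by
      simp only [Fam, f2]; rfl
    -- The final choice is a merge with the empty set, whose mask is `0`.
    refine (exec_best (T := ∅) (x := s1.mem 50 0) hN (f2.trans_le ((hs1.reg 2 rfl).trans_le hL))
      ((hE.of_same hs1).setReg.setReg) (by simp) (by simp [hs2, reg_setReg, mask, RAMExpr.eval])
      (by simp [hs2, reg_setReg, mem_setReg, RAMExpr.eval]) ?_ ?_).mono ?_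
    · rw [f2]
      intro r hr h4
      obtain ⟨S, hS, h5⟩ := hval r hr h4
      exact ⟨S, h5, hS, by simp⟩
    · rw [hF]
      exact ⟨_, hcov0⟩
    · rintro s3 - ⟨S, hS, h14, h15, hbest⟩
      rw [hF] at hS hbest
      simp only [Finset.empty_union] at h14 h15 hbest
      obtain ⟨r, hr, hr4, hr5⟩ := hS
      obtain ⟨S', hS', h5⟩ := hval r hr hr4
      rw [mask_injective (h5.symm.trans hr5)] at hS'
      exact ⟨S, hS', h14, h15, fun S' hS' => (hmax S' hS').trans (hbest _ hcov0)⟩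

end RAMProg

/-! ### Generating the candidate sets -/

section Candidates

variable {n : ℕ} {A : ℕ → ℕ → Prop}

theorem SameNbrs.refl (u : ℕ) : SameNbrs n A u u := fun _ _ => Iff.rfl

theorem SameNbrs.symm {u v : ℕ} (h : SameNbrs n A u v) : SameNbrs n A v u :=
  fun z hz => (h z hz).symm

theorem SameNbrs.trans {u v w : ℕ} (h : SameNbrs n A u v) (h' : SameNbrs n A v w) :
    SameNbrs n A u w := fun z hz => (h z hz).trans (h' z hz)

open scoped Classical in
/-- Replace the part of `S` in the class of `w` by the initial segment of the class up to `w`. -/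
noncomputable def fillTo (n : ℕ) (A : ℕ → ℕ → Prop) (S : Finset ℕ) (w : ℕ) : Finset ℕ :=
  (Finset.range n).filter fun z => if SameNbrs n A z w then z ≤ w else z ∈ S

theorem mem_fillTo {S : Finset ℕ} {w z : ℕ} : z ∈ fillTo n A S w ↔
    z < n ∧ ((SameNbrs n A z w ∧ z ≤ w) ∨ (¬SameNbrs n A z w ∧ z ∈ S)) := by
  simp only [fillTo, Finset.mem_filter, Finset.mem_range]
  split_ifs <;> simp_all

theorem fillTo_subset (S : Finset ℕ) (w : ℕ) : fillTo n A S w ⊆ Finset.range n :=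
  Finset.filter_subset _ _

/-- `w` is the last element of its class. -/
def IsLast (n : ℕ) (A : ℕ → ℕ → Prop) (w : ℕ) : Prop := ∀ z < n, SameNbrs n A z w → z ≤ w

/-- Tables of partial solutions: lists of labelled sets. -/
abbrev Table : Type := List (ℕ × Finset ℕ)

/-- The new entries obtained from a table by filling the class of `w` up to `w`. -/
noncomputable def extend (n : ℕ) (A : ℕ → ℕ → Prop) (lab : ℕ → ℕ) (w : ℕ) (l : Table) : Table :=
  (l.filter (·.1 = lab w)).map fun e => (e.1, fillTo n A e.2 w)

open scoped Classical in
/-- The table of all unions of classes with last element below `w`. -/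
noncomputable def unionTable (n : ℕ) (A : ℕ → ℕ → Prop) (lab : ℕ → ℕ) : ℕ → Table
  | 0 => (List.range n).map fun x => (x, ∅)
  | w + 1 => if IsLast n A w then unionTable n A lab w ++ extend n A lab w (unionTable n A lab w)
      else unionTable n A lab w

/-- Add to a table all sets obtained by filling one class. -/
noncomputable def splitTable (n : ℕ) (A : ℕ → ℕ → Prop) (lab : ℕ → ℕ) (l : Table) : Table :=
  l ++ (List.range n).flatMap fun w => extend n A lab w l

variable {lab : ℕ → ℕ}

theorem mem_extend {w x : ℕ} {S : Finset ℕ} {l : Table} (hx : lab w = x) (h : (x, S) ∈ l) :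
    (x, fillTo n A S w) ∈ extend n A lab w l := by
  refine List.mem_map.2 ⟨(x, S), List.mem_filter.2 ⟨h, ?_⟩, rfl⟩
  simp [hx]

/-- Every entry of the table has a label less than `n`, and consists of vertices with that label. -/
def IsValidTable (n : ℕ) (lab : ℕ → ℕ) (l : Table) : Prop :=
  ∀ e ∈ l, e.1 < n ∧ e.2 ⊆ region n lab e.1

theorem IsValidTable.extend (hlab : ∀ u < n, ∀ v < n, SameNbrs n A u v → lab u = lab v) {w : ℕ}
    (hw : w < n) {l : Table} (h : IsValidTable n lab l) :
    IsValidTable n lab (extend n A lab w l) := by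
  intro e he
  obtain ⟨e, he', rfl⟩ := List.mem_map.1 he
  rw [List.mem_filter, decide_eq_true_iff] at he'
  refine ⟨(h e he'.1).1, fun z hz => ?_⟩
  obtain ⟨hz1, ⟨hz2, -⟩ | ⟨-, hz2⟩⟩ := mem_fillTo.1 hz
  · exact mem_region.2 ⟨hz1, (hlab z hz1 w hw hz2).trans he'.2.symm⟩
  · exact (h e he'.1).2 hz2

theorem IsValidTable.append {l l' : Table} (h : IsValidTable n lab l) (h' : IsValidTable n lab l') :
    IsValidTable n lab (l ++ l') := by
  intro e he
  exact (List.mem_append.1 he).elim (h e) (h' e)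

theorem isValidTable_unionTable (hlab : ∀ u < n, ∀ v < n, SameNbrs n A u v → lab u = lab v)
    {w : ℕ} (hw : w ≤ n) : IsValidTable n lab (unionTable n A lab w) := by
  induction w with
  | zero =>
    intro e he
    obtain ⟨x, hx, rfl⟩ := List.mem_map.1 he
    exact ⟨List.mem_range.1 hx, by simp⟩
  | succ w ih =>
    rw [unionTable]
    split_ifs
    · exact (ih (by lia)).append ((ih (by lia)).extend hlab (by lia))
    · exact ih (by lia)

theorem IsValidTable.splitTable (hlab : ∀ u < n, ∀ v < n, SameNbrs n A u v → lab u = lab v)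
    {l : Table} (h : IsValidTable n lab l) : IsValidTable n lab (splitTable n A lab l) := by
  refine h.append fun e he => ?_
  obtain ⟨w, hw, he⟩ := List.mem_flatMap.1 he
  exact h.extend hlab (List.mem_range.1 hw) e he

theorem IsValidTable.iterate_splitTable
    (hlab : ∀ u < n, ∀ v < n, SameNbrs n A u v → lab u = lab v)
    {l : Table} (h : IsValidTable n lab l) (j : ℕ) :
    IsValidTable n lab ((_root_.splitTable n A lab)^[j] l) := by
  induction j with
  | zero => exact h
  | succ j ih => rw [Function.iterate_succ_apply']; exact ih.splitTable hlab

/-! #### The size of the tables -/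

theorem length_eq_sum_countP {l : Table} (h : ∀ e ∈ l, e.1 < n) :
    l.length = ∑ x ∈ Finset.range n, l.countP (·.1 = x) := by
  induction l with
  | nil => simp
  | cons e l ih =>
    rw [List.length_cons, ih fun e' he' => h e' (List.mem_cons_of_mem _ he')]
    simp only [List.countP_cons, Finset.sum_add_distrib, decide_eq_true_eq]
    simp [h e List.mem_cons_self]

/-- Filling the class of `w` duplicates only records carrying the label of `w`. Sizes can therefore
be counted label by label, which keeps the exponent of two at the number of classes in one part. -/
theorem countP_extend {w x : ℕ} {l : Table} :
    (extend n A lab w l).countP (·.1 = x) = if lab w = x then l.countP (·.1 = x) else 0 := by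
  rw [extend, List.countP_map, List.countP_filter]
  split_ifs with h
  · refine List.countP_congr fun e _ => ?_
    simp [h]
  · rw [List.countP_eq_zero]
    intro e _
    simp only [Function.comp_apply, Bool.and_eq_true, decide_eq_true_eq, not_and]
    rintro rfl h'
    exact h h'.symm

open scoped Classical in
-- Each class is represented by its last element, and processing such an element at most doubles the
-- records of its own label.
theorem countP_unionTable (w x : ℕ) : (unionTable n A lab w).countP (·.1 = x) ≤
    2 ^ ((Finset.range w).filter fun v => IsLast n A v ∧ lab v = x).card := by
  induction w with
  | zero =>
    simp only [unionTable, List.countP_map, Finset.range_zero, Finset.filter_empty,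
      Finset.card_empty, pow_zero]
    have : List.countP ((fun e : ℕ × Finset ℕ => decide (e.1 = x)) ∘ fun x => (x, ∅))
        (List.range n) = (List.range n).count x := by
      rw [List.count]
      refine List.countP_congr fun e _ => by simp
    rw [this]
    exact List.nodup_iff_count_le_one.1 List.nodup_range x
  | succ w ih =>
    rw [unionTable, Finset.range_add_one, Finset.filter_insert]
    by_cases h1 : IsLast n A w
    · rw [if_pos h1, List.countP_append, countP_extend]
      by_cases h2 : lab w = x
      · rw [if_pos h2, if_pos ⟨h1, h2⟩, Finset.card_insert_of_notMem (by simp), pow_succ]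
        lia
      · rw [if_neg h2, if_neg (by simp [h2])]
        exact ih
    · rw [if_neg h1, if_neg (by simp [h1])]
      exact ih

/-- Every record yields at most one new record for each of the `n` vertices, besides itself. -/
theorem length_splitTable (l : Table) : (splitTable n A lab l).length ≤ (n + 1) * l.length := by
  rw [splitTable, List.length_append, List.length_flatMap]
  have : ((List.range n).map fun w => (extend n A lab w l).length).sum ≤
      ((List.range n).map fun w => (extend n A lab w l).length).length • l.length := by
    refine List.sum_le_card_nsmul _ _ fun m hm => ?_
    obtain ⟨w, -, rfl⟩ := List.mem_map.1 hm
    rw [extend, List.length_map]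
    exact List.length_filter_le _ _
  rw [List.length_map, List.length_range, smul_eq_mul] at this
  lia

theorem length_iterate_splitTable (l : Table) (j : ℕ) :
    ((splitTable n A lab)^[j] l).length ≤ (n + 1) ^ j * l.length := by
  induction j with
  | zero => simp
  | succ j ih =>
    rw [Function.iterate_succ_apply', pow_succ', mul_assoc]
    exact (length_splitTable _).trans (Nat.mul_le_mul_left _ ih)

open scoped Classical in
theorem length_unionTable (hlab : ∀ u < n, ∀ v < n, SameNbrs n A u v → lab u = lab v) {k : ℕ}
    (hk : ∀ x, ((Finset.range n).filter fun v => IsLast n A v ∧ lab v = x).card ≤ k) :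
    (unionTable n A lab n).length ≤ n * 2 ^ k := by
  rw [length_eq_sum_countP fun e he => (isValidTable_unionTable hlab le_rfl e he).1]
  refine (Finset.sum_le_card_nsmul _ _ (2 ^ k) fun x _ => ?_).trans (by simp)
  exact (countP_unionTable n x).trans (Nat.pow_le_pow_right (by lia) (hk x))

theorem length_unionTable_mono {v w : ℕ} (h : v ≤ w) :
    (unionTable n A lab v).length ≤ (unionTable n A lab w).length := by
  induction w, h using Nat.le_induction with
  | base => exact le_rfl
  | succ w _ ih =>
    rw [unionTable]
    split_ifs
    · rw [List.length_append]; lia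
    · exact ih

theorem length_iterate_splitTable_mono (l : Table) {i j : ℕ} (h : i ≤ j) :
    ((splitTable n A lab)^[i] l).length ≤ ((splitTable n A lab)^[j] l).length := by
  induction j, h using Nat.le_induction with
  | base => exact le_rfl
  | succ j _ ih =>
    rw [Function.iterate_succ_apply', splitTable, List.length_append]; lia

theorem iterate_splitTable_subset (l : Table) {i j : ℕ} (h : i ≤ j) :
    (splitTable n A lab)^[i] l ⊆ (splitTable n A lab)^[j] l := by
  induction j, h using Nat.le_induction with
  | base => exact fun _ => id
  | succ j _ ih =>
    rw [Function.iterate_succ_apply']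
    exact fun e he => List.subset_append_left _ _ (ih he)

/-! #### Completeness of the tables -/

/-- Induction on `w`, for unions of classes whose last elements lie below `w`. If `w` is the last
element of a class in `U`, removing that class gives a set recorded earlier, and filling up to the
last element restores the whole class. -/
theorem mem_unionTable {x w : ℕ} (hx : x < n) {U : Finset ℕ}
    (hU : U ⊆ region n lab x)
    (hcl : ∀ u ∈ U, ∀ v < n, SameNbrs n A u v → v ∈ U)
    (hlast : ∀ u ∈ U, ∃ v < w, v < n ∧ IsLast n A v ∧ SameNbrs n A u v) :
    (x, U) ∈ unionTable n A lab w := by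
  classical
  induction w generalizing U with
  | zero =>
    have : U = ∅ := Finset.eq_empty_of_forall_notMem fun u hu => by
      obtain ⟨v, hv, -⟩ := hlast u hu
      lia
    rw [this, unionTable]
    exact List.mem_map.2 ⟨x, List.mem_range.2 hx, rfl⟩
  | succ w ih =>
    by_cases h : w ∈ U ∧ IsLast n A w
    · obtain ⟨hwU, hw⟩ := h
      have hw' := mem_region.1 (hU hwU)
      rw [unionTable, if_pos hw]
      have h1 : (x, U.filter fun u => ¬SameNbrs n A u w) ∈ unionTable n A lab w := by
        refine ih ((Finset.filter_subset _ _).trans hU) (fun u hu v hv huv => ?_) fun u hu => ?_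
        · rw [Finset.mem_filter] at hu ⊢
          exact ⟨hcl u hu.1 v hv huv, fun h => hu.2 (huv.trans h)⟩
        · rw [Finset.mem_filter] at hu
          obtain ⟨v, hv, hvn, hvl, huv⟩ := hlast u hu.1
          refine ⟨v, lt_of_le_of_ne (by lia) ?_, hvn, hvl, huv⟩
          rintro rfl
          exact hu.2 huv
      refine List.mem_append_right _ ?_
      have h2 := mem_extend (n := n) (A := A) hw'.2 h1
      convert h2 using 2
      ext z
      rw [mem_fillTo, Finset.mem_filter]
      constructor
      · intro hz
        have hzn := (mem_region.1 (hU hz)).1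
        refine ⟨hzn, ?_⟩
        by_cases hzw : SameNbrs n A z w
        · exact Or.inl ⟨hzw, hw z hzn hzw⟩
        · exact Or.inr ⟨hzw, hz, hzw⟩
      · rintro ⟨hzn, ⟨hzw, -⟩ | ⟨-, hz, -⟩⟩
        · exact hcl w hwU z hzn hzw.symm
        · exact hz
    · have h1 : (x, U) ∈ unionTable n A lab w := by
        refine ih hU hcl fun u hu => ?_
        obtain ⟨v, hv, hvn, hvl, huv⟩ := hlast u hu
        refine ⟨v, lt_of_le_of_ne (by lia) ?_, hvn, hvl, huv⟩
        rintro rfl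
        exact h ⟨hcl u hu v hvn huv, hvl⟩
      rw [unionTable]
      split_ifs
      · exact List.mem_append_left _ h1
      · exact h1

theorem mem_splitTable {x w : ℕ} (hw : w < n) (hx : lab w = x) {S : Finset ℕ} {l : Table}
    (h : (x, S) ∈ l) : (x, fillTo n A S w) ∈ splitTable n A lab l :=
  List.mem_append_right _ (List.mem_flatMap.2 ⟨w, List.mem_range.2 hw, mem_extend hx h⟩)

open scoped Classical in
/-- The elements of `S` with label `x` at which `S` splits a class. -/
noncomputable def splitters (n : ℕ) (A : ℕ → ℕ → Prop) (lab : ℕ → ℕ) (S : Finset ℕ) (x : ℕ) :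
    Finset ℕ :=
  S.filter fun w => lab w = x ∧ (∀ z ∈ S, SameNbrs n A z w → z ≤ w) ∧
    ∃ z < n, SameNbrs n A z w ∧ z ∉ S

theorem exists_last {S : Finset ℕ} {u : ℕ} (hu : u ∈ S) :
    ∃ w ∈ S, SameNbrs n A u w ∧ ∀ z ∈ S, SameNbrs n A z w → z ≤ w := by
  classical
  obtain ⟨w, hw, hmax⟩ := (S.filter fun w => SameNbrs n A u w).exists_max_image id
    ⟨u, Finset.mem_filter.2 ⟨hu, .refl u⟩⟩
  rw [Finset.mem_filter] at hw
  exact ⟨w, hw.1, hw.2, fun z hz hzw =>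
    hmax z (Finset.mem_filter.2 ⟨hz, hw.2.trans hzw.symm⟩)⟩

/-- Start from the union of the classes contained in `S` and add the properly split classes one by
one. As `S` meets each class in an initial segment, its trace on a split class is the filling up to
the last element taken, which is the corresponding splitter. Each splitter costs one application of
`splitTable`. -/
theorem mem_iterate_splitTable (hlab : ∀ u < n, ∀ v < n, SameNbrs n A u v → lab u = lab v)
    {S : Finset ℕ} (hS : S ⊆ Finset.range n)
    (hinit : ∀ w ∈ S, ∀ z ≤ w, SameNbrs n A z w → z ∈ S) {x α : ℕ} (hx : x < n)
    (hα : (splitters n A lab S x).card ≤ α) :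
    (x, S ∩ region n lab x) ∈ (splitTable n A lab)^[α] (unionTable n A lab n) := by
  classical
  have key (D : Finset ℕ) (hD : D ⊆ splitters n A lab S x) :
      (x, (S ∩ region n lab x).filter fun z =>
        (∀ z' < n, SameNbrs n A z z' → z' ∈ S) ∨ ∃ w ∈ D, SameNbrs n A z w) ∈
      (splitTable n A lab)^[D.card] (unionTable n A lab n) := by
    induction D using Finset.induction_on with
    | empty =>
      simp only [Finset.notMem_empty, false_and, exists_false, or_false, Finset.card_empty,
        Function.iterate_zero, id]
      refine mem_unionTable hx ?_ (fun u hu v hv huv => ?_) fun u hu => ?_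
      · exact (Finset.filter_subset _ _).trans Finset.inter_subset_right
      · rw [Finset.mem_filter, Finset.mem_inter, mem_region] at hu ⊢
        exact ⟨⟨hu.2 v hv huv, hv, (hlab _ hu.1.2.1 _ hv huv).symm.trans hu.1.2.2⟩,
          fun z hz hvz => hu.2 z hz (huv.trans hvz)⟩
      · rw [Finset.mem_filter, Finset.mem_inter, mem_region] at hu
        obtain ⟨w, hw, huw, hmax⟩ := exists_last (n := n) (A := A) (S := Finset.range n) (u := u)
          (Finset.mem_range.2 hu.1.2.1)
        rw [Finset.mem_range] at hw
        exact ⟨w, hw, hw, fun z hz => hmax z (Finset.mem_range.2 hz), huw⟩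
    | insert w D hw ih =>
      have hwD : w ∈ splitters n A lab S x := hD (Finset.mem_insert_self _ _)
      have ih' := ih ((Finset.subset_insert _ _).trans hD)
      rw [splitters, Finset.mem_filter] at hwD
      obtain ⟨hwS, hwx, hwmax, z₀, hz₀, hz₀w, hz₀S⟩ := hwD
      have hwn := Finset.mem_range.1 (hS hwS)
      rw [Finset.card_insert_of_notMem hw, Function.iterate_succ_apply']
      convert mem_splitTable (n := n) (A := A) hwn hwx ih' using 2
      ext z
      rw [mem_fillTo, Finset.mem_filter, Finset.mem_filter, Finset.mem_inter, mem_region]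
      constructor
      · rintro ⟨⟨hzS, hzn, hzx⟩, hz⟩
        refine ⟨hzn, ?_⟩
        by_cases hzw : SameNbrs n A z w
        · exact Or.inl ⟨hzw, hwmax z hzS hzw⟩
        · refine Or.inr ⟨hzw, ⟨hzS, hzn, hzx⟩, hz.imp_right ?_⟩
          rintro ⟨w', hw', hzw'⟩
          rcases Finset.mem_insert.1 hw' with rfl | hw'
          exacts [absurd hzw' hzw, ⟨w', hw', hzw'⟩]
      · rintro ⟨hzn, ⟨hzw, hle⟩ | ⟨hzw, ⟨hzS, -, hzx⟩, hz⟩⟩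
        · exact ⟨⟨hinit w hwS z hle hzw, hzn, (hlab z hzn w hwn hzw).trans hwx⟩,
            Or.inr ⟨w, Finset.mem_insert_self _ _, hzw⟩⟩
        · refine ⟨⟨hzS, hzn, hzx⟩, hz.imp_right ?_⟩
          rintro ⟨w', hw', hzw'⟩
          exact ⟨w', Finset.mem_insert_of_mem hw', hzw'⟩
  -- Fewer than `α` split classes are harmless, since the tables only increase.
  have h := iterate_splitTable_subset (unionTable n A lab n) hα (key _ subset_rfl)
  convert h using 2
  refine (Finset.filter_true_of_mem fun z hz => ?_).symm
  rw [Finset.mem_inter, mem_region] at hz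
  by_cases hfull : ∀ z' < n, SameNbrs n A z z' → z' ∈ S
  · exact Or.inl hfull
  · right
    push Not at hfull
    obtain ⟨z', hz', hzz', hz'S⟩ := hfull
    obtain ⟨w, hw, hzw, hmax⟩ := exists_last (n := n) (A := A) hz.1
    have hwn := Finset.mem_range.1 (hS hw)
    refine ⟨w, ?_, hzw⟩
    rw [splitters, Finset.mem_filter]
    exact ⟨hw, (hlab z hz.2.1 w hwn hzw).symm.trans hz.2.2, hmax, z', hz',
      hzz'.symm.trans hzw, hz'S⟩

end Candidates

/-! ### Machine programs generating the tables -/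

namespace RAMProg

local infixr:60 " ;; " => RAMProg.seq

variable {N n : ℕ} {A : ℕ → ℕ → Prop} {s : RAMState}

/-- The table `l` is stored in the memory. -/
structure Stored (l : Table) (s : RAMState) : Prop where
  length : s.reg 2 = l.length
  get : ∀ r (hr : r < l.length), s.mem 4 r = l[r].1 ∧ s.mem 5 r = mask l[r].2

theorem Stored.congr {l : Table} {s' : RAMState} (h : Stored l s) (h2 : s'.reg 2 = s.reg 2)
    (h4 : s'.mem 4 = s.mem 4) (h5 : s'.mem 5 = s.mem 5) : Stored l s' :=
  ⟨h2.trans h.length, by rw [h4, h5]; exact h.get⟩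

theorem Stored.mem_fam {l : Table} (h : Stored l s) {x : ℕ} {S : Finset ℕ} :
    S ∈ Fam s x ↔ (x, S) ∈ l := by
  constructor
  · rintro ⟨r, hr, h4, h5⟩
    rw [h.length] at hr
    obtain ⟨h4', h5'⟩ := h.get r hr
    have : (x, S) = l[r] := Prod.ext (h4.symm.trans h4') (mask_injective (h5.symm.trans h5'))
    rw [this]
    exact List.getElem_mem hr
  · intro hx
    obtain ⟨r, hr, hrx⟩ := List.getElem_of_mem hx
    obtain ⟨h4, h5⟩ := h.get r hr
    exact ⟨r, h.length ▸ hr, by rw [h4, hrx], by rw [h5, hrx]⟩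

/-- Bank `3` is the table of the relation `SameNbrs`. -/
def TwinTable (n : ℕ) (A : ℕ → ℕ → Prop) (s : RAMState) : Prop :=
  ∀ u < n, ∀ v < n, s.mem 3 (s.mem 1 u + v) = bit01 (SameNbrs n A u v)

theorem TwinTable.congr {s' : RAMState} (h : TwinTable n A s) (h3 : s'.mem 3 = s.mem 3)
    (h1 : s'.mem 1 = s.mem 1) : TwinTable n A s' := by
  unfold TwinTable
  rw [h3, h1]
  exact h

/-- From the set in bank `6` and the vertex `w` in register `21`, compute in register `22` the mask
of the set with the class of `w` filled up to `w`. -/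
def fillMask : RAMProg :=
  .assign 22 (.num 0) ;;
  forp 42 1 (.cond (entry 3 (.reg 42) (.reg 21))
    (.cond (leE (.reg 42) (.reg 21)) (.assign 22 (.add (.reg 22) (.read 2 (.reg 42)))) .skip)
    (.cond (.read 6 (.reg 42)) (.assign 22 (.add (.reg 22) (.read 2 (.reg 42)))) .skip))

theorem exec_fillMask (hN : n ≤ N) (hE : Env n A s) (hW : TwinTable n A s) {S : Finset ℕ} {w : ℕ}
    (hb : ∀ v < n, s.mem 6 v = bit01 (v ∈ S)) (h21 : s.reg 21 = w) (hw : w < n) :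
    Exec N fillMask s fun s' => s'.reg 22 = mask (fillTo n A S w) := by
  refine Exec.seq (Exec.assign ?_)
  refine (Exec.forp (fun i s' => s'.reg 22 = ∑ z ∈ Finset.range i,
    if z ∈ fillTo n A S w then 2 ^ z else 0) hE.setReg.size hN rfl rfl rfl ?_ ?_).mono ?_
  · simp [reg_setReg, RAMExpr.eval]
  · intro i s1 hi hs1 hri hI
    have hE1 := hE.setReg.of_same hs1
    have r21 : s1.reg 21 = w := by rw [hs1.reg 21 rfl, ← h21]; simp [reg_setReg]
    have m6 : s1.mem 6 = s.mem 6 := hs1.mem 6 rfl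
    have m3 : s1.mem 3 = s.mem 3 := hs1.mem 3 rfl
    have m1 : s1.mem 1 = s.mem 1 := hs1.mem 1 rfl
    have hp : s1.mem 2 i = 2 ^ i := hE1.pow i hi
    have hent : (entry 3 (.reg 42) (.reg 21)).eval s1 = bit01 (SameNbrs n A i w) := by
      simp only [entry, RAMExpr.eval, hri, r21, m3, m1]
      exact hW i hi w hw
    have hb6 : (RAMExpr.read 6 (.reg 42)).eval s1 = bit01 (i ∈ S) := by
      simp only [RAMExpr.eval, hri, m6]
      exact hb i hi
    have hadd : i ∈ fillTo n A S w → Exec N (.assign 22 (.add (.reg 22) (.read 2 (.reg 42)))) s1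
        fun s'' => (s''.setReg 42 (i + 1)).reg 22 = ∑ z ∈ Finset.range (i + 1),
          if z ∈ fillTo n A S w then 2 ^ z else 0 := by
      intro h
      refine Exec.assign ?_
      rw [Finset.sum_range_succ, ← hI, if_pos h]
      simp [reg_setReg, RAMExpr.eval, hri, hp]
    have hskip : i ∉ fillTo n A S w → Exec N .skip s1
        fun s'' => (s''.setReg 42 (i + 1)).reg 22 = ∑ z ∈ Finset.range (i + 1),
          if z ∈ fillTo n A S w then 2 ^ z else 0 := by
      intro h
      refine Exec.skip ?_
      rw [Finset.sum_range_succ, ← hI, if_neg h]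
      simp [reg_setReg]
    refine Exec.cond (fun h => Exec.cond (fun h' => hadd ?_) fun h' => hskip ?_)
      fun h => Exec.cond (fun h' => hadd ?_) fun h' => hskip ?_
    all_goals
      first
        | rw [hb6, Ne, bit01_eq_zero, not_not] at h'
        | rw [hb6, bit01_eq_zero] at h'
        | rw [Ne, eval_leE] at h'
        | rw [eval_leE] at h'
      first
        | rw [hent, Ne, bit01_eq_zero, not_not] at h
        | rw [hent, bit01_eq_zero] at h
      try simp only [RAMExpr.eval, hri, r21] at h'
      rw [mem_fillTo]
      simp_all
  · intro s' _ h
    rw [h, mask, Finset.sum_ite_mem, Finset.inter_eq_right.2 (fillTo_subset S w)]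

/-- Append to the table all entries obtained by filling the class of the vertex in register `21`
in one of the first entries, their number being given by register `3`. -/
def extendProg : RAMProg :=
  forp 43 3 (.cond (neE (.read 4 (.reg 43)) (.read 50 (.reg 21))) .skip (
    .assign 10 (.read 5 (.reg 43)) ;; decode ;; fillMask ;;
    .store 4 (.reg 2) (.read 4 (.reg 43)) ;; .store 5 (.reg 2) (.reg 22) ;;
    .assign 2 (.add (.reg 2) (.num 1))))

theorem Stored.append {l : Table} (h : Stored l s) {s' : RAMState} {e : ℕ × Finset ℕ}
    (h2 : s'.reg 2 = l.length + 1)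
    (h4 : ∀ r, s'.mem 4 r = if r = l.length then e.1 else s.mem 4 r)
    (h5 : ∀ r, s'.mem 5 r = if r = l.length then mask e.2 else s.mem 5 r) :
    Stored (l ++ [e]) s' := by
  refine ⟨by simp [h2], fun r hr => ?_⟩
  rw [h4, h5]
  rw [List.length_append, List.length_singleton] at hr
  rcases Nat.lt_succ_iff_lt_or_eq.1 hr with h' | rfl
  · rw [if_neg h'.ne, if_neg h'.ne, List.getElem_append_left h']
    exact h.get r h'
  · simp

/-- Register 3 freezes the number of old records while new ones are appended. The list `l'` stands
for what earlier vertices have appended in the same round. -/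
theorem exec_extendProg (hN : n ≤ N) (hE : Env n A s) (hW : TwinTable n A s) {l l' : Table}
    (hl : Stored (l ++ l') s) (h3 : s.reg 3 = l.length) (hlN : l.length ≤ N)
    (hln : ∀ e ∈ l, e.2 ⊆ Finset.range n) {w : ℕ} (h21 : s.reg 21 = w) (hw : w < n) :
    Exec N extendProg s fun s' => Stored (l ++ l' ++ extend n A (s.mem 50) w l) s' := by
  refine (Exec.forp (fun i s' => Stored (l ++ l' ++ extend n A (s.mem 50) w (l.take i)) s') h3 hlN
    rfl rfl rfl ?_ ?_).mono ?_
  · simp only [List.take_zero, extend, List.filter_nil, List.map_nil, List.append_nil]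
    exact hl.congr (by simp [reg_setReg]) rfl rfl
  · intro i s1 hi hs1 hri hI
    have hE1 := hE.of_same hs1
    have m50 : s1.mem 50 = s.mem 50 := hs1.mem 50 rfl
    have r21 : s1.reg 21 = w := (hs1.reg 21 rfl).trans h21
    have hget := hI.get i (by rw [List.length_append, List.length_append]; lia)
    rw [List.getElem_append_left (by rw [List.length_append]; lia),
      List.getElem_append_left hi] at hget
    have htake : l.take (i + 1) = l.take i ++ [l[i]] := (List.take_append_getElem hi).symm
    have hext : extend n A (s.mem 50) w (l.take (i + 1)) = extend n A (s.mem 50) w (l.take i) ++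
        extend n A (s.mem 50) w [l[i]] := by
      rw [htake, extend, List.filter_append, List.map_append]
      rfl
    rw [hext]
    refine Exec.cond (fun h => Exec.skip ?_) fun h => ?_
    · rw [Ne, eval_neE] at h
      simp only [RAMExpr.eval, hri, r21, m50, hget.1] at h
      have : extend n A (s.mem 50) w [l[i]] = [] := by simp [extend, h]
      rw [this, List.append_nil]
      exact hI.congr (by simp [reg_setReg]) rfl rfl
    · rw [eval_neE] at h
      simp only [RAMExpr.eval, hri, r21, m50, hget.1] at h
      have : extend n A (s.mem 50) w [l[i]] = [(l[i].1, fillTo n A l[i].2 w)] := by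
        simp [extend, h]
      rw [this, ← List.append_assoc]
      refine Exec.seq (Exec.assign ?_)
      refine Exec.seq' (exec_decode hN hE1.setReg (hln _ (List.getElem_mem hi)) ?_)
        fun s2 hs2 hb => ?_
      · simp [reg_setReg, RAMExpr.eval, hri, hget.2]
      have hE2 := hE1.setReg.of_same hs2
      have g21 : s2.reg 21 = w := by
        rw [hs2.reg 21 rfl, ← r21]; simp [reg_setReg]
      refine Exec.seq' (exec_fillMask hN hE2 (hW.congr ((hs2.mem 3 rfl).trans (hs1.mem 3 rfl))
        ((hs2.mem 1 rfl).trans (hs1.mem 1 rfl))) hb g21 hw) fun s3 hs3 h22 => ?_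
      have k4 : s3.mem 4 = s1.mem 4 := (hs3.mem 4 rfl).trans (hs2.mem 4 rfl)
      have k5 : s3.mem 5 = s1.mem 5 := (hs3.mem 5 rfl).trans (hs2.mem 5 rfl)
      have k2 : s3.reg 2 = s1.reg 2 := by
        rw [hs3.reg 2 rfl, hs2.reg 2 rfl]; simp [reg_setReg]
      have k43 : s3.reg 43 = i := by
        rw [hs3.reg 43 rfl, hs2.reg 43 rfl, ← hri]; simp [reg_setReg]
      refine Exec.seq (Exec.store (Exec.seq (Exec.store (Exec.assign ?_))))
      refine hI.append ?_ (fun r => ?_) fun r => ?_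
      · simp [reg_setReg, reg_setMem, RAMExpr.eval, k2, hI.length]
      · simp only [mem_setReg, RAMExpr.eval, mem_setMem_ne _ _ _ (show (4 : ℕ) ≠ 5 by decide),
          mem_setMem, k2, k43, k4, hI.length, hget.1]
      · simp only [mem_setReg, RAMExpr.eval, mem_setMem_ne _ _ _ (show (5 : ℕ) ≠ 4 by decide),
          mem_setMem, reg_setMem, k2, k5, hI.length, h22]
  · intro s' _ h
    rwa [List.take_length] at h

/-- Store the table with an empty set for every label. -/
def initTable : RAMProg :=
  forp 44 1 (.store 4 (.reg 44) (.reg 44) ;; .store 5 (.reg 44) (.num 0)) ;; .assign 2 (.reg 1)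

theorem exec_initTable (hN : n ≤ N) (h1 : s.reg 1 = n) (lab : ℕ → ℕ) :
    Exec N initTable s fun s' => Stored (unionTable n A lab 0) s' := by
  refine Exec.seq' (Exec.forp (fun i s' => ∀ r < i, s'.mem 4 r = r ∧ s'.mem 5 r = 0) h1 hN rfl rfl
    rfl (by simp) ?_) fun s1 hs1 h => Exec.assign ⟨?_, fun r hr => ?_⟩
  · intro i s1 hi hs1 hri hI
    refine Exec.seq (Exec.store (Exec.store fun r hr => ?_))
    simp only [mem_setReg, RAMExpr.eval, mem_setMem_ne _ _ _ (show (5 : ℕ) ≠ 4 by decide),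
      mem_setMem_ne _ _ _ (show (4 : ℕ) ≠ 5 by decide), mem_setMem, reg_setMem, hri]
    rcases Nat.lt_succ_iff_lt_or_eq.1 hr with h' | rfl
    · rw [if_neg h'.ne, if_neg h'.ne]
      exact hI r h'
    · simp
  · simp [reg_setReg, RAMExpr.eval, unionTable, hs1.reg 1 rfl, h1]
  · simp only [unionTable, List.length_map, List.length_range] at hr
    simp [mem_setReg, unionTable, h r hr, mask]

/-- Generate all unions of classes. -/
def unionProg : RAMProg :=
  forp 21 1 (.assign 3 (.reg 2) ;; .assign 23 (.num 1) ;;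
    forp 45 1 (.cond (entry 3 (.reg 45) (.reg 21))
      (.cond (leE (.reg 45) (.reg 21)) .skip (.assign 23 (.num 0))) .skip) ;;
    .cond (.reg 23) extendProg .skip)

theorem exec_unionProg (hN : n ≤ N) (hE : Env n A s) (hW : TwinTable n A s)
    (hlab : ∀ u < n, ∀ v < n, SameNbrs n A u v → s.mem 50 u = s.mem 50 v)
    (hl : Stored (unionTable n A (s.mem 50) 0) s)
    (hlN : (unionTable n A (s.mem 50) n).length ≤ N) :
    Exec N unionProg s (Stored (unionTable n A (s.mem 50) n)) := by
  refine Exec.forp (fun i s' => Stored (unionTable n A (s.mem 50) i) s') hE.size hN rfl rfl rfl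
    (hl.congr (by simp [reg_setReg]) rfl rfl) ?_
  intro i s1 hi hs1 hri hI
  have hE1 := hE.of_same hs1
  have m50 : s1.mem 50 = s.mem 50 := hs1.mem 50 rfl
  have hW1 : TwinTable n A s1 := hW.congr (hs1.mem 3 rfl) (hs1.mem 1 rfl)
  refine Exec.seq (Exec.assign (Exec.seq (Exec.assign ?_)))
  set s2 := (s1.setReg 3 (RAMExpr.eval s1 (.reg 2))).setReg 23
    (RAMExpr.eval (s1.setReg 3 (RAMExpr.eval s1 (.reg 2))) (.num 1)) with hs2
  have g3 : s2.reg 3 = (unionTable n A (s.mem 50) i).length := by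
    simp [hs2, reg_setReg, RAMExpr.eval, hI.length]
  have g2 : s2.reg 2 = s1.reg 2 := by simp [hs2, reg_setReg]
  have g21 : s2.reg 21 = i := by simp [hs2, reg_setReg, hri]
  have g23 : s2.reg 23 = 1 := by simp [hs2, reg_setReg, RAMExpr.eval]
  have hE2 : Env n A s2 := hE1.setReg.setReg
  have hW2 : TwinTable n A s2 := hW1.congr rfl rfl
  have g50 : s2.mem 50 = s.mem 50 := m50
  have hI2 : Stored (unionTable n A (s.mem 50) i) s2 := hI.congr g2 rfl rfl
  clear_value s2
  refine Exec.seq' (Exec.forp (fun j s' => s'.reg 23 ≠ 0 ↔ ∀ z < j, SameNbrs n A z i → z ≤ i)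
    hE2.size hN rfl rfl rfl (by simp [reg_setReg, g23]) ?_) fun s3 hs3 hlast => ?_
  · intro j s3 hj hs3 hrj hJ
    have k21 : s3.reg 21 = i := (hs3.reg 21 rfl).trans g21
    have hent : (entry 3 (.reg 45) (.reg 21)).eval s3 = bit01 (SameNbrs n A j i) := by
      simp only [entry, RAMExpr.eval, hrj, k21]
      exact (hW2.congr (hs3.mem 3 rfl) (hs3.mem 1 rfl)) j hj i hi
    have key (hj' : SameNbrs n A j i → j ≤ i) : (s3.setReg 45 (j + 1)).reg 23 ≠ 0 ↔
        ∀ z < j + 1, SameNbrs n A z i → z ≤ i := by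
      simp only [reg_setReg, if_neg (show ¬(23 : ℕ) = 45 by decide)]
      rw [hJ]
      refine ⟨fun h' u hu => ?_, fun h' u hu => h' u (by lia)⟩
      rcases Nat.lt_succ_iff_lt_or_eq.1 hu with h'' | rfl
      exacts [h' u h'', hj']
    refine Exec.cond (fun h => Exec.cond (fun h' => Exec.skip (key fun _ => ?_))
      fun h' => Exec.assign ?_) fun h => Exec.skip (key fun h' => ?_)
    · rw [Ne, eval_leE, not_lt] at h'
      simpa only [RAMExpr.eval, hrj, k21] using h'
    · rw [hent, Ne, bit01_eq_zero, not_not] at h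
      rw [eval_leE] at h'
      simp only [RAMExpr.eval, hrj, k21] at h'
      simp only [reg_setReg, RAMExpr.eval]
      simp only [show ¬(23 : ℕ) = 45 by decide, if_false, if_true, ne_eq, not_true, false_iff]
      exact fun h'' => absurd (h'' j (by lia) h) (by lia)
    · rw [hent, bit01_eq_zero] at h
      exact absurd h' h
  · change s3.reg 23 ≠ 0 ↔ IsLast n A i at hlast
    have hI3 := hI2.congr (hs3.reg 2 rfl) (hs3.mem 4 rfl) (hs3.mem 5 rfl)
    have k50 : s3.mem 50 = s.mem 50 := (hs3.mem 50 rfl).trans g50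
    rw [unionTable]
    refine Exec.cond (fun h => ?_) fun h => Exec.skip ?_
    · rw [if_pos (hlast.1 h)]
      -- The length is frozen anew for every vertex, so the filling applies to all records,
      -- including those of previous vertices.
      have h' := exec_extendProg (l := unionTable n A (s.mem 50) i) (l' := []) (w := i) hN
        (hE2.of_same hs3) (hW2.congr (hs3.mem 3 rfl) (hs3.mem 1 rfl)) (by rwa [List.append_nil])
        ((hs3.reg 3 rfl).trans g3) ((length_unionTable_mono hi.le).trans hlN)
        (fun e he => (isValidTable_unionTable hlab hi.le e he).2.trans (region_subset _ _ _))
        ((hs3.reg 21 rfl).trans g21) hi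
      rw [List.append_nil, k50] at h'
      exact h'.mono fun s4 _ h4 => h4.congr (by simp [reg_setReg]) rfl rfl
    · rw [if_neg (fun h' => hlast.2 h' h)]
      exact hI3.congr (by simp [reg_setReg]) rfl rfl

/-- Apply `α` times the generation of all sets obtained by filling one class. -/
def splitProg (α : ℕ) : RAMProg :=
  .assign 24 (.num α) ;; forp 46 24 (.assign 3 (.reg 2) ;; forp 21 1 extendProg)

theorem exec_splitProg {α : ℕ} (hN : n ≤ N) (hαN : α ≤ N) (hE : Env n A s) (hW : TwinTable n A s)
    (hlab : ∀ u < n, ∀ v < n, SameNbrs n A u v → s.mem 50 u = s.mem 50 v) {l : Table}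
    (hv : IsValidTable n (s.mem 50) l) (hl : Stored l s)
    (hlN : ((splitTable n A (s.mem 50))^[α] l).length ≤ N) :
    Exec N (splitProg α) s (Stored ((splitTable n A (s.mem 50))^[α] l)) := by
  refine Exec.seq (Exec.assign ?_)
  refine Exec.forp (fun i s' => Stored ((splitTable n A (s.mem 50))^[i] l) s')
    (by simp [reg_setReg, RAMExpr.eval]) hαN rfl rfl rfl
    (hl.congr (by simp [reg_setReg]) rfl rfl) ?_
  intro i s1 hi hs1 hri hI
  have hE1 := hE.setReg.of_same hs1
  have m50 : s1.mem 50 = s.mem 50 := hs1.mem 50 rfl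
  have hW1 : TwinTable n A s1 := hW.congr (hs1.mem 3 rfl) (hs1.mem 1 rfl)
  rw [Function.iterate_succ_apply']
  set l1 := (splitTable n A (s.mem 50))^[i] l with hl1
  have hv1 : IsValidTable n (s.mem 50) l1 := hv.iterate_splitTable hlab i
  have hl1N : l1.length ≤ N := (length_iterate_splitTable_mono l hi.le).trans hlN
  refine Exec.seq (Exec.assign ?_)
  have hl2 : Stored l1 (s1.setReg 3 (RAMExpr.eval s1 (.reg 2))) :=
    hI.congr (by simp [reg_setReg]) rfl rfl
  -- Here the length is frozen once per round: all vertices extend the same list `l1`, so each round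
  -- changes only one class per record.
  refine (Exec.forp (n := n) (fun j s' =>
    Stored (l1 ++ (List.range j).flatMap fun w => extend n A (s.mem 50) w l1) s')
    hE1.setReg.size hN rfl rfl rfl ?_ ?_).mono fun s' _ h => ?_
  · simp only [List.range_zero, List.flatMap_nil, List.append_nil]
    exact hl2.congr (by simp [reg_setReg]) rfl rfl
  · intro j s2 hj hs2 hrj hJ
    have n50 : s2.mem 50 = s.mem 50 := (hs2.mem 50 rfl).trans m50
    have n3 : s2.reg 3 = l1.length := by
      rw [hs2.reg 3 rfl, ← hI.length]; simp [reg_setReg, RAMExpr.eval]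
    have h' := exec_extendProg hN (hE1.setReg.of_same hs2)
      (hW1.congr (hs2.mem 3 rfl) (hs2.mem 1 rfl)) hJ n3 hl1N
      (fun e he => (hv1 e he).2.trans (region_subset _ _ _)) hrj hj
    rw [n50] at h'
    refine h'.mono fun s3 _ h3 => ?_
    rw [List.range_succ, List.flatMap_append, List.flatMap_singleton, ← List.append_assoc]
    exact h3.congr (by simp [reg_setReg]) rfl rfl
  · exact h.congr (by simp [reg_setReg]) rfl rfl

end RAMProg

namespace RAMProg

local infixr:60 " ;; " => RAMProg.seq

variable {N n : ℕ} {s : RAMState}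

/-! ### Preparing the tables -/

/-- The offset `1` is there because cell 0 of the input holds the number of vertices. -/
theorem index_injective {u v u' v' : ℕ} (hv : v < n) (hv' : v' < n) :
    1 + u * n + v = 1 + u' * n + v' ↔ u = u' ∧ v = v' := by
  constructor
  · intro h
    have h1 : v + n * u = v' + n * u' := by
      rw [mul_comm n, mul_comm n]; lia
    have h2 := congrArg (· / n) h1
    simp only [Nat.add_mul_div_left _ _ (Nat.zero_lt_of_lt hv), Nat.div_eq_of_lt hv,
      Nat.div_eq_of_lt hv', zero_add] at h2
    subst h2
    exact ⟨rfl, by lia⟩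
  · rintro ⟨rfl, rfl⟩
    rfl

/-- Store the row offsets in bank `1` and the powers of two in bank `2`. -/
def rowProg : RAMProg :=
  .assign 5 (.num 1) ;; .assign 6 (.num 1) ;;
  forp 48 1 (.store 1 (.reg 48) (.reg 5) ;; .assign 5 (.add (.reg 5) (.reg 1)) ;;
    .store 2 (.reg 48) (.reg 6) ;; .assign 6 (.add (.reg 6) (.reg 6)))

theorem exec_rowProg (hN : n ≤ N) (h1 : s.reg 1 = n) :
    Exec N rowProg s fun s' => (∀ u < n, s'.mem 1 u = 1 + u * n) ∧ ∀ v < n, s'.mem 2 v = 2 ^ v := by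
  refine Exec.seq (Exec.assign (Exec.seq (Exec.assign ?_)))
  refine (Exec.forp (n := n) (fun i s' => s'.reg 5 = 1 + i * n ∧ s'.reg 6 = 2 ^ i ∧
    (∀ u < i, s'.mem 1 u = 1 + u * n) ∧ ∀ v < i, s'.mem 2 v = 2 ^ v) (by simp [reg_setReg, h1])
    hN rfl rfl rfl (by simp [reg_setReg, RAMExpr.eval]) ?_).mono fun s' _ h => h.2.2
  rintro i s1 hi hs1 hri ⟨h5, h6, hr, hp⟩
  have r1 : s1.reg 1 = n := by rw [hs1.reg 1 rfl]; simp [reg_setReg, h1]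
  refine Exec.seq (Exec.store (Exec.seq (Exec.assign (Exec.seq (Exec.store (Exec.assign ?_))))))
  simp only [RAMExpr.eval, reg_setReg, mem_setReg, reg_setMem, hri,
    mem_setMem_ne _ _ _ (show (1 : ℕ) ≠ 2 by decide),
    mem_setMem_ne _ _ _ (show (2 : ℕ) ≠ 1 by decide), mem_setMem]
  simp only [show ¬(5 : ℕ) = 48 by decide, show ¬(6 : ℕ) = 48 by decide,
    show ¬(5 : ℕ) = 6 by decide, show ¬(6 : ℕ) = 5 by decide, show ¬(48 : ℕ) = 5 by decide,
    if_false, if_true, h5, h6, r1]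
  refine ⟨by ring, by ring, fun u hu => ?_, fun v hv => ?_⟩
  · rcases Nat.lt_succ_iff_lt_or_eq.1 hu with h' | rfl
    · rw [if_neg h'.ne]; exact hr u h'
    · rw [if_pos rfl]
  · rcases Nat.lt_succ_iff_lt_or_eq.1 hv with h' | rfl
    · rw [if_neg h'.ne]; exact hp v h'
    · rw [if_pos rfl]

/-- Set the diagonal of the matrix in bank `0` to one. -/
def diagProg : RAMProg :=
  forp 48 1 (.store 0 (.add (.read 1 (.reg 48)) (.reg 48)) (.num 1))

theorem exec_diagProg (hN : n ≤ N) (h1 : s.reg 1 = n) (hrow : ∀ u < n, s.mem 1 u = 1 + u * n)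
    {B : ℕ → ℕ → Prop} (hB : ∀ u < n, ∀ v < n, s.mem 0 (1 + u * n + v) = bit01 (B u v)) :
    Exec N diagProg s fun s' =>
      ∀ u < n, ∀ v < n, s'.mem 0 (1 + u * n + v) = bit01 (u = v ∨ B u v) := by
  -- Ones on the diagonal make the relation reflexive, so that being equal or twins becomes equality
  -- of rows. Cut sizes are unaffected.
  refine (Exec.forp (fun i s' => ∀ u < n, ∀ v < n, s'.mem 0 (1 + u * n + v) =
    bit01 ((u < i ∧ u = v) ∨ B u v)) h1 hN rfl rfl rfl (by simpa [mem_setReg] using hB) ?_).mono ?_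
  · intro i s1 hi hs1 hri hI
    refine Exec.store fun u hu v hv => ?_
    simp only [mem_setReg, RAMExpr.eval, hri, mem_setMem, hs1.mem 1 rfl, hrow i hi,
      index_injective hv hi]
    split_ifs with h
    · rw [bit01_true]
      exact Or.inl ⟨by lia, h.1.trans h.2.symm⟩
    · rw [hI u hu v hv]
      have : (u < i + 1 ∧ u = v) ↔ (u < i ∧ u = v) := by lia
      rw [this]
  · intro s' _ h u hu v hv
    rw [h u hu v hv]
    simp [hu]

/-- Compute the table of the relation `SameNbrs`. -/
def twinProg : RAMProg :=
  forp 48 1 (forp 49 1 (.store 3 (.add (.read 1 (.reg 48)) (.reg 49)) (.num 1) ;;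
    forp 47 1 (.cond (neE (entry 0 (.reg 48) (.reg 47)) (entry 0 (.reg 49) (.reg 47)))
      (.store 3 (.add (.read 1 (.reg 48)) (.reg 49)) (.num 0)) .skip)))

theorem bit01_inj {p q : Prop} : bit01 p = bit01 q ↔ (p ↔ q) := by
  unfold bit01
  split_ifs <;> simp_all

theorem exec_twinProg {A : ℕ → ℕ → Prop} (hN : n ≤ N) (hE : Env n A s)
    (hrow : ∀ u < n, s.mem 1 u = 1 + u * n) : Exec N twinProg s (TwinTable n A) := by
  refine (Exec.forp (fun i s' => ∀ u < i, ∀ v < n, s'.mem 3 (1 + u * n + v) =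
    bit01 (SameNbrs n A u v)) hE.size hN rfl rfl rfl (by simp) ?_).mono ?_
  · intro i s1 hi hs1 hri hI
    have hE1 := hE.of_same hs1
    refine Exec.forp (fun j s' => (∀ u < i, ∀ v < n, s'.mem 3 (1 + u * n + v) =
      bit01 (SameNbrs n A u v)) ∧ ∀ v < j, s'.mem 3 (1 + i * n + v) =
      bit01 (SameNbrs n A i v)) hE1.size hN rfl rfl rfl (by simpa [mem_setReg] using hI) ?_ |>.mono ?_
    · rintro j s2 hj hs2 hrj ⟨hJ1, hJ2⟩
      have hE2 := hE1.of_same hs2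
      have n48 : s2.reg 48 = i := (hs2.reg 48 rfl).trans hri
      have n1 : s2.mem 1 i = 1 + i * n := by
        rw [hs2.mem 1 rfl, hs1.mem 1 rfl, hrow i hi]
      have hE3 : Env n A (s2.setMem 3 (RAMExpr.eval s2 (.add (.read 1 (.reg 48)) (.reg 49)))
          (RAMExpr.eval s2 (.num 1))) := ⟨hE2.size, hE2.adj, hE2.pow⟩
      refine Exec.seq (Exec.store ?_)
      refine (Exec.forp (fun k s' => (∀ u < i, ∀ v < n, s'.mem 3 (1 + u * n + v) =
        bit01 (SameNbrs n A u v)) ∧ (∀ v < j, s'.mem 3 (1 + i * n + v) =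
        bit01 (SameNbrs n A i v)) ∧ s'.mem 3 (1 + i * n + j) = bit01 (∀ z < k, A i z ↔ A j z))
        hE3.size hN rfl rfl rfl ?_ ?_).mono ?_
      · simp only [mem_setReg, RAMExpr.eval, mem_setMem, n48, hrj, n1]
        refine ⟨fun u hu v hv => ?_, fun v hv => ?_, by simp [bit01]⟩
        · rw [if_neg (by rw [index_injective hv hj]; lia)]
          exact hJ1 u hu v hv
        · rw [if_neg (by lia)]
          exact hJ2 v hv
      · rintro k s3 hk hs3 hrk ⟨hK1, hK2, hK3⟩
        have hE4 := hE3.of_same hs3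
        have k48 : s3.reg 48 = i := (hs3.reg 48 rfl).trans n48
        have k49 : s3.reg 49 = j := (hs3.reg 49 rfl).trans hrj
        have k1 : s3.mem 1 i = 1 + i * n := by
          rw [hs3.mem 1 rfl]; exact n1
        have hne : (neE (entry 0 (.reg 48) (.reg 47)) (entry 0 (.reg 49) (.reg 47))).eval s3 = 0 ↔
            (A i k ↔ A j k) := by
          rw [eval_neE]
          simp only [entry, RAMExpr.eval, k48, k49, hrk, hE4.adj i hi k hk, hE4.adj j hj k hk,
            bit01_inj]
        refine Exec.cond (fun h => Exec.store ?_) fun h => Exec.skip ?_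
        · rw [Ne, hne] at h
          simp only [mem_setReg, RAMExpr.eval, mem_setMem, k48, k49, k1]
          refine ⟨fun u hu v hv => ?_, fun v hv => ?_, ?_⟩
          · rw [if_neg (by rw [index_injective hv hj]; lia)]
            exact hK1 u hu v hv
          · rw [if_neg (by lia)]
            exact hK2 v hv
          · rw [if_pos trivial, bit01_false]
            exact fun h' => h (h' k (by lia))
        · rw [hne] at h
          refine ⟨hK1, hK2, hK3.trans (bit01_inj.2 ⟨fun h' z hz => ?_, fun h' z hz => h' z (by lia)⟩)⟩
          rcases Nat.lt_succ_iff_lt_or_eq.1 hz with hz | rfl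
          exacts [h' z hz, h]
      · rintro s3 - ⟨hK1, hK2, hK3⟩
        refine ⟨hK1, fun v hv => ?_⟩
        rcases Nat.lt_succ_iff_lt_or_eq.1 hv with hv | rfl
        exacts [hK2 v hv, hK3]
    · rintro s2 - ⟨hJ1, hJ2⟩ u hu v hv
      rcases Nat.lt_succ_iff_lt_or_eq.1 hu with hu | rfl
      exacts [hJ1 u hu v hv, hJ2 v hv]
  · intro s' hs h u hu v hv
    rw [hs.mem 1 rfl, hrow u hu]
    exact h u hu v hv

/-! ### The main program -/

/-- The data of a labelled graph for which the algorithm works: the labels refine to a tree, and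
some maximum cut splits few classes per label. -/
structure Solvable (n α k : ℕ) (B : ℕ → ℕ → Prop) (lab : ℕ → ℕ) {τ : Type} (T : SimpleGraph τ) :
    Prop where
  pos : 0 < n
  symm : ∀ u v, (u = v ∨ B u v) → (v = u ∨ B v u)
  isTree : T.IsTree
  lab_lt : ∀ v < n, lab v < n
  lab_eq : ∀ u < n, ∀ v < n, SameNbrs n (fun u v => u = v ∨ B u v) u v → lab u = lab v
  tree : ∃ π : ℕ → τ, (∀ u < n, ∀ v < n, (lab u = lab v ↔ π u = π v)) ∧
    ∀ u < n, ∀ v < n, (u = v ∨ B u v) → π u = π v ∨ T.Adj (π u) (π v)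
  classes : ∀ x, {v | v < n ∧ IsLast n (fun u v => u = v ∨ B u v) v ∧ lab v = x}.ncard ≤ k
  cut : ∃ S₀ ⊆ Finset.range n, (∀ S ⊆ Finset.range n,
    cutN n (fun u v => u = v ∨ B u v) S ≤ cutN n (fun u v => u = v ∨ B u v) S₀) ∧
    (∀ w ∈ S₀, ∀ z ≤ w, SameNbrs n (fun u v => u = v ∨ B u v) z w → z ∈ S₀) ∧
    ∀ x, (splitters n (fun u v => u = v ∨ B u v) lab S₀ x).card ≤ α

/-- Compute a maximum cut, from the number of vertices and the adjacency matrix in bank `0` and the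
labels in bank `50`. -/
def mainProg (α : ℕ) : RAMProg :=
  .assign 1 (.read 0 (.num 0)) ;; rowProg ;; diagProg ;; twinProg ;; initTable ;; unionProg ;;
    splitProg α ;; solve

theorem exec_mainProg {α k : ℕ} {B : ℕ → ℕ → Prop} {τ : Type} {T : SimpleGraph τ}
    (hN : (n + 1) ^ α * (n * 2 ^ k) ≤ N) (hαN : α ≤ N)
    (hS : Solvable n α k B (s.mem 50) T) (h0 : s.mem 0 0 = n)
    (hB : ∀ u < n, ∀ v < n, s.mem 0 (1 + u * n + v) = bit01 (B u v)) :
    Exec N (mainProg α) s fun s' => Env n (fun u v => u = v ∨ B u v) s' ∧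
      ∃ S ⊆ Finset.range n, s'.reg 14 = mask S ∧
      s'.reg 15 = cutN n (fun u v => u = v ∨ B u v) S + 1 ∧ ∀ S' ⊆ Finset.range n,
        cutN n (fun u v => u = v ∨ B u v) S' ≤ cutN n (fun u v => u = v ∨ B u v) S := by
  classical
  set A : ℕ → ℕ → Prop := fun u v => u = v ∨ B u v with hA
  have hnN : n ≤ N := by
    refine le_trans ?_ hN
    calc n = 1 * (n * 1) := by ring
      _ ≤ (n + 1) ^ α * (n * 2 ^ k) := by gcongr <;> exact Nat.one_le_pow _ _ (by lia)
  have hlen : (unionTable n A (s.mem 50) n).length ≤ n * 2 ^ k := by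
    refine length_unionTable hS.lab_eq fun x => le_trans (le_of_eq ?_) (hS.classes x)
    rw [← Set.ncard_coe_finset]
    congr 1
    ext v
    simp
  have hlen2 : ((splitTable n A (s.mem 50))^[α] (unionTable n A (s.mem 50) n)).length ≤ N :=
    (length_iterate_splitTable _ α).trans ((Nat.mul_le_mul_left _ hlen).trans hN)
  have hlen1 : (unionTable n A (s.mem 50) n).length ≤ N :=
    (length_iterate_splitTable_mono _ (Nat.zero_le α)).trans hlen2
  refine Exec.seq (Exec.assign ?_)
  set s0 := s.setReg 1 (RAMExpr.eval s (.read 0 (.num 0))) with hs0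
  have h01 : s0.reg 1 = n := by simp [hs0, reg_setReg, RAMExpr.eval, h0]
  refine Exec.seq' (exec_rowProg hnN h01) fun s1 hs1 ⟨hrow, hpow⟩ => ?_
  refine Exec.seq' (exec_diagProg hnN ((hs1.reg 1 rfl).trans h01) hrow (B := B) ?_)
    fun s2 hs2 hadj => ?_
  · rw [hs1.mem 0 rfl]; exact hB
  have hrow2 : ∀ u < n, s2.mem 1 u = 1 + u * n := by rw [hs2.mem 1 rfl]; exact hrow
  have hE2 : Env n A s2 := by
    refine ⟨(hs2.reg 1 rfl).trans ((hs1.reg 1 rfl).trans h01), fun u hu v hv => ?_, ?_⟩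
    · rw [hrow2 u hu, hadj u hu v hv]
    · rw [hs2.mem 2 rfl]; exact hpow
  refine Exec.seq' (exec_twinProg hnN hE2 hrow2) fun s3 hs3 hW3 => ?_
  have hE3 := hE2.of_same hs3
  have m50 : s3.mem 50 = s.mem 50 := (hs3.mem 50 rfl).trans ((hs2.mem 50 rfl).trans (hs1.mem 50 rfl))
  refine Exec.seq' (exec_initTable (A := A) hnN hE3.size (s.mem 50)) fun s4 hs4 hI4 => ?_
  have hE4 := hE3.of_same hs4
  have hW4 := hW3.congr (hs4.mem 3 rfl) (hs4.mem 1 rfl)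
  have n50 : s4.mem 50 = s.mem 50 := (hs4.mem 50 rfl).trans m50
  refine Exec.seq' (exec_unionProg hnN hE4 hW4 (n50 ▸ hS.lab_eq) (n50 ▸ hI4) (n50 ▸ hlen1))
    fun s5 hs5 hI5 => ?_
  have hE5 := hE4.of_same hs5
  have hW5 := hW4.congr (hs5.mem 3 rfl) (hs5.mem 1 rfl)
  have k50 : s5.mem 50 = s.mem 50 := (hs5.mem 50 rfl).trans n50
  rw [n50] at hI5
  have hv5 := isValidTable_unionTable hS.lab_eq (le_refl n)
  refine Exec.seq' (exec_splitProg hnN hαN hE5 hW5 (k50 ▸ hS.lab_eq) (k50 ▸ hv5) hI5 (k50 ▸ hlen2))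
    fun s6 hs6 hI6 => ?_
  have hE6 := hE5.of_same hs6
  have j50 : s6.mem 50 = s.mem 50 := (hs6.mem 50 rfl).trans k50
  rw [k50] at hI6
  have hv6 := hv5.iterate_splitTable hS.lab_eq α
  -- Initially the labels are the parts themselves, and the traces of the canonical cut are in the
  -- table by `mem_iterate_splitTable`.
  have hM : Mergeful n A T s6 := by
    refine ⟨fun v hv r hr hr4 => ?_, ?_, ?_⟩
    · rw [hI6.length] at hr
      obtain ⟨h4, h5⟩ := hI6.get r hr
      refine ⟨_, ?_, h5⟩
      rw [← hr4, h4, j50]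
      exact (hv6 _ (List.getElem_mem hr)).2
    · obtain ⟨S₀, hS₀, hmax, hinit, hsplit⟩ := hS.cut
      refine ⟨S₀, hS₀, hmax, fun v hv => ?_⟩
      rw [hI6.mem_fam, j50]
      exact mem_iterate_splitTable hS.lab_eq hS₀ hinit (hS.lab_lt v hv) (hsplit _)
    · rw [j50]
      exact hS.tree
  refine (exec_solve hS.isTree hS.symm hnN hS.pos (hI6.length.trans_le hlen2) hE6 hM).mono ?_
  intro s7 hs7 h7
  exact ⟨hE6.of_same hs7, h7⟩

/-! ### Input and output -/

/-- Copy the first cells of bank `0` to bank `50`, and their number from register `4` to register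
`50`. -/
def copyProg : RAMProg :=
  forp 47 4 (.store 50 (.reg 47) (.read 0 (.reg 47))) ;; .assign 50 (.reg 4)

/-- The shifted algorithm must find a genuine initial state in its own part of the memory. For this
reason everything from index 50 on is assumed to be zero, and only the graph part of the input is
copied. -/
theorem exec_copyProg {w : List ℕ} (hN : w.length ≤ N) (h4 : s.reg 4 = w.length)
    (hw : ∀ i < w.length, s.mem 0 i = w.getD i 0) (hr : ∀ x, s.reg (x + 50) = 0)
    (hm : ∀ a i, s.mem (a + 50) i = 0) :
    Exec N copyProg s fun s' => s'.unshift 50 = RAMState.init w := by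
  refine Exec.seq' (Exec.forp (fun i s' => ∀ j, s'.mem 50 j = if j < i then w.getD j 0 else 0) h4 hN
    rfl rfl rfl ?_ ?_) fun s1 hs1 h => Exec.assign ?_
  · intro j
    simpa [mem_setReg] using hm 0 j
  · intro i s1 hi hs1 hri hI
    refine Exec.store fun j => ?_
    simp only [mem_setReg, RAMExpr.eval, hri, mem_setMem, hs1.mem 0 rfl]
    rcases eq_or_ne j i with rfl | hji
    · simp [hw j hi]
    · rw [if_neg hji, hI j]
      have : j < i + 1 ↔ j < i := by lia
      simp only [this]
  · simp only [RAMState.unshift, RAMState.init, RAMState.mk.injEq]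
    refine ⟨funext fun x => ?_, funext fun a => funext fun i => ?_⟩
    · rw [reg_setReg]
      rcases Nat.eq_zero_or_pos x with rfl | hx
      · simp [RAMExpr.eval, hs1.reg 4 rfl, h4]
      · have hwr : (forp 47 4 (.store 50 (.reg 47) (.read 0 (.reg 47)))).wr (x + 50) = false := by
          simp [forp, wr]
        rw [if_neg (by lia), if_neg (by lia), hs1.reg _ hwr, hr x]
    · rw [mem_setReg]
      rcases Nat.eq_zero_or_pos a with rfl | ha
      · simp only [zero_add, h i, if_true]
        split_ifs with h'
        · rfl
        · rw [List.getD_eq_default _ _ (by lia)]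
      · have hwm : (forp 47 4 (.store 50 (.reg 47) (.read 0 (.reg 47)))).wm (a + 50) = false := by
          simp [forp, wm]
          lia
        rw [if_neg (by lia), hs1.mem _ hwm, hm a]

/-- Output the indicator of the set in register `14`. -/
def outputSet : RAMProg :=
  .assign 10 (.reg 14) ;; decode ;; forp 48 1 (.store 0 (.reg 48) (.read 6 (.reg 48))) ;;
    .assign 0 (.reg 1)

theorem exec_outputSet {A : ℕ → ℕ → Prop} (hN : n ≤ N) (hE : Env n A s) {S : Finset ℕ}
    (hS : S ⊆ Finset.range n) (h14 : s.reg 14 = mask S) :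
    Exec N outputSet s fun s' => s'.output = List.ofFn fun v : Fin n => bit01 ((v : ℕ) ∈ S) := by
  refine Exec.seq (Exec.assign ?_)
  refine Exec.seq' (exec_decode hN hE.setReg hS ?_) fun s1 hs1 hb => ?_
  · simp [reg_setReg, RAMExpr.eval, h14]
  · have g1 : s1.reg 1 = n := (hE.setReg.of_same hs1).size
    refine Exec.seq' (Exec.forp (fun i s' => ∀ v < i, s'.mem 0 v = bit01 (v ∈ S)) g1 hN rfl rfl rfl
      (by simp) ?_) fun s2 hs2 h => Exec.assign ?_
    · intro i s2 hi hs2 hri hI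
      refine Exec.store fun v hv => ?_
      simp only [mem_setReg, RAMExpr.eval, hri, mem_setMem, hs2.mem 6 rfl]
      rcases Nat.lt_succ_iff_lt_or_eq.1 hv with h' | rfl
      · rw [if_neg h'.ne]; exact hI v h'
      · rw [if_pos rfl]; exact hb v hi
    · refine List.ext_getElem ?_ fun i h1 h2 => ?_
      · simp [RAMState.output, reg_setReg, RAMExpr.eval, hs2.reg 1 rfl, g1]
      · rw [List.length_ofFn] at h2
        simp [RAMState.output, mem_setReg, h i h2]

/-- Output whether the number in register `15` is greater than that in register `7`. -/
def outputTest : RAMProg :=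
  .cond (leE (.add (.reg 7) (.num 1)) (.reg 15)) (.store 0 (.num 0) (.num 1))
    (.store 0 (.num 0) (.num 0)) ;; .assign 0 (.num 1)

theorem exec_outputTest {m c : ℕ} (h7 : s.reg 7 = m) (h15 : s.reg 15 = c + 1) :
    Exec N outputTest s fun s' => s'.output = [bit01 (m ≤ c)] := by
  refine Exec.seq' (R := fun s' => s'.mem 0 0 = bit01 (m ≤ c)) (Exec.cond (fun h => Exec.store ?_)
    fun h => Exec.store ?_) fun s1 _ h => Exec.assign ?_
  · rw [Ne, eval_leE, not_lt] at h
    simp only [RAMExpr.eval, h7, h15] at h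
    simp only [RAMExpr.eval, mem_setMem, if_true]
    rw [bit01_true (by lia)]
  · rw [eval_leE] at h
    simp only [RAMExpr.eval, h7, h15] at h
    simp only [RAMExpr.eval, mem_setMem, if_true]
    rw [bit01_false (by lia)]
  · simp [RAMState.output, reg_setReg, RAMExpr.eval, mem_setReg, h, List.range_succ]

end RAMProg

/-! ### Maximum cuts that split few classes -/

section CanonicalCut

variable {n : ℕ} {A : ℕ → ℕ → Prop}

/-- The bilinear form of the relation `A` below `n`. -/
noncomputable def bilin (n : ℕ) (A : ℕ → ℕ → Prop) (f g : ℕ → ℤ) : ℤ :=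
  ∑ u ∈ Finset.range n, ∑ v ∈ Finset.range n, f u * (bit01 (A u v) : ℤ) * g v

/-- The sum of `g` over the neighbours of `u`. -/
noncomputable def rowSum (n : ℕ) (A : ℕ → ℕ → Prop) (u : ℕ) (g : ℕ → ℤ) : ℤ :=
  ∑ v ∈ Finset.range n, (bit01 (A u v) : ℤ) * g v

/-- The indicator function of `S`. -/
noncomputable def ind (S : Finset ℕ) (v : ℕ) : ℤ := if v ∈ S then 1 else 0

theorem bilin_add_left (f f' g : ℕ → ℤ) :
    bilin n A (f + f') g = bilin n A f g + bilin n A f' g := by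
  simp only [bilin, Pi.add_apply, add_mul, Finset.sum_add_distrib]

theorem bilin_sub_left (f f' g : ℕ → ℤ) :
    bilin n A (f - f') g = bilin n A f g - bilin n A f' g := by
  simp only [bilin, Pi.sub_apply, sub_mul, Finset.sum_sub_distrib]

theorem bilin_comm (hA : ∀ u v, A u v → A v u) (f g : ℕ → ℤ) : bilin n A f g = bilin n A g f := by
  rw [bilin, Finset.sum_comm]
  refine Finset.sum_congr rfl fun u _ => Finset.sum_congr rfl fun v _ => ?_
  have : A v u ↔ A u v := ⟨hA v u, hA u v⟩
  rw [this]
  ring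

theorem bilin_ind_singleton {x : ℕ} (hx : x < n) (g : ℕ → ℤ) :
    bilin n A (ind {x}) g = rowSum n A x g := by
  simp [bilin, rowSum, ind, Finset.mem_range.2 hx, ite_mul]

theorem rowSum_ind_singleton {x y : ℕ} (hy : y < n) :
    rowSum n A x (ind {y}) = bit01 (A x y) := by
  simp [rowSum, ind, hy]

theorem rowSum_congr {x y : ℕ} (h : SameNbrs n A x y) (g : ℕ → ℤ) :
    rowSum n A x g = rowSum n A y g := by
  refine Finset.sum_congr rfl fun v hv => ?_
  rw [propext (h v (Finset.mem_range.1 hv))]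

/-- Pairs starting in `S`, minus pairs inside `S`: the cut is a quadratic polynomial in the
indicator, so exchanges can be computed by bilinear expansion. -/
theorem cutN_eq (S : Finset ℕ) :
    (cutN n A S : ℤ) = bilin n A (ind S) 1 - bilin n A (ind S) (ind S) := by
  rw [cutN, bilin, bilin, ← Finset.sum_sub_distrib]
  push_cast
  refine Finset.sum_congr rfl fun u _ => ?_
  rw [← Finset.sum_sub_distrib]
  refine Finset.sum_congr rfl fun v _ => ?_
  simp only [ind, bit01, Pi.one_apply]
  by_cases h1 : u ∈ S <;> by_cases h2 : v ∈ S <;> by_cases h3 : A u v <;> simp [h1, h2, h3]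

/-- `S` with `x` replaced by `y`. -/
def exchange (S : Finset ℕ) (x y : ℕ) : Finset ℕ := insert y (S.erase x)

theorem exchange_subset {S : Finset ℕ} {x y : ℕ} (hS : S ⊆ Finset.range n) (hy : y < n) :
    exchange S x y ⊆ Finset.range n :=
  Finset.insert_subset (Finset.mem_range.2 hy) ((Finset.erase_subset _ _).trans hS)

theorem ind_exchange {S : Finset ℕ} {x y : ℕ} (hx : x ∈ S) (hy : y ∉ S) :
    ind (exchange S x y) = ind S + (ind {y} - ind {x}) := by
  ext v
  simp only [ind, exchange, Finset.mem_insert, Finset.mem_erase, Finset.mem_singleton, Pi.add_apply,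
    Pi.sub_apply]
  have hxy : x ≠ y := fun h => hy (h ▸ hx)
  by_cases h1 : v = x
  · subst h1; simp [hx, hxy]
  · by_cases h2 : v = y
    · subst h2; simp [hy, hxy.symm]
    · simp [h1, h2]

theorem bilin_exchange (hA : ∀ u v, A u v → A v u) {S : Finset ℕ} {x y : ℕ} (hx : x ∈ S) (hy : y ∉ S)
    (hxn : x < n) (hyn : y < n) :
    bilin n A (ind (exchange S x y)) (ind (exchange S x y)) = bilin n A (ind S) (ind S) +
      2 * (rowSum n A y (ind S) - rowSum n A x (ind S)) +
      ((bit01 (A y y) : ℤ) - 2 * bit01 (A x y) + bit01 (A x x)) := by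
  have hyx : A y x ↔ A x y := ⟨hA y x, hA x y⟩
  rw [ind_exchange hx hy, bilin_add_left, bilin_sub_left, bilin_comm hA (ind S),
    bilin_comm hA (ind {y}), bilin_comm hA (ind {x})]
  simp only [bilin_add_left, bilin_sub_left, bilin_comm hA (ind S) (ind {y}),
    bilin_comm hA (ind S) (ind {x}), bilin_ind_singleton hyn, bilin_ind_singleton hxn,
    rowSum_ind_singleton hyn, rowSum_ind_singleton hxn, hyx]
  ring

/-- The last bracket is the second order term. For a reflexive relation it vanishes when `x` and `y`
are adjacent, and it equals `2` when they are not. -/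
theorem cutN_exchange_eq (hA : ∀ u v, A u v → A v u) {S : Finset ℕ} {x y : ℕ} (hx : x ∈ S)
    (hy : y ∉ S) (hxn : x < n) (hyn : y < n) :
    (cutN n A (exchange S x y) : ℤ) = cutN n A S + (rowSum n A y 1 - rowSum n A x 1) -
      2 * (rowSum n A y (ind S) - rowSum n A x (ind S)) -
      ((bit01 (A y y) : ℤ) - 2 * bit01 (A x y) + bit01 (A x x)) := by
  rw [cutN_eq, cutN_eq, bilin_exchange hA hx hy hxn hyn, ind_exchange hx hy, bilin_add_left,
    bilin_sub_left, bilin_ind_singleton hyn, bilin_ind_singleton hxn]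
  ring

/-- Exchanging two elements of the same class changes neither the size of the cut nor the number of
pairs of elements of the same class. -/
theorem cutN_exchange_same (hA : ∀ u v, A u v → A v u) (hr : ∀ u, A u u) {S : Finset ℕ} {x y : ℕ}
    (hx : x ∈ S) (hy : y ∉ S) (hxn : x < n) (hyn : y < n) (hxy : SameNbrs n A x y) :
    (cutN n A (exchange S x y) : ℤ) = cutN n A S ∧
      bilin n (SameNbrs n A) (ind (exchange S x y)) (ind (exchange S x y)) =
        bilin n (SameNbrs n A) (ind S) (ind S) := by
  have h1 : A x y := (hxy y hyn).2 (hr y)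
  have h2 : SameNbrs n (SameNbrs n A) x y := fun z _ => ⟨hxy.symm.trans, hxy.trans⟩
  rw [cutN_exchange_eq hA hx hy hxn hyn, bilin_exchange (fun _ _ h => h.symm) hx hy hxn hyn,
    rowSum_congr hxy, rowSum_congr hxy, rowSum_congr h2, bit01_true h1, bit01_true (hr x),
    bit01_true (hr y), bit01_true hxy, bit01_true (SameNbrs.refl (n := n) (A := A) x), bit01_true (SameNbrs.refl (n := n) (A := A) y)]
  constructor <;> ring

/-- If two adjacent classes are both split, then the cut size is an affine function along the
exchange of their elements, and the number of pairs of elements of the same class is convex. -/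
theorem cutN_exchange_adj (hA : ∀ u v, A u v → A v u) (hr : ∀ u, A u u) {S : Finset ℕ}
    {x y x' y' : ℕ} (hx : x ∈ S) (hy : y ∉ S) (hx' : x' ∉ S) (hy' : y' ∈ S) (hxn : x < n)
    (hyn : y < n) (hxn' : x' < n) (hyn' : y' < n) (hxx : SameNbrs n A x x')
    (hyy : SameNbrs n A y y') (hxy : A x y) (hne : ¬SameNbrs n A x y) :
    (cutN n A (exchange S x y) : ℤ) + cutN n A (exchange S y' x') = 2 * cutN n A S ∧
      bilin n (SameNbrs n A) (ind (exchange S x y)) (ind (exchange S x y)) +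
        bilin n (SameNbrs n A) (ind (exchange S y' x')) (ind (exchange S y' x')) =
        2 * bilin n (SameNbrs n A) (ind S) (ind S) + 4 := by
  have h1 : A y' x' := by
    have h2 := hA _ _ ((hxx y hyn).1 hxy)
    exact (hyy x' hxn').1 h2
  -- The same exchange formula is applied to the relation `SameNbrs n A` itself, whose quadratic
  -- form on `ind S` is the sum of the squares of the class traces. Its second order term is `2` for
  -- different classes, hence the `4` for two exchanges.
  have h2 : SameNbrs n (SameNbrs n A) x x' := fun z _ => ⟨hxx.symm.trans, hxx.trans⟩
  have h3 : SameNbrs n (SameNbrs n A) y y' := fun z _ => ⟨hyy.symm.trans, hyy.trans⟩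
  have h4 : ¬SameNbrs n A y' x' := fun h => hne (hxx.trans ((hyy.trans h).symm))
  rw [cutN_exchange_eq hA hx hy hxn hyn, cutN_exchange_eq hA hy' hx' hyn' hxn',
    bilin_exchange (fun _ _ h => h.symm) hx hy hxn hyn,
    bilin_exchange (fun _ _ h => h.symm) hy' hx' hyn' hxn', bit01_true hxy, bit01_true h1,
    bit01_true (hr x), bit01_true (hr y), bit01_true (hr x'), bit01_true (hr y'),
    bit01_false hne, bit01_false h4, bit01_true (SameNbrs.refl (n := n) (A := A) x), bit01_true (SameNbrs.refl (n := n) (A := A) y),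
    bit01_true (SameNbrs.refl (n := n) (A := A) x'), bit01_true (SameNbrs.refl (n := n) (A := A) y')]
  simp only [rowSum_congr hxx, rowSum_congr hyy, rowSum_congr h2, rowSum_congr h3]
  constructor <;> push_cast <;> ring

/-- There is a maximum cut which meets every class in an initial segment and which does not split
two adjacent classes. -/
theorem exists_canonical_cut (hA : ∀ u v, A u v → A v u) (hr : ∀ u, A u u) :
    ∃ S₀ ⊆ Finset.range n, (∀ S ⊆ Finset.range n, cutN n A S ≤ cutN n A S₀) ∧
      (∀ w ∈ S₀, ∀ z ≤ w, SameNbrs n A z w → z ∈ S₀) ∧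
      ∀ x < n, ∀ y < n, ∀ x' < n, ∀ y' < n, x ∈ S₀ → y ∉ S₀ → x' ∉ S₀ → y' ∈ S₀ →
        SameNbrs n A x x' → SameNbrs n A y y' → A x y → SameNbrs n A x y := by
  classical
  -- Three successive choices: maximize the cut, then the sum of squares of the class traces, then
  -- minimize the sum of the elements.
  obtain ⟨S₁, hS₁, hmax₁⟩ := (Finset.range n).powerset.exists_max_image (cutN n A)
    ⟨∅, Finset.empty_mem_powerset _⟩
  obtain ⟨S₂, hS₂, hmax₂⟩ := ((Finset.range n).powerset.filter
    fun S => cutN n A S = cutN n A S₁).exists_max_image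
    (fun S => bilin n (SameNbrs n A) (ind S) (ind S)) ⟨S₁, Finset.mem_filter.2 ⟨hS₁, rfl⟩⟩
  obtain ⟨S₃, hS₃, hmin₃⟩ := (((Finset.range n).powerset.filter
    fun S => cutN n A S = cutN n A S₁).filter fun S =>
    bilin n (SameNbrs n A) (ind S) (ind S) = bilin n (SameNbrs n A) (ind S₂) (ind S₂)).exists_min_image
    (fun S => ∑ v ∈ S, v) ⟨S₂, Finset.mem_filter.2 ⟨hS₂, rfl⟩⟩
  simp only [Finset.mem_filter, Finset.mem_powerset] at hS₁ hS₂ hS₃ hmax₁ hmax₂ hmin₃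
  obtain ⟨⟨hS, hcut⟩, hpsi⟩ := hS₃
  have hmax : ∀ S ⊆ Finset.range n, cutN n A S ≤ cutN n A S₃ := fun S h => hcut ▸ hmax₁ S h
  have hmax' : ∀ S ⊆ Finset.range n, cutN n A S = cutN n A S₃ →
      bilin n (SameNbrs n A) (ind S) (ind S) ≤ bilin n (SameNbrs n A) (ind S₃) (ind S₃) :=
    fun S h h' => hpsi ▸ hmax₂ S ⟨h, h'.trans hcut⟩
  refine ⟨S₃, hS, hmax, fun w hw z hz hzw => ?_, ?_⟩
  · by_contra hzS
    have hwn := Finset.mem_range.1 (hS hw)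
    -- Replacing `w` by the smaller twin `z` preserves the first two quantities and lowers the
    -- third.
    obtain ⟨h1, h2⟩ := cutN_exchange_same hA hr hw hzS hwn (by lia) hzw.symm
    have h3 := hmin₃ (exchange S₃ w z) ⟨⟨exchange_subset hS (by lia), by
      rw [← hcut]; exact_mod_cast h1⟩, h2.trans hpsi⟩
    rw [exchange, Finset.sum_insert (fun h => hzS (Finset.mem_of_mem_erase h)),
      ← Finset.add_sum_erase _ _ hw] at h3
    have h4 : z ≠ w := fun h => hzS (h ▸ hw)
    lia
  · intro x hxn y hyn x' hxn' y' hyn' hx hy hx' hy' hxx hyy hxy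
    by_contra hne
    obtain ⟨h1, h2⟩ := cutN_exchange_adj hA hr hx hy hx' hy' hxn hyn hxn' hyn' hxx hyy hxy hne
    have h3 := hmax _ (exchange_subset (x := x) hS hyn)
    have h4 := hmax _ (exchange_subset (x := y') hS hxn')
    -- The two exchanged cuts average to a maximum cut, so both are maximum; then their sums of
    -- squares cannot average to more than that of `S₃`.
    have h5 := hmax' _ (exchange_subset (x := x) hS hyn) (by lia)
    have h6 := hmax' _ (exchange_subset (x := y') hS hxn') (by lia)
    lia

/-- Both classes are split, so adjacency would put `u` and `v` into the same class; each is the last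
element of `S` in its class, hence they would be equal. -/
theorem not_adj_of_mem_splitters (hA : ∀ u v, A u v → A v u) {lab : ℕ → ℕ} {S : Finset ℕ}
    (hS : S ⊆ Finset.range n)
    (h : ∀ x < n, ∀ y < n, ∀ x' < n, ∀ y' < n, x ∈ S → y ∉ S → x' ∉ S → y' ∈ S →
        SameNbrs n A x x' → SameNbrs n A y y' → A x y → SameNbrs n A x y)
    {x u v : ℕ} (hu : u ∈ splitters n A lab S x) (hv : v ∈ splitters n A lab S x) (huv : u ≠ v) :
    ¬A u v := by
  classical
  intro hadj
  rw [splitters, Finset.mem_filter] at hu hv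
  obtain ⟨huS, -, humax, z, hz, hzu, hzS⟩ := hu
  obtain ⟨hvS, -, hvmax, z', hz', hzv, hzS'⟩ := hv
  have hun := Finset.mem_range.1 (hS huS)
  have hvn := Finset.mem_range.1 (hS hvS)
  have h1 := h u hun z' hz' z hz v hvn huS hzS' hzS hvS hzu.symm hzv
    (hA _ _ ((hzv u hun).2 (hA _ _ hadj)))
  have h2 := h1.trans hzv
  exact huv (le_antisymm (hvmax u huS h2) (humax v hvS h2.symm))

end CanonicalCut

/-! ### Graphs -/

section Graphs

variable {n : ℕ} (G : SimpleGraph (Fin n))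

/-- The adjacency relation of a graph, on natural numbers. -/
def natAdj (u v : ℕ) : Prop := ∃ (hu : u < n) (hv : v < n), G.Adj ⟨u, hu⟩ ⟨v, hv⟩

/-- The closed adjacency relation of a graph, on natural numbers. -/
def closedAdj (u v : ℕ) : Prop := u = v ∨ natAdj G u v

theorem natAdj_coe {u v : Fin n} : natAdj G u v ↔ G.Adj u v := by simp [natAdj]

theorem closedAdj_coe {u v : Fin n} : closedAdj G u v ↔ u = v ∨ G.Adj u v := by
  rw [closedAdj, natAdj_coe, Fin.val_inj]

theorem closedAdj_symm (u v : ℕ) (h : closedAdj G u v) : closedAdj G v u := by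
  rcases h with rfl | ⟨hu, hv, h⟩
  · exact Or.inl rfl
  · exact Or.inr ⟨hv, hu, h.symm⟩

theorem cutSize_eq (S : Finset (Fin n)) :
    cutSize G S = cutN n (closedAdj G) (S.map Fin.valEmbedding) := by
  classical
  have h1 : {e | e ∈ G.edgeSet ∧ ∃ u ∈ S, ∃ v ∉ S, e = s(u, v)} =
      (fun p : Fin n × Fin n => s(p.1, p.2)) '' {p | p.1 ∈ S ∧ p.2 ∉ S ∧ G.Adj p.1 p.2} := by
    ext e
    constructor
    · rintro ⟨he, u, hu, v, hv, rfl⟩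
      exact ⟨(u, v), ⟨hu, hv, he⟩, rfl⟩
    · rintro ⟨⟨u, v⟩, ⟨hu, hv, h⟩, rfl⟩
      exact ⟨h, u, hu, v, hv, rfl⟩
  -- A cut edge has exactly one orientation leaving `S`, so ordered pairs count edges once.
  have h2 : Set.InjOn (fun p : Fin n × Fin n => s(p.1, p.2))
      {p | p.1 ∈ S ∧ p.2 ∉ S ∧ G.Adj p.1 p.2} := by
    rintro ⟨u, v⟩ ⟨hu, hv, -⟩ ⟨u', v'⟩ ⟨hu', hv', -⟩ h
    rcases Sym2.eq_iff.1 h with ⟨h1, h2⟩ | ⟨h1, h2⟩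
    · exact Prod.ext h1 h2
    · change u = v' at h1
      subst h1
      exact absurd hu hv'
  have h3 : {p : Fin n × Fin n | p.1 ∈ S ∧ p.2 ∉ S ∧ G.Adj p.1 p.2} =
      ↑(Finset.univ.filter fun p : Fin n × Fin n => p.1 ∈ S ∧ p.2 ∉ S ∧ G.Adj p.1 p.2) := by
    simp
  rw [cutSize, h1, h2.ncard_image, h3, Set.ncard_coe_finset, Finset.card_filter,
    ← Finset.univ_product_univ, Finset.sum_product, cutN, Finset.sum_range]
  refine Finset.sum_congr rfl fun u _ => ?_
  rw [Finset.sum_range]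
  refine Finset.sum_congr rfl fun v _ => ?_
  rw [bit01]
  congr 1
  simp only [Finset.mem_map, Fin.valEmbedding_apply, Fin.val_inj, exists_eq_right, closedAdj_coe,
    eq_iff_iff]
  refine and_congr_right fun hu => and_congr_right fun hv => ?_
  -- The added loops never run from `S` to its complement.
  exact ⟨Or.inr, fun h => h.resolve_left fun h => hv (h ▸ hu)⟩

theorem exists_map_val_eq {S : Finset ℕ} (hS : S ⊆ Finset.range n) :
    (Finset.univ.filter fun v : Fin n => (v : ℕ) ∈ S).map Fin.valEmbedding = S := by
  ext v
  simp only [Finset.mem_map, Finset.mem_filter, Finset.mem_univ, true_and, Fin.valEmbedding_apply]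
  constructor
  · rintro ⟨v, hv, rfl⟩
    exact hv
  · intro hv
    exact ⟨⟨v, Finset.mem_range.1 (hS hv)⟩, hv, rfl⟩

theorem map_val_subset (S : Finset (Fin n)) : S.map Fin.valEmbedding ⊆ Finset.range n := by
  intro v hv
  obtain ⟨v, -, rfl⟩ := Finset.mem_map.1 hv
  simp

/-! #### Bubbles are classes -/

/-- Adding a loop at each vertex turns the twin condition into equality of neighbourhoods, which is
visibly an equivalence relation. -/
theorem sameNbrs_iff {u v : Fin n} :
    SameNbrs n (closedAdj G) u v ↔ u = v ∨ AreTwins G u v := by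
  have key : SameNbrs n (closedAdj G) u v ↔ ∀ z : Fin n, (u = z ∨ G.Adj u z) ↔ (v = z ∨ G.Adj v z) := by
    constructor
    · intro h z
      simpa only [closedAdj_coe] using h z z.2
    · intro h z hz
      simpa only [closedAdj_coe] using
        ((closedAdj_coe G (v := ⟨z, hz⟩)).trans (h ⟨z, hz⟩)).trans (closedAdj_coe G).symm
  rw [key]
  constructor
  · intro h
    by_cases huv : u = v
    · exact Or.inl huv
    · have hadj : G.Adj u v := ((h v).2 (Or.inl rfl)).resolve_left huv
      refine Or.inr ⟨hadj, ?_⟩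
      ext z
      simp only [Set.mem_sdiff, SimpleGraph.mem_neighborSet, Set.mem_singleton_iff]
      have hz := h z
      constructor
      · rintro ⟨h1, h2⟩
        exact ⟨(hz.1 (Or.inr h1)).resolve_left (Ne.symm h2), h1.ne'⟩
      · rintro ⟨h1, h2⟩
        exact ⟨(hz.2 (Or.inr h1)).resolve_left (Ne.symm h2), h1.ne'⟩
  · rintro (rfl | ⟨hadj, h⟩) z
    · rfl
    · have hz := Set.ext_iff.1 h z
      simp only [Set.mem_sdiff, SimpleGraph.mem_neighborSet, Set.mem_singleton_iff] at hz
      constructor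
      · rintro (rfl | h1)
        · exact Or.inr hadj.symm
        · by_cases hzv : z = v
          · exact Or.inl hzv.symm
          · exact Or.inr (hz.1 ⟨h1, hzv⟩).1
      · rintro (rfl | h1)
        · exact Or.inr hadj
        · by_cases hzu : z = u
          · exact Or.inl hzu.symm
          · exact Or.inr (hz.2 ⟨h1, hzu⟩).1

open scoped Classical in
/-- The class of a vertex: the vertex and its twins. -/
noncomputable def bubbleOf (v : Fin n) : Finset (Fin n) :=
  Finset.univ.filter fun z => SameNbrs n (closedAdj G) z v

theorem mem_bubbleOf {v z : Fin n} : z ∈ bubbleOf G v ↔ SameNbrs n (closedAdj G) z v := by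
  simp [bubbleOf]

theorem pairwise_bubbleOf (v : Fin n) : (bubbleOf G v : Set (Fin n)).Pairwise (AreTwins G) := by
  intro x hx y hy hxy
  rw [Finset.mem_coe, mem_bubbleOf] at hx hy
  exact ((sameNbrs_iff G).1 (hx.trans hy.symm)).resolve_left hxy

theorem subset_bubbleOf {v : Fin n} {C : Finset (Fin n)} (hC : (C : Set (Fin n)).Pairwise (AreTwins G))
    (hv : v ∈ C) : C ⊆ bubbleOf G v := by
  intro z hz
  rw [mem_bubbleOf, sameNbrs_iff]
  by_cases h : z = v
  · exact Or.inl h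
  · exact Or.inr (hC hz hv h)

/-- Being equal or twins is an equivalence relation, so a class is a set of pairwise twins and
absorbs every such set that meets it. -/
theorem isBubble_bubbleOf (v : Fin n) : IsBubble G (bubbleOf G v) :=
  ⟨pairwise_bubbleOf G v, fun _ hC hle =>
    subset_bubbleOf G hC (hle ((mem_bubbleOf G).2 (.refl _)))⟩

theorem IsBubble.eq_bubbleOf {v : Fin n} {B : Finset (Fin n)} (hB : IsBubble G B) (hv : v ∈ B) :
    B = bubbleOf G v :=
  hB.eq_of_le (pairwise_bubbleOf G v) (subset_bubbleOf G hB.1 hv)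

theorem IsUnionOfBubbles.bubbleOf_subset {v : Fin n} {U : Finset (Fin n)}
    (hU : IsUnionOfBubbles G U) (hv : v ∈ U) : bubbleOf G v ⊆ U := by
  obtain ⟨𝓑, h𝓑, hU⟩ := hU
  have h1 : v ∈ ⋃ B ∈ 𝓑, (B : Set (Fin n)) := hU ▸ hv
  obtain ⟨B, hB, hvB⟩ := Set.mem_iUnion₂.1 h1
  rw [← (h𝓑 B hB).eq_bubbleOf G hvB]
  intro z hz
  have : z ∈ (U : Set (Fin n)) := hU ▸ Set.mem_iUnion₂.2 ⟨B, hB, hz⟩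
  exact this

/-! ### From a bubble partition to the hypotheses of the algorithm -/

variable {G}

/-- This is where the graph parameters enter: the width bounds the number of classes per label, and
the independence number bounds the number of classes that the canonical cut splits per label. -/
theorem solvable_of_bubblePartition {α : ℕ} {P : Finpartition (Finset.univ : Finset (Fin n))}
    (hP : IsBubblePartition G P) (hα : partitionIndepNum G P ≤ α) {ℓ : Fin n → Fin n}
    (hℓ : ∀ u v, ℓ u = ℓ v ↔ P.part u = P.part v) {lab : ℕ → ℕ} (hlab : ∀ v : Fin n, lab v = ℓ v) :
    RAMProg.Solvable n α (partitionWidth G P) (natAdj G) lab (contractParts G P) := by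
  classical
  have hpart (v : Fin n) : P.part v ∈ P.parts := P.part_mem.2 (Finset.mem_univ v)
  have hself (v : Fin n) : v ∈ P.part v := P.mem_part_self.2 (Finset.mem_univ v)
  have hlabeq (u v : Fin n) : lab u = lab v ↔ P.part u = P.part v := by
    rw [hlab, hlab, Fin.val_inj, hℓ]
  have hsub (v : Fin n) : bubbleOf G v ⊆ P.part v := (hP.1 _ (hpart v)).bubbleOf_subset G (hself v)
  have hsame (u v : Fin n) (h : SameNbrs n (closedAdj G) u v) : P.part u = P.part v :=
    P.part_eq_of_mem (hpart v) (hsub v ((mem_bubbleOf G).2 h))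
  -- A tree has a vertex, so the partition has a part, and parts are non-empty.
  have hpos : 0 < n := by
    obtain ⟨U, hU⟩ := hP.2.connected.nonempty
    obtain ⟨v, -⟩ := P.nonempty_of_mem_parts hU
    exact v.pos
  have hmem (v z : Fin n) (h : lab z = lab v) : z ∈ P.part v :=
    (hlabeq z v).1 h ▸ hself z
  refine ⟨hpos, closedAdj_symm G, hP.2, fun v hv => ?_, fun u hu v hv h => ?_, ?_, fun x => ?_, ?_⟩
  · rw [hlab ⟨v, hv⟩]
    exact Fin.is_lt _
  · exact (hlabeq ⟨u, hu⟩ ⟨v, hv⟩).2 (hsame ⟨u, hu⟩ ⟨v, hv⟩ h)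
  · refine ⟨fun v => if hv : v < n then ⟨P.part ⟨v, hv⟩, hpart _⟩ else ⟨P.part ⟨0, hpos⟩, hpart _⟩,
      fun u hu v hv => ?_, fun u hu v hv huv => ?_⟩
    · beta_reduce
      rw [dif_pos hu, dif_pos hv, Subtype.mk.injEq]
      exact hlabeq ⟨u, hu⟩ ⟨v, hv⟩
    · beta_reduce
      rw [dif_pos hu, dif_pos hv]
      rcases huv with rfl | ⟨_, _, huv⟩
      · exact Or.inl rfl
      · by_cases h : P.part ⟨u, hu⟩ = P.part ⟨v, hv⟩
        · left; rw [Subtype.mk.injEq]; exact h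
        · right
          exact ⟨fun h' => h (congrArg Subtype.val h'), _, hself _, _, hself _, huv⟩
  · change {v | v < n ∧ IsLast n (closedAdj G) v ∧ lab v = x}.ncard ≤ _
    rcases Set.eq_empty_or_nonempty {v | v < n ∧ IsLast n (closedAdj G) v ∧ lab v = x} with h | h
    · rw [h]; simp
    · obtain ⟨v₀, hv₀, -, rfl⟩ := h
      have h1 : bubbleCount G (P.part ⟨v₀, hv₀⟩) ≤ partitionWidth G P :=
        Finset.le_sup (f := bubbleCount G) (hpart _)
      refine le_trans ?_ h1
      -- Last elements map injectively to the bubbles contained in the part; the value `∅` beyond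
      -- `n` is never used.
      refine Set.ncard_le_ncard_of_injOn
        (fun v => if hv : v < n then bubbleOf G ⟨v, hv⟩ else ∅) ?_ ?_ (Set.toFinite _)
      · rintro v ⟨hv, -, hvx⟩
        simp only [dif_pos hv]
        refine ⟨isBubble_bubbleOf G _, ?_⟩
        rw [← (hlabeq ⟨v, hv⟩ ⟨v₀, hv₀⟩).1 hvx]
        exact hsub _
      · rintro u ⟨hu, hu', -⟩ v ⟨hv, hv', -⟩ h
        simp only [dif_pos hu, dif_pos hv] at h
        have h2 : (⟨u, hu⟩ : Fin n) ∈ bubbleOf G ⟨v, hv⟩ := h ▸ (mem_bubbleOf G).2 (.refl _)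
        rw [mem_bubbleOf] at h2
        exact le_antisymm (hv' u hu h2) (hu' v hv h2.symm)
  · obtain ⟨S₀, hS₀, hmax, hinit, hadj⟩ :=
      exists_canonical_cut (n := n) (closedAdj_symm G) (fun u => Or.inl rfl)
    refine ⟨S₀, hS₀, hmax, hinit, fun x => ?_⟩
    change (splitters n (closedAdj G) lab S₀ x).card ≤ α
    have hD (w : ℕ) (hw : w ∈ splitters n (closedAdj G) lab S₀ x) : w < n ∧ lab w = x := by
      rw [splitters, Finset.mem_filter] at hw
      exact ⟨Finset.mem_range.1 (hS₀ hw.1), hw.2.1⟩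
    rcases Finset.eq_empty_or_nonempty (splitters n (closedAdj G) lab S₀ x) with h | ⟨v₀, hv₀⟩
    · rw [h]; simp
    · obtain ⟨hv₀n, rfl⟩ := hD v₀ hv₀
      set U := P.part ⟨v₀, hv₀n⟩ with hU
      have h1 : (G.induce (U : Set (Fin n))).indepNum ≤ partitionIndepNum G P :=
        Finset.le_sup (f := fun A : Finset (Fin n) => (G.induce (A : Set (Fin n))).indepNum)
          (hpart ⟨v₀, hv₀n⟩)
      refine le_trans ?_ (h1.trans hα)
      -- The splitters form an independent set in the subgraph induced by the part.
      set I : Finset (U : Set (Fin n)) := Finset.univ.filter fun z =>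
        ((z : Fin n) : ℕ) ∈ splitters n (closedAdj G) lab S₀ (lab v₀) with hI
      have h2 : (G.induce (U : Set (Fin n))).IsIndepSet (I : Set (U : Set (Fin n))) := by
        intro a ha b hb hab h
        rw [Finset.mem_coe, hI, Finset.mem_filter] at ha hb
        refine not_adj_of_mem_splitters (closedAdj_symm G) hS₀ hadj ha.2 hb.2
          (fun h' => hab (Subtype.ext (Fin.ext h'))) ?_
        exact (closedAdj_coe G).2 (Or.inr h)
      refine le_trans ?_ h2.card_le_indepNum
      refine Finset.card_le_card_of_surjOn (fun z : (U : Set (Fin n)) => ((z : Fin n) : ℕ)) ?_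
      intro w hw
      obtain ⟨hwn, hwx⟩ := hD w hw
      refine ⟨⟨⟨w, hwn⟩, hmem ⟨v₀, hv₀n⟩ ⟨w, hwn⟩ hwx⟩, ?_, rfl⟩
      rw [hI]
      simpa using hw

end Graphs

/-! ### Assembly -/

theorem length_encodeGraph (G : FinGraph) : (encodeGraph G).length = G.1 * G.1 + 1 := by
  simp [encodeGraph, Function.comp_def]

theorem getD_encodeGraph (G : FinGraph) {u v : ℕ} (hu : u < G.1) (hv : v < G.1) :
    (encodeGraph G).getD (1 + u * G.1 + v) 0 = bit01 (natAdj G.2 u v) := by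
  obtain ⟨n, G⟩ := G
  change u < n at hu
  change v < n at hv
  have hlt : u * n + v < n * n := by
    calc u * n + v < u * n + n := by lia
      _ = (u + 1) * n := by ring
      _ ≤ n * n := Nat.mul_le_mul_right _ hu
  have hdiv (i j : Fin n) (h : (i : ℕ) * n + j < n * n) :
      Fin.divNat (⟨i * n + j, h⟩ : Fin (n * n)) = i := by
    ext
    rw [Fin.coe_divNat]
    change (i * n + j : ℕ) / n = i
    rw [mul_comm, Nat.mul_add_div (by lia), Nat.div_eq_of_lt j.2, add_zero]
  have hmod (i j : Fin n) (h : (i : ℕ) * n + j < n * n) :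
      Fin.modNat (⟨i * n + j, h⟩ : Fin (n * n)) = j := by
    ext
    rw [Fin.coe_modNat]
    change (i * n + j : ℕ) % n = j
    rw [mul_comm, Nat.mul_add_mod, Nat.mod_eq_of_lt j.2]
  -- Flattening the matrix row by row is a single list indexed by division and remainder modulo `n`.
  have h := List.ofFn_mul (m := n) (n := n)
    fun x : Fin (n * n) => bit01 (G.Adj (Fin.divNat x) (Fin.modNat x))
  simp only [hdiv, hmod] at h
  rw [encodeGraph, ← h, add_assoc, add_comm 1, List.getD_cons_succ,
    List.getD_eq_getElem _ _ (by simpa using hlt), List.getElem_ofFn]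
  rw [hdiv ⟨u, hu⟩ ⟨v, hv⟩ hlt, hmod ⟨u, hu⟩ ⟨v, hv⟩ hlt]
  congr 1
  simp [natAdj, hu, hv]

theorem length_le_bitLength (w : List ℕ) : w.length ≤ bitLength w := by
  induction w with
  | nil => simp
  | cons a w ih =>
    simp only [bitLength, List.map_cons, List.sum_cons, List.length_cons] at ih ⊢
    lia

/-! ### Composition with the given algorithm and time estimates -/

namespace RAMProg

/-- A bound for the number of iterations of all loops, for a graph with `n` vertices. -/
def loopBound (n α k : ℕ) : ℕ := (n + 1) ^ α * (n * 2 ^ k) + α + (n * n + 1)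

theorem loopBound_le {n α k b : ℕ} (hb : n * n + 1 ≤ b) :
    loopBound n α k + 1 ≤ (2 ^ k + α + 2) * b ^ (α + 1) := by
  have h1 : n ≤ n * n := Nat.le_mul_self n
  have h2 : (n + 1) ^ α ≤ b ^ α := Nat.pow_le_pow_left (by lia) α
  have h3 : 1 ≤ b ^ (α + 1) := Nat.one_le_pow _ _ (by lia)
  have h4 : b ≤ b ^ (α + 1) := Nat.le_self_pow (by lia) b
  calc loopBound n α k + 1
      = (n + 1) ^ α * (n * 2 ^ k) + α + (n * n + 1) + 1 := rfl
    -- From `n * n + 1 ≤ b` both `n` and `n + 1` are at most `b`, the latter also for `n = 0` and `n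
    -- = 1`.
    _ ≤ b ^ α * (b * 2 ^ k) + α * b ^ (α + 1) + b ^ (α + 1) + b ^ (α + 1) := by
      gcongr
      · lia
      · exact Nat.le_mul_of_pos_right _ h3
      · lia
    _ = (2 ^ k + α + 2) * b ^ (α + 1) := by ring

/-- The algorithm: copy the input, find a bubble partition, find a maximum cut. -/
def cutProg (α : ℕ) (p : RAMProg) : RAMProg := .seq copyProg (.seq (p.shift 50) (mainProg α))

/-- The assumptions concern only the graph part of the input and the zero cells from index 50 on, so
both problems can use it; register 7 survives and can carry the threshold of the decision problem.
-/
theorem run_cutProg {α : ℕ} {p : RAMProg} {G : FinGraph} {out : List ℕ} {t₀ : ℕ}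
    (hp : p.Outputs (encodeGraph G) out t₀) (hout : IsOptimalBubblePartitionOutput α G out)
    {s : RAMState} (h4 : s.reg 4 = G.1 * G.1 + 1)
    (hw : ∀ i < G.1 * G.1 + 1, s.mem 0 i = (encodeGraph G).getD i 0)
    (hr : ∀ x, s.reg (x + 50) = 0) (hm : ∀ a i, s.mem (a + 50) i = 0) :
    ∃ s' t, (cutProg α p).Run s s' t ∧
      t ≤ copyProg.bound (loopBound G.1 α (bwParam α G)) + t₀ +
        (mainProg α).bound (loopBound G.1 α (bwParam α G)) ∧
      s'.reg 7 = s.reg 7 ∧ Env G.1 (closedAdj G.2) s' ∧ ∃ S : Finset (Fin G.1), IsMaxCut G.2 S ∧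
        s'.reg 14 = mask (S.map Fin.valEmbedding) ∧ s'.reg 15 = cutSize G.2 S + 1 := by
  obtain ⟨P, hP, hPα, hPw, ℓ, rfl, hℓ⟩ := hout
  have hk : bwParam α G = partitionWidth G.2 P := by
    rw [bwParam, ← hPw, ENat.toNat_natCast]
  have hlen := length_encodeGraph G
  set N := loopBound G.1 α (bwParam α G) with hN
  obtain ⟨s₁, t₁, hrun₁, ht₁, h₁⟩ := exec_copyProg (N := N) (s := s) (w := encodeGraph G)
    (by rw [hlen, hN, loopBound]; lia) (h4.trans hlen.symm) (by rwa [hlen]) hr hm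
  obtain ⟨sf, hrunf, hsf⟩ := hp
  obtain ⟨s₂, hrun₂, h₂⟩ := hrunf.shift s₁ h₁
  have hs₁ := hrun₁.same
  have hs₂ := hrun₂.same
  have hreg : s₂.reg 50 = G.1 := by
    have := congrArg List.length hsf
    rw [← h₂] at this
    simpa [RAMState.output, RAMState.unshift] using this
  -- Bank 0 of the given algorithm is bank 50 here, so its output already lies where `mainProg`
  -- expects the labels.
  have hlab (v : Fin G.1) : s₂.mem 50 v = ℓ v := by
    have := congrArg (fun l => l.getD v 0) hsf
    rw [← h₂] at this
    simpa [RAMState.output, RAMState.unshift, hreg, List.getD_eq_getElem?_getD] using this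
  have hmem : ∀ i < G.1 * G.1 + 1, s₂.mem 0 i = (encodeGraph G).getD i 0 := by
    intro i hi
    rw [hs₂.mem 0 (wm_shift (by lia) p), hs₁.mem 0 rfl, hw i hi]
  have hsolv := solvable_of_bubblePartition hP hPα hℓ hlab
  rw [← hk] at hsolv
  obtain ⟨s₃, t₃, hrun₃, ht₃, hE, S, hS, h14, h15, hmax⟩ := exec_mainProg (N := N) (s := s₂)
    (by rw [hN, loopBound]; lia) (by rw [hN, loopBound]; lia) hsolv
    ((hmem 0 (by lia)).trans (by simp [encodeGraph])) (fun u hu v hv => by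
      have h1 : 1 + u * G.1 + v < G.1 * G.1 + 1 := by
        have h2 : (u + 1) * G.1 ≤ G.1 * G.1 := Nat.mul_le_mul_right _ hu
        rw [add_mul] at h2
        lia
      rw [hmem _ h1, getD_encodeGraph G hu hv])
  refine ⟨s₃, _, .seq hrun₁ (.seq hrun₂ hrun₃), by lia, ?_, hE, ?_⟩
  · rw [hrun₃.same.reg 7 rfl, hs₂.reg 7 (wr_shift (by lia) p), hs₁.reg 7 rfl]
  · rw [← exists_map_val_eq hS] at h14 h15 hmax
    refine ⟨_, fun T => ?_, h14, ?_⟩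
    · rw [cutSize_eq, cutSize_eq]
      exact hmax _ (map_val_subset T)
    · rw [cutSize_eq]
      exact h15

theorem computable_param {f : ℕ → ℕ} (hf : Computable f) (C α d : ℕ) :
    Computable fun k => C * (2 ^ k + α + 2) ^ d + f k := by
  have hpow : Primrec₂ ((· ^ ·) : ℕ → ℕ → ℕ) := Primrec₂.unpaired'.1 Nat.Primrec.pow
  have h1 : Primrec fun k : ℕ => C * (2 ^ k + α + 2) ^ d :=
    Primrec.nat_mul.comp (.const C) (hpow.comp (Primrec.nat_add.comp (Primrec.nat_add.comp
      (hpow.comp (.const 2) .id) (.const α)) (.const 2)) (.const d))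
  exact Primrec.nat_add.to_comp.comp h1.to_comp hf

/-- Here `w` stands for the length of the encoded graph and `b` for that of the whole instance,
which may carry a further number; `T` bounds the added code and `t₀` the given algorithm. -/
theorem time_le {C d b α k n c fk t t₀ w T : ℕ} (hT : T ≤ C * (loopBound n α k + 1) ^ d)
    (hw : n * n + 1 ≤ w) (hb : w ≤ b) (ht₀ : t₀ ≤ fk * w ^ c) (ht : t ≤ T + t₀) :
    t ≤ (C * (2 ^ k + α + 2) ^ d + fk) * b ^ ((α + 1) * d + c) := by
  have h1 : 1 ≤ b := by lia
  have h2 : b ^ ((α + 1) * d) ≤ b ^ ((α + 1) * d + c) := Nat.pow_le_pow_right h1 (by lia)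
  have h3 : b ^ c ≤ b ^ ((α + 1) * d + c) := Nat.pow_le_pow_right h1 (by lia)
  calc t ≤ T + t₀ := ht
    _ ≤ C * ((2 ^ k + α + 2) * b ^ (α + 1)) ^ d + fk * b ^ c := by
      refine add_le_add (hT.trans ?_) (ht₀.trans ?_)
      · gcongr
        exact loopBound_le (hw.trans hb)
      · gcongr
    _ = C * (2 ^ k + α + 2) ^ d * b ^ ((α + 1) * d) + fk * b ^ c := by
      rw [mul_pow, ← pow_mul]; ring
    _ ≤ C * (2 ^ k + α + 2) ^ d * b ^ ((α + 1) * d + c) + fk * b ^ ((α + 1) * d + c) := by gcongr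
    _ = _ := by ring

end RAMProg

section FinalPrograms

open RAMProg

theorem fptSolvable_maxCut {α : ℕ}
    (hfind : FPTSolvable encodeGraph (InBW α) (bwParam α) (IsOptimalBubblePartitionOutput α)) :
    FPTSolvable encodeGraph (InBW α) (bwParam α) IsMaxCutOutput := by
  obtain ⟨p, f, c, hf, hp⟩ := hfind
  set pre : RAMProg := .assign 4 (.reg 0) with hpre
  -- The program `p` is left out: it has no loop bound, and its time is supplied by the hypothesis.
  obtain ⟨C, d, hCd⟩ := bound_poly (.seq pre (.seq copyProg (.seq (mainProg α) outputSet)))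
  refine ⟨.seq pre (.seq (cutProg α p) outputSet), _, (α + 1) * d + c, computable_param hf C α d,
    fun G hG => ?_⟩
  obtain ⟨out, t₀, hout, hopt, ht₀⟩ := hp G hG
  set N := loopBound G.1 α (bwParam α G) with hN
  have hlen := length_encodeGraph G
  set s := (RAMState.init (encodeGraph G)).setReg 4 ((encodeGraph G).length) with hs
  obtain ⟨s₁, t₁, hrun₁, ht₁, -, hE, S, hS, h14, -⟩ := run_cutProg (s := s) hout hopt
    (by simp [hs, reg_setReg, hlen]) (fun i _ => by simp [hs, mem_setReg, RAMState.init])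
    (fun x => by
      rw [hs, reg_setReg, if_neg (by lia)]
      simp [RAMState.init])
    (fun a i => by simp [hs, mem_setReg, RAMState.init])
  obtain ⟨s₂, t₂, hrun₂, ht₂, h₂⟩ := exec_outputSet (N := N) (by
    have := Nat.le_mul_self G.1
    rw [hN, loopBound]; lia) hE (map_val_subset S) h14
  refine ⟨_, _, ⟨s₂, .seq (.assign 4 (.reg 0) _) (.seq hrun₁ hrun₂), h₂⟩, ⟨S, hS, ?_⟩, ?_⟩
  · exact congrArg List.ofFn (funext fun v => bit01_inj.2 (by simp [Fin.val_inj]))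
  · refine time_le (hCd N) (hlen.symm.trans_le (length_le_bitLength _)) le_rfl ht₀ ?_
    simp only [RAMProg.bound, hpre]
    lia

theorem fptDecidable_maxCut {α : ℕ}
    (hfind : FPTSolvable encodeGraph (InBW α) (bwParam α) (IsOptimalBubblePartitionOutput α)) :
    FPTDecidable (fun x : FinGraph × ℕ => encodeGraph x.1 ++ [x.2])
    (fun x => InBW α x.1) (fun x => bwParam α x.1)
    (fun x => ∃ S : Finset (Fin x.1.1), x.2 ≤ cutSize x.1.2 S) := by
  obtain ⟨p, f, c, hf, hp⟩ := hfind
  -- The last entry of the input is the threshold. Its index equals the length of the encoding of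
  -- the graph, so register 4 serves both for reading it and as the length to copy.
  set pre : RAMProg := .seq (.assign 4 (.sub (.reg 0) (.num 1))) (.assign 7 (.read 0 (.reg 4)))
    with hpre
  obtain ⟨C, d, hCd⟩ := bound_poly (.seq pre (.seq copyProg (.seq (mainProg α) outputTest)))
  refine ⟨.seq pre (.seq (cutProg α p) outputTest), _, (α + 1) * d + c, computable_param hf C α d,
    ?_⟩
  rintro ⟨G, m⟩ hG
  obtain ⟨out, t₀, hout, hopt, ht₀⟩ := hp G hG
  set N := loopBound G.1 α (bwParam α G) with hN
  have hlen := length_encodeGraph G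
  set s₀ := RAMState.init (encodeGraph G ++ [m]) with hs₀
  set s := (s₀.setReg 4 (RAMExpr.eval s₀ (.sub (.reg 0) (.num 1)))) with hs
  set s' := s.setReg 7 (RAMExpr.eval s (.read 0 (.reg 4))) with hs'
  have e4 : s.reg 4 = G.1 * G.1 + 1 := by
    simp [hs, hs₀, reg_setReg, RAMExpr.eval, RAMState.init, hlen]
  have e7 : s'.reg 7 = m := by
    have h1 : s.mem 0 (G.1 * G.1 + 1) = m := by
      simp [hs, hs₀, mem_setReg, RAMState.init, ← hlen]
    simp [hs', reg_setReg, RAMExpr.eval, e4, h1]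
  obtain ⟨s₁, t₁, hrun₁, ht₁, h7, hE, S, hS, -, h15⟩ := run_cutProg (s := s') hout hopt
    (by rw [hs', reg_setReg, if_neg (by decide), e4]) (fun i hi => by
      simp only [hs', hs, hs₀, mem_setReg, RAMState.init, if_true]
      rw [List.getD_append _ _ _ _ (by rw [hlen]; exact hi)])
    (fun x => by
      rw [hs', reg_setReg, if_neg (by lia), hs, reg_setReg, if_neg (by lia)]
      simp [hs₀, RAMState.init])
    (fun a i => by simp [hs', hs, hs₀, mem_setReg, RAMState.init])
  obtain ⟨s₂, t₂, hrun₂, ht₂, h₂⟩ := exec_outputTest (N := N) (h7.trans e7) h15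
  refine ⟨_, _, ⟨s₂, .seq (.seq (.assign 4 _ _) (.assign 7 _ _)) (.seq hrun₁ hrun₂), h₂⟩, ?_, ?_⟩
  · rw [bit01_inj.2]
    -- Comparing the threshold with a maximum cut decides the existence of a cut of that size.
    exact ⟨fun h => ⟨S, h⟩, fun ⟨T, hT⟩ => hT.trans (hS T)⟩
  · refine time_le (hCd N) (hlen.symm.trans_le (length_le_bitLength _)) ?_ ht₀ ?_
    · simp [bitLength]
    · simp only [RAMProg.bound, hpre]
      lia

end FinalPrograms

/-- If bubble partitions of optimal width can be found in fixed-parameter time on `BW_α`, then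
a maximum cut of a graph in `BW_α` can be found, and the problem whether a given graph in `BW_α`
has a cut of size at least a given number can be decided, in fixed-parameter time, the parameter
being the `α`-bubble width of the graph. -/
theorem mainTheorem8 (α : ℕ) (hα : 0 < α)
    (hfind : FPTSolvable encodeGraph (InBW α) (bwParam α) (IsOptimalBubblePartitionOutput α)) :
    FPTSolvable encodeGraph (InBW α) (bwParam α) IsMaxCutOutput ∧
    FPTDecidable (fun x : FinGraph × ℕ => encodeGraph x.1 ++ [x.2])
      (fun x => InBW α x.1) (fun x => bwParam α x.1)
      (fun x => ∃ S : Finset (Fin x.1.1), x.2 ≤ cutSize x.1.2 S) :=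
  ⟨fptSolvable_maxCut hfind, fptDecidable_maxCut hfind⟩
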